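/- Let $M$ be a paracompact Hausdorff smooth manifold of finite dimension $n$ without boundary, and let $\tau\colon M\to M$ be a smooth involution. A Real Hermitian line bundle on $(M,\tau)$ is a smooth complex line bundle $L\to M$ with a smooth involution $\sigma\colon L\to L$ covering $\tau$ and complex antilinear on fibres, and a smooth Hermitian metric $h$ on $L$ with $h(\sigma v,\sigma w)=\overline{h(v,w)}$ (equivalently, a Real principal $U(1)$-bundle). A Real connection on it is a connection $\nabla$ that is Hermitian, $d\,h(s,t)=h(\nabla s,t)+h(s,\nabla t)$, and commutes with the involutions, i.e. $\nabla_{d\tau X}(\sigma\circ s\circ\tau)=\sigma(\nabla_X s)$. Isomorphisms are smooth isometric complex-linear isomorphisms over $\mathrm{id}_M$ that commute with the involutions $\sigma$ and the connections. Let $i\mathbb Z$, $\overline{\mathcal A}^0$, $\overline{\mathcal A}^1$ be the sheaves on $M$ of locally constant $i\mathbb Z$-valued functions, of smooth $i\mathbb R$-valued functions and of smooth $i\mathbb R$-valued $1$-forms, with the $C_2$-action $s\mapsto\overline{\tau^*s}$, and let $\mathbb Z_{\mathcal D,\mathcal R}(2)$ be the complex of $C_2$-sheaves $i\mathbb Z\hookrightarrow\overline{\mathcal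 A}^0\xrightarrow{d}\overline{\mathcal A}^1$ with $i\mathbb Z$ in degree $0$. A $C_2$-cover without fixed points is an open cover $\mathcal U=(U_i)_{i\in I}$ with a free involution $\tau$ of $I$ such that $U_{\tau(i)}=\tau(U_i)$; its equivariant Čech cochains with coefficients in a $C_2$-sheaf $\mathcal F$ are the Čech cochains $c$ with $\overline{\tau^*c_{\tau(i_0)\dots\tau(i_q)}}=c_{i_0\dots i_q}$. Let $$H^2_{\mathcal D,\mathcal R}(M;\mathbb Z(2))=\operatorname*{colim}_{\mathcal U}H^2\bigl(\mathrm{Tot}\,\check C^*(\mathcal U,\mathbb Z_{\mathcal D,\mathcal R}(2))\bigr),$$ where the total differential on Čech degree $q$ is $\partial+(-1)^q d$ and the colimit runs over all $C_2$-covers without fixed points and their equivariant refinements. Then any two Real Hermitian line bundles with Real connection have a tensor product $(L,\nabla)\otimes(L',\nabla')=(L\otimes L',\nabla\otimes1+1\otimes\nabla')$ (with Real structure $\sigma\otimes\sigma'$ and metric $h\otimes h'$) that is again such an object; the set of isomorphism classes of Real Hermitian line bundles with Real connection is an abelian group under tensor product; and this group is isomorphic to $H^2_{\mathcal D,\mathcal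 R}(M;\mathbb Z(2))$. -/

import Mathlib

open scoped Manifold ContDiff Topology TensorProduct ComplexConjugate
open Bundle TopologicalSpace

noncomputable section

universe u

namespace RealDeligne

/-! ### Involutive spaces, `C_2`-sheaves and `C_2`-covers -/

/-- A self-inverse homeomorphism `τ` of a topological space. -/
structure Involution (M : Type u) [TopologicalSpace M] where
  toFun : M → M
  continuous_toFun : Continuous toFun
  involutive : Function.Involutive toFun

instance {M : Type u} [TopologicalSpace M] : CoeFun (Involution M) (fun _ => M → M) :=
  ⟨Involution.toFun⟩

section Topological

variable {M : Type u} [TopologicalSpace M]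

/-- The invariant translate `τ(U) = τ⁻¹(U)` of an open set. -/
def Involution.translate (τ : Involution M) (U : Opens M) : Opens M :=
  ⟨τ ⁻¹' U, U.isOpen.preimage τ.continuous_toFun⟩

theorem Involution.mem_translate (τ : Involution M) (U : Opens M) (x : M) :
    x ∈ τ.translate U ↔ τ x ∈ U := Iff.rfl

open Classical in
/-- Restriction to `V`: a section over an open set is encoded as a function on all of `M` that
vanishes outside that open set, so restricting means cutting off outside `V`. -/
def cutoff {B : M → Type} [∀ x, AddCommGroup (B x)] (V : Opens M) (s : ∀ x, B x) : ∀ x, B x :=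
  fun x => if x ∈ V then s x else 0

theorem cutoff_of_mem {B : M → Type} [∀ x, AddCommGroup (B x)] {V : Opens M} {s : ∀ x, B x}
    {x : M} (h : x ∈ V) : cutoff V s x = s x := if_pos h

theorem cutoff_of_notMem {B : M → Type} [∀ x, AddCommGroup (B x)] {V : Opens M} {s : ∀ x, B x}
    {x : M} (h : x ∉ V) : cutoff V s x = 0 := if_neg h

/-- A `C_2`-sheaf of abelian groups on `(M, τ)` whose sections over `U` are functions
`x ↦ s x ∈ B x` on `U` (encoded as functions on `M` vanishing outside `U`). The involution sends a
section `s` over `U` to the section `x ↦ act x (s (τ x))` over `τ(U)`. -/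
structure C2Sheaf (τ : Involution M) where
  B : M → Type
  [group : ∀ x, AddCommGroup (B x)]
  act : ∀ x, B (τ x) →+ B x
  sec : Opens M → AddSubgroup (∀ x, B x)
  eq_zero : ∀ {U : Opens M} {s : ∀ x, B x}, s ∈ sec U → ∀ x ∉ U, s x = 0
  restrict : ∀ {U V : Opens M} {s : ∀ x, B x}, V ≤ U → s ∈ sec U → cutoff V s ∈ sec V
  glue : ∀ {U : Opens M} {s : ∀ x, B x}, (∀ x ∉ U, s x = 0) →
    (∀ x ∈ U, ∃ V : Opens M, x ∈ V ∧ V ≤ U ∧ cutoff V s ∈ sec V) → s ∈ sec U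
  act_mem : ∀ {U : Opens M} {s : ∀ x, B x}, s ∈ sec U →
    (fun x => act x (s (τ x))) ∈ sec (τ.translate U)
  act_act : ∀ (s : ∀ x, B x) (x : M), act x (act (τ x) (s (τ (τ x)))) = s x

attribute [instance] C2Sheaf.group

/-- A morphism of `C_2`-sheaves: homomorphisms on sections over every open set, commuting with
restriction and with the involutions. -/
structure C2Sheaf.Hom {τ : Involution M} (F G : C2Sheaf τ) where
  app : ∀ U : Opens M, F.sec U →+ G.sec U
  app_restrict : ∀ {U V : Opens M} (h : V ≤ U) (s : F.sec U),
    (app V ⟨cutoff V s.1, F.restrict h s.2⟩).1 = cutoff V (app U s).1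
  app_act : ∀ {U : Opens M} (s : F.sec U),
    (app (τ.translate U) ⟨fun x => F.act x (s.1 (τ x)), F.act_mem s.2⟩).1 =
      fun x => G.act x ((app U s).1 (τ x))

/-- A complex `F0 → F1 → F2 → 0 → ⋯` of `C_2`-sheaves, with `F0` in degree `0`. -/
structure C2Complex (τ : Involution M) where
  F0 : C2Sheaf τ
  F1 : C2Sheaf τ
  F2 : C2Sheaf τ
  d0 : C2Sheaf.Hom F0 F1
  d1 : C2Sheaf.Hom F1 F2
  d_d : ∀ (U : Opens M) (s : F0.sec U), d1.app U (d0.app U s) = 0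

/-- A `C_2`-cover without fixed points: an open cover `(U_i)` with a free involution `i ↦ τ(i)` of
the index set such that `U_{τ(i)} = τ(U_i)`. -/
structure C2Cover (τ : Involution M) where
  ι : Type u
  U : ι → Opens M
  covers : ∀ x, ∃ i, x ∈ U i
  inv : ι → ι
  inv_inv : ∀ i, inv (inv i) = i
  inv_free : ∀ i, inv i ≠ i
  U_inv : ∀ i, U (inv i) = τ.translate (U i)

namespace C2Cover

variable {τ : Involution M}

/-- The intersection `U_{i_0} ∩ ⋯ ∩ U_{i_q}`. -/
def inter (𝒰 : C2Cover τ) {q : ℕ} (s : Fin (q + 1) → 𝒰.ι) : Opens M :=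
  ⟨⋂ k, (𝒰.U (s k) : Set M), isOpen_iInter_of_finite fun k => (𝒰.U (s k)).isOpen⟩

theorem mem_inter {𝒰 : C2Cover τ} {q : ℕ} {s : Fin (q + 1) → 𝒰.ι} {x : M} :
    x ∈ 𝒰.inter s ↔ ∀ k, x ∈ 𝒰.U (s k) :=
  Set.mem_iInter

theorem mem_inter_inv {𝒰 : C2Cover τ} {q : ℕ} {s : Fin (q + 1) → 𝒰.ι} {x : M} :
    τ x ∈ 𝒰.inter (𝒰.inv ∘ s) ↔ x ∈ 𝒰.inter s := by
  simp only [mem_inter, Function.comp_apply, U_inv, Involution.mem_translate, τ.involutive x]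

theorem inter_le_face {𝒰 : C2Cover τ} {q : ℕ} (s : Fin (q + 2) → 𝒰.ι) (k : Fin (q + 2)) :
    𝒰.inter s ≤ 𝒰.inter (s ∘ k.succAbove) :=
  fun _ hx => mem_inter.2 fun j => mem_inter.1 hx (k.succAbove j)

/-- The group `Č^q(𝒰, F)` of equivariant Čech cochains. -/
def cochain (𝒰 : C2Cover τ) (F : C2Sheaf τ) (q : ℕ) :
    AddSubgroup ((Fin (q + 1) → 𝒰.ι) → ∀ x, F.B x) where
  carrier := {c | (∀ s, c s ∈ F.sec (𝒰.inter s)) ∧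
    ∀ s x, F.act x (c (𝒰.inv ∘ s) (τ x)) = c s x}
  zero_mem' := ⟨fun _ => zero_mem _, fun s x => map_zero (F.act x)⟩
  add_mem' := fun ha hb => ⟨fun s => add_mem (ha.1 s) (hb.1 s), fun s x => by
    simp [ha.2 s x, hb.2 s x]⟩
  neg_mem' := fun ha => ⟨fun s => neg_mem (ha.1 s), fun s x => by
    simp [ha.2 s x]⟩

theorem cutoff_sum_mem (F : C2Sheaf τ) {α : Type} [Fintype α] {V : Opens M} {U : α → Opens M}
    (hV : ∀ a, V ≤ U a) (m : α → ℤ) (c : α → ∀ x, F.B x) (hc : ∀ a, c a ∈ F.sec (U a)) :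
    cutoff V (fun x => ∑ a, m a • c a x) ∈ F.sec V := by
  have h : cutoff V (fun x => ∑ a, m a • c a x) = ∑ a, m a • cutoff V (c a) := by
    funext x
    by_cases hx : x ∈ V
    · simp [cutoff_of_mem hx]
    · simp [cutoff_of_notMem hx]
  rw [h]
  exact sum_mem fun a _ => zsmul_mem (F.restrict (hV a) (hc a)) _

/-- The Čech coboundary `(∂c)_{i_0 … i_{q+1}} = ∑_k (-1)^k c_{i_0 … î_k … i_{q+1}}`. -/
def coboundary (𝒰 : C2Cover τ) (F : C2Sheaf τ) (q : ℕ) :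
    𝒰.cochain F q →+ 𝒰.cochain F (q + 1) where
  toFun c := ⟨fun s => cutoff (𝒰.inter s)
      fun x => ∑ k : Fin (q + 2), ((-1) ^ (k : ℕ) : ℤ) • c.1 (s ∘ k.succAbove) x, by
    refine ⟨fun s => cutoff_sum_mem F (inter_le_face s) _ _ fun k => c.2.1 _, fun s x => ?_⟩
    by_cases hx : x ∈ 𝒰.inter s
    · dsimp only
      rw [cutoff_of_mem hx, cutoff_of_mem (mem_inter_inv.2 hx), map_sum]
      refine Finset.sum_congr rfl fun k _ => ?_
      rw [map_zsmul, ← c.2.2 (s ∘ k.succAbove) x]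
      rfl
    · dsimp only
      rw [cutoff_of_notMem hx, cutoff_of_notMem (fun h => hx (mem_inter_inv.1 h)), map_zero]⟩
  map_zero' := by
    ext s x
    simp [cutoff]
  map_add' a b := by
    ext s x
    by_cases hx : x ∈ 𝒰.inter s
    · simp [cutoff_of_mem hx, Finset.sum_add_distrib]
    · simp [cutoff_of_notMem hx]

theorem app_congr {F G : C2Sheaf τ} (f : C2Sheaf.Hom F G) {U V : Opens M} (h : U = V)
    (s : F.sec U) (t : F.sec V) (hst : s.1 = t.1) : (f.app U s).1 = (f.app V t).1 := by
  subst h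
  rw [Subtype.ext hst]

theorem translate_inter (𝒰 : C2Cover τ) {q : ℕ} (s : Fin (q + 1) → 𝒰.ι) :
    τ.translate (𝒰.inter (𝒰.inv ∘ s)) = 𝒰.inter s :=
  Opens.ext (Set.ext fun _ => mem_inter_inv)

/-- The map on equivariant cochains induced by a morphism of `C_2`-sheaves. -/
def mapCochain (𝒰 : C2Cover τ) {F G : C2Sheaf τ} (f : C2Sheaf.Hom F G) (q : ℕ) :
    𝒰.cochain F q →+ 𝒰.cochain G q where
  toFun c := ⟨fun s => (f.app (𝒰.inter s) ⟨c.1 s, c.2.1 s⟩).1, by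
    refine ⟨fun s => (f.app _ _).2, fun s x => ?_⟩
    have h := congrFun (f.app_act ⟨c.1 (𝒰.inv ∘ s), c.2.1 _⟩) x
    rw [← h]
    exact congrFun (app_congr f (translate_inter 𝒰 s) _ _ (funext (c.2.2 s))) x⟩
  map_zero' := by
    ext s x
    exact congrFun (congrArg Subtype.val (map_zero (f.app (𝒰.inter s)))) x
  map_add' a b := by
    ext s x
    exact congrFun (congrArg Subtype.val
      (map_add (f.app (𝒰.inter s)) ⟨a.1 s, a.2.1 s⟩ ⟨b.1 s, b.2.1 s⟩)) x

/-- A refinement `𝒱 → 𝒰`: an equivariant map `r` of index sets with `V_i ⊆ U_{r(i)}`. -/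
structure Refinement (𝒱 𝒰 : C2Cover τ) where
  r : 𝒱.ι → 𝒰.ι
  r_inv : ∀ i, r (𝒱.inv i) = 𝒰.inv (r i)
  le : ∀ i, 𝒱.U i ≤ 𝒰.U (r i)

theorem Refinement.inter_le {𝒱 𝒰 : C2Cover τ} (ρ : Refinement 𝒱 𝒰) {q : ℕ}
    (s : Fin (q + 1) → 𝒱.ι) : 𝒱.inter s ≤ 𝒰.inter (ρ.r ∘ s) :=
  fun _ hx => mem_inter.2 fun k => ρ.le _ (mem_inter.1 hx k)

/-- Pullback of cochains along a refinement. -/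
def Refinement.pull {𝒱 𝒰 : C2Cover τ} (ρ : Refinement 𝒱 𝒰) (F : C2Sheaf τ) (q : ℕ) :
    𝒰.cochain F q →+ 𝒱.cochain F q where
  toFun c := ⟨fun s => cutoff (𝒱.inter s) (c.1 (ρ.r ∘ s)), by
    refine ⟨fun s => F.restrict (ρ.inter_le s) (c.2.1 _), fun s x => ?_⟩
    by_cases hx : x ∈ 𝒱.inter s
    · dsimp only
      rw [cutoff_of_mem hx, cutoff_of_mem (mem_inter_inv.2 hx), ← c.2.2 (ρ.r ∘ s) x]
      have : ρ.r ∘ 𝒱.inv ∘ s = 𝒰.inv ∘ ρ.r ∘ s := funext fun k => ρ.r_inv (s k)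
      rw [this]
    · dsimp only
      rw [cutoff_of_notMem hx, cutoff_of_notMem (fun h => hx (mem_inter_inv.1 h)), map_zero]⟩
  map_zero' := by
    ext s x
    simp [cutoff]
  map_add' a b := by
    ext s x
    by_cases hx : x ∈ 𝒱.inter s
    · simp [cutoff_of_mem hx]
    · simp [cutoff_of_notMem hx]

theorem Refinement.pull_coboundary {𝒱 𝒰 : C2Cover τ} (ρ : Refinement 𝒱 𝒰) (F : C2Sheaf τ) (q : ℕ)
    (c : 𝒰.cochain F q) :
    𝒱.coboundary F q (ρ.pull F q c) = ρ.pull F (q + 1) (𝒰.coboundary F q c) := by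
  ext s x
  by_cases hx : x ∈ 𝒱.inter s
  · have hx' : x ∈ 𝒰.inter (ρ.r ∘ s) := ρ.inter_le s hx
    simp only [coboundary, pull, AddMonoidHom.coe_mk, ZeroHom.coe_mk, cutoff_of_mem hx,
      cutoff_of_mem hx']
    refine Finset.sum_congr rfl fun k _ => ?_
    rw [cutoff_of_mem (inter_le_face s k hx)]
    rfl
  · simp only [coboundary, pull, AddMonoidHom.coe_mk, ZeroHom.coe_mk, cutoff_of_notMem hx]

theorem Refinement.pull_mapCochain {𝒱 𝒰 : C2Cover τ} (ρ : Refinement 𝒱 𝒰) {F G : C2Sheaf τ}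
    (f : C2Sheaf.Hom F G) (q : ℕ) (c : 𝒰.cochain F q) :
    𝒱.mapCochain f q (ρ.pull F q c) = ρ.pull G q (𝒰.mapCochain f q c) := by
  ext s x
  exact congrFun (f.app_restrict (ρ.inter_le s) ⟨c.1 (ρ.r ∘ s), c.2.1 _⟩) x

/-! ### Degree two equivariant Čech hypercohomology -/

variable (𝒰 𝒱 : C2Cover τ) (K : C2Complex τ)

/-- The total complex in degree one. -/
abbrev T1 := 𝒰.cochain K.F0 1 × 𝒰.cochain K.F1 0

/-- The total complex in degree two. -/
abbrev T2 := 𝒰.cochain K.F0 2 × 𝒰.cochain K.F1 1 × 𝒰.cochain K.F2 0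

/-- The total complex in degree three. -/
abbrev T3 := 𝒰.cochain K.F0 3 × 𝒰.cochain K.F1 2 × 𝒰.cochain K.F2 1

/-- The differential `T1 → T2` of the total complex, given by `∂ + (-1)^q d` on `Č^q`. -/
def D1 : 𝒰.T1 K →+ 𝒰.T2 K where
  toFun c := (𝒰.coboundary K.F0 1 c.1,
    𝒰.coboundary K.F1 0 c.2 - 𝒰.mapCochain K.d0 1 c.1,
    𝒰.mapCochain K.d1 0 c.2)
  map_zero' := by simp
  map_add' a b := by
    ext1
    · simp
    · ext1
      · simp only [Prod.fst_add, Prod.snd_add, map_add]; abel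
      · simp

/-- The differential `T2 → T3` of the total complex, given by `∂ + (-1)^q d` on `Č^q`. -/
def D2 : 𝒰.T2 K →+ 𝒰.T3 K where
  toFun c := (𝒰.coboundary K.F0 2 c.1,
    𝒰.coboundary K.F1 1 c.2.1 + 𝒰.mapCochain K.d0 2 c.1,
    𝒰.coboundary K.F2 0 c.2.2 - 𝒰.mapCochain K.d1 1 c.2.1)
  map_zero' := by simp
  map_add' a b := by
    ext1
    · simp
    · ext1 <;> simp only [Prod.fst_add, Prod.snd_add, map_add] <;> abel

/-- The hypercohomology group `ℍ²(𝒰, C_2; K) = ker D2 / im D1` of a `C_2`-cover. -/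
abbrev H2 := (𝒰.D2 K).ker ⧸ (𝒰.D1 K).range.addSubgroupOf (𝒰.D2 K).ker

variable {𝒰 𝒱}

def Refinement.pullT1 (ρ : Refinement 𝒱 𝒰) : 𝒰.T1 K →+ 𝒱.T1 K :=
  (ρ.pull K.F0 1).prodMap (ρ.pull K.F1 0)

def Refinement.pullT2 (ρ : Refinement 𝒱 𝒰) : 𝒰.T2 K →+ 𝒱.T2 K :=
  (ρ.pull K.F0 2).prodMap ((ρ.pull K.F1 1).prodMap (ρ.pull K.F2 0))

def Refinement.pullT3 (ρ : Refinement 𝒱 𝒰) : 𝒰.T3 K →+ 𝒱.T3 K :=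
  (ρ.pull K.F0 3).prodMap ((ρ.pull K.F1 2).prodMap (ρ.pull K.F2 1))

theorem Refinement.D1_pull (ρ : Refinement 𝒱 𝒰) (c : 𝒰.T1 K) :
    𝒱.D1 K (ρ.pullT1 K c) = ρ.pullT2 K (𝒰.D1 K c) := by
  simp [D1, pullT1, pullT2, pull_coboundary, pull_mapCochain]

theorem Refinement.D2_pull (ρ : Refinement 𝒱 𝒰) (c : 𝒰.T2 K) :
    𝒱.D2 K (ρ.pullT2 K c) = ρ.pullT3 K (𝒰.D2 K c) := by
  simp [D2, pullT2, pullT3, pull_coboundary, pull_mapCochain]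

def Refinement.pullCocycle (ρ : Refinement 𝒱 𝒰) : (𝒰.D2 K).ker →+ (𝒱.D2 K).ker :=
  ((ρ.pullT2 K).comp (𝒰.D2 K).ker.subtype).codRestrict _ fun c => by
    have h : 𝒰.D2 K c.1 = 0 := c.2
    simp [AddMonoidHom.mem_ker, ρ.D2_pull K, h]

/-- The map `ℍ²(𝒰, C_2; K) → ℍ²(𝒱, C_2; K)` induced by a refinement `𝒱 → 𝒰`. -/
def Refinement.mapH2 (ρ : Refinement 𝒱 𝒰) : 𝒰.H2 K →+ 𝒱.H2 K :=
  QuotientAddGroup.map _ _ (ρ.pullCocycle K) (by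
    rintro c ⟨b, hb⟩
    exact ⟨ρ.pullT1 K b, by rw [ρ.D1_pull, hb]; rfl⟩)

end C2Cover

open Classical in
/-- The relations `a ~ ρ^* a` defining the colimit over refinements. -/
def hypercohomologyRelations {τ : Involution M} (K : C2Complex τ) :
    AddSubgroup (DirectSum (C2Cover τ) fun 𝒰 => 𝒰.H2 K) :=
  AddSubgroup.closure {z | ∃ (𝒰 𝒱 : C2Cover τ) (ρ : C2Cover.Refinement 𝒱 𝒰) (a : 𝒰.H2 K),
    z = DirectSum.of (fun 𝒲 : C2Cover τ => 𝒲.H2 K) 𝒱 (ρ.mapH2 K a) -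
      DirectSum.of (fun 𝒲 : C2Cover τ => 𝒲.H2 K) 𝒰 a}

/-- The equivariant Čech hypercohomology `ℍ²(M, C_2; K)`: the colimit of the abelian groups
`ℍ²(𝒰, C_2; K)` over all `C_2`-covers and their refinements. -/
abbrev Hypercohomology2 {τ : Involution M} (K : C2Complex τ) :=
  (DirectSum (C2Cover τ) fun 𝒰 => 𝒰.H2 K) ⧸ hypercohomologyRelations K

end Topological

/-! ### Smooth forms and the Real Deligne complex -/

section Smooth

variable (n : ℕ) (M : Type u) [TopologicalSpace M] [ChartedSpace (EuclideanSpace ℝ (Fin n)) M]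

/-- A smooth involution of an `n`-dimensional manifold `M`. -/
structure SmoothInvolution extends Involution M where
  contMDiff_toFun : ContMDiff (𝓡 n) (𝓡 n) ∞ toFun

instance : CoeFun (SmoothInvolution n M) (fun _ => M → M) := ⟨fun τ => τ.toFun⟩

variable {n M}

/-- Smoothness at `x` of a complex-valued one-form, as a section of `Hom(TM, M × ℂ)`. -/
def SmoothFormAt [IsManifold (𝓡 n) ∞ M] (α : ∀ x : M, TangentSpace (𝓡 n) x →L[ℝ] ℂ) (x : M) :
    Prop :=
  ContMDiffAt (𝓡 n) ((𝓡 n).prod 𝓘(ℝ, EuclideanSpace ℝ (Fin n) →L[ℝ] ℂ)) ∞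
    (fun y => TotalSpace.mk' (EuclideanSpace ℝ (Fin n) →L[ℝ] ℂ)
      (E := fun z : M => TangentSpace (𝓡 n) z →L[ℝ] Trivial M ℂ z) y (α y)) x

section forms

variable [IsManifold (𝓡 n) ∞ M]

theorem smoothFormAt_iff (α : ∀ x : M, TangentSpace (𝓡 n) x →L[ℝ] ℂ) (x : M) :
    SmoothFormAt α x ↔ ContMDiffAt (𝓡 n) 𝓘(ℝ, EuclideanSpace ℝ (Fin n) →L[ℝ] ℂ) ∞
      (fun y => ContinuousLinearMap.inCoordinates (EuclideanSpace ℝ (Fin n))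
        (TangentSpace (𝓡 n) (M := M)) ℂ (Trivial M ℂ) x y x y (α y)) x := by
  unfold SmoothFormAt
  rw [contMDiffAt_hom_bundle]
  exact and_iff_right contMDiffAt_id

theorem smoothFormAt_mvfderiv {f : M → ℂ} {x : M} (hf : ContMDiffAt (𝓡 n) 𝓘(ℝ, ℂ) ∞ f x) :
    SmoothFormAt (fun y => mvfderiv (𝓡 n) f y) x := by
  rw [smoothFormAt_iff]
  refine (hf.mfderiv_const (m := ∞) (by simp)).congr_of_eventuallyEq (.of_forall fun y => ?_)
  ext v
  simp only [mvfderiv, ContinuousLinearMap.inCoordinates, inTangentCoordinates]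
  simp
  rfl

theorem SmoothFormAt.congr {α β : ∀ x : M, TangentSpace (𝓡 n) x →L[ℝ] ℂ} {x : M}
    (h : SmoothFormAt α x) (hb : ∀ᶠ y in 𝓝 x, β y = α y) : SmoothFormAt β x :=
  ContMDiffAt.congr_of_eventuallyEq h (hb.mono fun y hy => by simp only [hy])

theorem SmoothFormAt.pullback {τ : M → M} (hτ : ContMDiff (𝓡 n) (𝓡 n) ∞ τ)
    {α : ∀ x : M, TangentSpace (𝓡 n) x →L[ℝ] ℂ} {x : M} (h : SmoothFormAt α (τ x))
    (L : ℂ →L[ℝ] ℂ) :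
    SmoothFormAt (fun y => L ∘L (α (τ y)) ∘L (mfderiv (𝓡 n) (𝓡 n) τ y)) x := by
  rw [smoothFormAt_iff] at h ⊢
  have h1 := h.comp x (hτ x)
  have h2 := (hτ x).mfderiv_const (m := ∞) (by simp)
  have h3 : ContMDiffAt (𝓡 n) 𝓘(ℝ, EuclideanSpace ℝ (Fin n) →L[ℝ] ℂ) ∞ _ x :=
    (contMDiffAt_const (c := L)).clm_comp (h1.clm_comp h2)
  refine h3.congr_of_eventuallyEq ?_
  let e := trivializationAt (EuclideanSpace ℝ (Fin n)) (TangentSpace (𝓡 n) (M := M)) (τ x)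
  have hb : τ ⁻¹' e.baseSet ∈ 𝓝 x :=
    hτ.continuous.continuousAt.preimage_mem_nhds
      (e.open_baseSet.mem_nhds (FiberBundle.mem_baseSet_trivializationAt' _))
  filter_upwards [hb] with y hy
  ext v
  have key := fun w => e.symmL_continuousLinearMapAt (R := ℝ) hy w
  simp [inTangentCoordinates, ContinuousLinearMap.inCoordinates]
  exact congrArg (fun w => L (α (τ y) w)) (key _).symm

end forms

theorem eventually_cutoff {B : M → Type} [∀ x, AddCommGroup (B x)] {V : Opens M}
    (s : ∀ x, B x) {x : M} (hx : x ∈ V) : ∀ᶠ y in 𝓝 x, cutoff V s y = s y :=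
  Filter.mem_of_superset (V.isOpen.mem_nhds hx) fun _ hy => cutoff_of_mem hy

/-- Complex conjugation as a homomorphism of additive groups. -/
def conjHom : ℂ →+ ℂ := (starRingEnd ℂ).toAddMonoidHom

/-- The `C_2`-sheaf `iℤ` of locally constant functions with values in `iℤ ⊆ ℂ`; the involution is
`s ↦ conj ∘ s ∘ τ`. -/
abbrev sheafIZ (τ : SmoothInvolution n M) : C2Sheaf τ.toInvolution where
  B _ := ℂ
  act _ := conjHom
  sec U :=
    { carrier := {f | (∀ x ∉ U, f x = 0) ∧
        ∀ x ∈ U, ∃ k : ℤ, ∀ᶠ y in 𝓝 x, f y = k * Complex.I}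
      zero_mem' := ⟨fun _ _ => rfl, fun _ _ => ⟨0, by simp⟩⟩
      add_mem' := by
        rintro f g ⟨hf, hf'⟩ ⟨hg, hg'⟩
        refine ⟨fun x hx => by simp [hf x hx, hg x hx], fun x hx => ?_⟩
        obtain ⟨k, hk⟩ := hf' x hx
        obtain ⟨l, hl⟩ := hg' x hx
        refine ⟨k + l, ?_⟩
        filter_upwards [hk, hl] with y h1 h2
        simp [h1, h2, add_mul]
      neg_mem' := by
        rintro f ⟨hf, hf'⟩
        refine ⟨fun x hx => by simp [hf x hx], fun x hx => ?_⟩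
        obtain ⟨k, hk⟩ := hf' x hx
        refine ⟨-k, ?_⟩
        filter_upwards [hk] with y h1
        simp [h1] }
  eq_zero h := h.1
  restrict {U V s} hV h := ⟨fun x hx => cutoff_of_notMem hx, fun x hx => by
    obtain ⟨k, hk⟩ := h.2 x (hV hx)
    refine ⟨k, ?_⟩
    filter_upwards [hk, eventually_cutoff (B := fun _ => ℂ) s hx] with y h1 h2
    rw [h2, h1]⟩
  glue {U s} h0 h := ⟨h0, fun x hx => by
    obtain ⟨V, hxV, -, hV⟩ := h x hx
    obtain ⟨k, hk⟩ := hV.2 x hxV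
    refine ⟨k, ?_⟩
    filter_upwards [hk, eventually_cutoff (B := fun _ => ℂ) s hxV] with y h1 h2
    rw [← h2, h1]⟩
  act_mem {U s} h := ⟨fun x hx => by
      have : s (τ x) = 0 := h.1 _ hx
      simp [this], fun x hx => by
    obtain ⟨k, hk⟩ := h.2 (τ x) hx
    refine ⟨-k, ?_⟩
    filter_upwards [τ.continuous_toFun.continuousAt.eventually hk] with y h1
    simp [conjHom, h1]⟩
  act_act s x := by
    change starRingEnd ℂ (starRingEnd ℂ (s (τ (τ x)))) = s x
    rw [Complex.conj_conj, τ.involutive x]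

/-- The `C_2`-sheaf of smooth `iℝ`-valued functions; the involution is `f ↦ conj ∘ f ∘ τ`. -/
abbrev sheafA0 (τ : SmoothInvolution n M) : C2Sheaf τ.toInvolution where
  B _ := ℂ
  act _ := conjHom
  sec U :=
    { carrier := {f | (∀ x ∉ U, f x = 0) ∧ (∀ x, (f x).re = 0) ∧
        ∀ x ∈ U, ContMDiffAt (𝓡 n) 𝓘(ℝ, ℂ) ∞ f x}
      zero_mem' := ⟨fun _ _ => rfl, fun _ => rfl, fun _ _ => contMDiffAt_const⟩
      add_mem' := by
        rintro f g ⟨hf, hf', hf''⟩ ⟨hg, hg', hg''⟩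
        exact ⟨fun x hx => by simp [hf x hx, hg x hx], fun x => by simp [hf' x, hg' x],
          fun x hx => (hf'' x hx).add (hg'' x hx)⟩
      neg_mem' := by
        rintro f ⟨hf, hf', hf''⟩
        exact ⟨fun x hx => by simp [hf x hx], fun x => by simp [hf' x],
          fun x hx => (hf'' x hx).neg⟩ }
  eq_zero h := h.1
  restrict {U V s} hV h := ⟨fun x hx => cutoff_of_notMem hx, fun x => by
      by_cases hx : x ∈ V
      · rw [cutoff_of_mem (B := fun _ => ℂ) hx, h.2.1]
      · rw [cutoff_of_notMem (B := fun _ => ℂ) hx, Complex.zero_re],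
    fun x hx => (h.2.2 x (hV hx)).congr_of_eventuallyEq (eventually_cutoff s hx)⟩
  glue {U s} h0 h := ⟨h0, fun x => by
      by_cases hx : x ∈ U
      · obtain ⟨V, hxV, -, hV⟩ := h x hx
        rw [← cutoff_of_mem (B := fun _ => ℂ) (s := s) hxV, hV.2.1]
      · rw [h0 x hx, Complex.zero_re], fun x hx => by
    obtain ⟨V, hxV, -, hV⟩ := h x hx
    exact (hV.2.2 x hxV).congr_of_eventuallyEq
      ((eventually_cutoff (B := fun _ => ℂ) s hxV).mono fun _ hy => hy.symm)⟩
  act_mem {U s} h := ⟨fun x hx => by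
      have : s (τ x) = 0 := h.1 _ hx
      simp [this], fun x => by
      change (starRingEnd ℂ (s (τ x))).re = 0
      rw [Complex.conj_re, h.2.1], fun x hx =>
    (Complex.conjCLE.contDiff.contMDiff (n := ∞)).contMDiffAt.comp x
      ((h.2.2 (τ x) hx).comp x (τ.contMDiff_toFun x))⟩
  act_act s x := by
    change starRingEnd ℂ (starRingEnd ℂ (s (τ (τ x)))) = s x
    rw [Complex.conj_conj, τ.involutive x]

/-- The conjugate pullback `v ↦ conj (α (dτ v))` of a covector `α` at `τ x`. -/
def conjPullback (τ : SmoothInvolution n M) (x : M) :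
    (TangentSpace (𝓡 n) (τ x) →L[ℝ] ℂ) →+ (TangentSpace (𝓡 n) x →L[ℝ] ℂ) where
  toFun α := (Complex.conjCLE : ℂ →L[ℝ] ℂ) ∘L α ∘L mfderiv (𝓡 n) (𝓡 n) τ x
  map_zero' := by ext v; simp
  map_add' α β := by ext v; simp

theorem conjPullback_apply (τ : SmoothInvolution n M) (x : M)
    (α : TangentSpace (𝓡 n) (τ x) →L[ℝ] ℂ) (v : TangentSpace (𝓡 n) x) :
    conjPullback τ x α v = conj (α (mfderiv (𝓡 n) (𝓡 n) τ x v)) := rfl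

theorem mfderiv_mfderiv_apply (τ : SmoothInvolution n M) (x : M)
    (s : ∀ x : M, TangentSpace (𝓡 n) x →L[ℝ] ℂ) (v : TangentSpace (𝓡 n) x) :
    s (τ (τ x)) (mfderiv (𝓡 n) (𝓡 n) τ (τ x) (mfderiv (𝓡 n) (𝓡 n) τ x v)) = s x v := by
  have hd : ∀ y, MDifferentiableAt (𝓡 n) (𝓡 n) τ y := fun y =>
    (τ.contMDiff_toFun y).mdifferentiableAt (by simp)
  have h1 : mfderiv (𝓡 n) (𝓡 n) (τ ∘ τ) x =
      (mfderiv (𝓡 n) (𝓡 n) τ (τ x)).comp (mfderiv (𝓡 n) (𝓡 n) τ x) :=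
    mfderiv_comp x (hd _) (hd _)
  have h2 : τ.toFun ∘ τ.toFun = id := funext τ.involutive
  have h3 : mfderiv (𝓡 n) (𝓡 n) τ (τ x) (mfderiv (𝓡 n) (𝓡 n) τ x v) =
      mfderiv (𝓡 n) (𝓡 n) (τ ∘ τ) x v := by rw [h1]; rfl
  rw [h3]
  have h4 : ∀ f : M → M, f = id → s (f x) (mfderiv (𝓡 n) (𝓡 n) f x v) = s x v := by
    rintro f rfl
    rw [mfderiv_id]
    rfl
  exact h4 _ h2

/-- The `C_2`-sheaf of smooth `iℝ`-valued one-forms; the involution is `α ↦ conj (τ^* α)`. -/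
abbrev sheafA1 [IsManifold (𝓡 n) ∞ M] (τ : SmoothInvolution n M) : C2Sheaf τ.toInvolution where
  B x := TangentSpace (𝓡 n) x →L[ℝ] ℂ
  act x := conjPullback τ x
  sec U :=
    { carrier := {α | (∀ x ∉ U, α x = 0) ∧ (∀ x v, (α x v).re = 0) ∧ ∀ x ∈ U, SmoothFormAt α x}
      zero_mem' := ⟨fun _ _ => rfl, fun _ _ => rfl, fun x _ =>
        contMDiff_zeroSection ℝ (fun z : M => TangentSpace (𝓡 n) z →L[ℝ] Trivial M ℂ z) x⟩
      add_mem' := by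
        rintro f g ⟨hf, hf', hf''⟩ ⟨hg, hg', hg''⟩
        exact ⟨fun x hx => by simp [hf x hx, hg x hx], fun x v => by simp [hf' x, hg' x],
          fun x hx => ContMDiffAt.add_section (hf'' x hx) (hg'' x hx)⟩
      neg_mem' := by
        rintro f ⟨hf, hf', hf''⟩
        exact ⟨fun x hx => by simp [hf x hx], fun x v => by simp [hf' x],
          fun x hx => ContMDiffAt.neg_section (hf'' x hx)⟩ }
  eq_zero h := h.1
  restrict {U V s} hV h := ⟨fun x hx => cutoff_of_notMem hx, fun x v => by
      by_cases hx : x ∈ V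
      · rw [cutoff_of_mem hx, h.2.1]
      · rw [cutoff_of_notMem hx]; rfl,
    fun x hx => (h.2.2 x (hV hx)).congr (eventually_cutoff s hx)⟩
  glue {U s} h0 h := ⟨h0, fun x v => by
      by_cases hx : x ∈ U
      · obtain ⟨V, hxV, -, hV⟩ := h x hx
        rw [← cutoff_of_mem (s := s) hxV, hV.2.1]
      · rw [h0 x hx]; rfl, fun x hx => by
    obtain ⟨V, hxV, -, hV⟩ := h x hx
    exact (hV.2.2 x hxV).congr ((eventually_cutoff s hxV).mono fun _ hy => hy.symm)⟩
  act_mem {U s} h := ⟨fun x hx => by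
      have : s (τ x) = 0 := h.1 _ hx
      simp [this], fun x v => by
      change (starRingEnd ℂ (s (τ x) (mfderiv (𝓡 n) (𝓡 n) τ x v))).re = 0
      rw [Complex.conj_re, h.2.1], fun x hx =>
    SmoothFormAt.pullback τ.contMDiff_toFun (h.2.2 (τ x) hx) (Complex.conjCLE : ℂ →L[ℝ] ℂ)⟩
  act_act s x := by
    ext v
    change starRingEnd ℂ (starRingEnd ℂ (s (τ (τ x)) (mfderiv (𝓡 n) (𝓡 n) τ (τ x)
      (mfderiv (𝓡 n) (𝓡 n) τ x v)))) = s x v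
    rw [Complex.conj_conj, mfderiv_mfderiv_apply]

/-- The inclusion `iℤ → iA^0`. -/
def inclIZ (τ : SmoothInvolution n M) : C2Sheaf.Hom (sheafIZ τ) (sheafA0 τ) where
  app U :=
    { toFun := fun f => ⟨f.1, f.2.1, fun x => by
          by_cases hx : x ∈ U
          · obtain ⟨k, hk⟩ := f.2.2 x hx
            rw [hk.self_of_nhds]
            simp
          · rw [f.2.1 x hx]; rfl, fun x hx => by
        obtain ⟨k, hk⟩ := f.2.2 x hx
        exact contMDiffAt_const.congr_of_eventuallyEq hk⟩
      map_zero' := rfl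
      map_add' := fun _ _ => rfl }
  app_restrict _ _ := rfl
  app_act _ := rfl

/-- The differential `df` of a smooth function `f` on `U`, as a one-form on `U`. -/
def diffOn (U : Opens M) (f : M → ℂ) : ∀ x : M, TangentSpace (𝓡 n) x →L[ℝ] ℂ :=
  cutoff U fun x => mvfderiv (𝓡 n) f x

theorem diffOn_of_mem {U : Opens M} {f : M → ℂ} {x : M} (hx : x ∈ U) :
    diffOn (n := n) U f x = mvfderiv (𝓡 n) f x := cutoff_of_mem hx

theorem diffOn_of_notMem {U : Opens M} {f : M → ℂ} {x : M} (hx : x ∉ U) :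
    diffOn (n := n) U f x = 0 := cutoff_of_notMem hx

theorem mvfderiv_clm_comp {F : Type} [NormedAddCommGroup F] [NormedSpace ℝ F]
    (L : ℂ →L[ℝ] F) {f : M → ℂ} {x : M} (hf : MDifferentiableAt (𝓡 n) 𝓘(ℝ, ℂ) f x) :
    mvfderiv (𝓡 n) (fun y => L (f y)) x = L ∘L mvfderiv (𝓡 n) f x := by
  have h := (L.hasMFDerivAt (x := f x)).comp x hf.hasMFDerivAt
  ext v
  have := congrArg (fun T => T v) h.mfderiv
  exact this

theorem diffOn_re {U : Opens M} {f : M → ℂ} (h0 : ∀ x, (f x).re = 0)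
    (hf : ∀ x ∈ U, ContMDiffAt (𝓡 n) 𝓘(ℝ, ℂ) ∞ f x) (x : M) (v : TangentSpace (𝓡 n) x) :
    (diffOn U f x v).re = 0 := by
  by_cases hx : x ∈ U
  · rw [diffOn_of_mem hx]
    have h := mvfderiv_clm_comp Complex.reCLM ((hf x hx).mdifferentiableAt (by simp))
    have h0 : (fun y => Complex.reCLM (f y)) = fun _ => 0 := funext h0
    rw [h0] at h
    have h1 := congrArg (fun T => T v) h
    rw [mvfderiv_const] at h1
    exact h1.symm
  · rw [diffOn_of_notMem hx]; rfl

theorem diffOn_zero (U : Opens M) : diffOn (n := n) U (fun _ => 0) = 0 := by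
  funext x
  by_cases hx : x ∈ U
  · rw [diffOn_of_mem hx, mvfderiv_const]; rfl
  · rw [diffOn_of_notMem hx]; rfl

theorem diffOn_add {U : Opens M} {f g : M → ℂ}
    (hf : ∀ x ∈ U, ContMDiffAt (𝓡 n) 𝓘(ℝ, ℂ) ∞ f x)
    (hg : ∀ x ∈ U, ContMDiffAt (𝓡 n) 𝓘(ℝ, ℂ) ∞ g x) :
    diffOn (n := n) U (f + g) = diffOn U f + diffOn U g := by
  funext x
  rw [Pi.add_apply]
  by_cases hx : x ∈ U
  · simp only [diffOn_of_mem hx]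
    exact mvfderiv_add ((hf x hx).mdifferentiableAt (by simp))
      ((hg x hx).mdifferentiableAt (by simp))
  · simp only [diffOn_of_notMem hx, add_zero]

theorem mvfderiv_congr_eventually {f g : M → ℂ} {x : M} (h : ∀ᶠ y in 𝓝 x, f y = g y) :
    mvfderiv (𝓡 n) f x = mvfderiv (𝓡 n) g x :=
  Filter.EventuallyEq.mfderiv_eq (I := 𝓡 n) (I' := 𝓘(ℝ, ℂ)) h

theorem diffOn_cutoff {U V : Opens M} (h : V ≤ U) (f : M → ℂ) :
    diffOn (n := n) V (cutoff (B := fun _ => ℂ) V f) = cutoff V (diffOn U f) := by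
  funext x
  by_cases hx : x ∈ V
  · rw [cutoff_of_mem hx, diffOn_of_mem hx, diffOn_of_mem (h hx)]
    exact mvfderiv_congr_eventually (eventually_cutoff (B := fun _ => ℂ) f hx)
  · rw [cutoff_of_notMem hx, diffOn_of_notMem hx]

theorem diffOn_conj (τ : SmoothInvolution n M) {U : Opens M} {f : M → ℂ}
    (hf : ∀ x ∈ U, ContMDiffAt (𝓡 n) 𝓘(ℝ, ℂ) ∞ f x) :
    diffOn (τ.translate U) (fun x => conjHom (f (τ x))) =
      fun x => conjPullback τ x (diffOn U f (τ x)) := by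
  funext x
  by_cases hx : x ∈ τ.translate U
  · rw [diffOn_of_mem hx, diffOn_of_mem (show τ x ∈ U from hx)]
    have hs : MDifferentiableAt (𝓡 n) 𝓘(ℝ, ℂ) f (τ x) :=
      (hf (τ x) hx).mdifferentiableAt (by simp)
    have ht : MDifferentiableAt (𝓡 n) (𝓡 n) τ x :=
      (τ.contMDiff_toFun x).mdifferentiableAt (by simp)
    have h1 := mvfderiv_clm_comp (Complex.conjCLE : ℂ →L[ℝ] ℂ) (hs.comp x ht)
    refine h1.trans ?_
    ext v
    rw [conjPullback_apply]
    have h2 := congrArg (fun T => T v) (mfderiv_comp x hs ht)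
    exact congrArg (starRingEnd ℂ) h2
  · rw [diffOn_of_notMem hx, diffOn_of_notMem (show τ x ∉ U from hx), map_zero]

theorem diffOn_locallyConst {U : Opens M} {f : M → ℂ}
    (hf : ∀ x ∈ U, ∃ k : ℤ, ∀ᶠ y in 𝓝 x, f y = k * Complex.I) :
    diffOn (n := n) U f = 0 := by
  funext x
  by_cases hx : x ∈ U
  · rw [diffOn_of_mem hx]
    obtain ⟨k, hk⟩ := hf x hx
    rw [mvfderiv_congr_eventually hk, mvfderiv_const]
    rfl
  · rw [diffOn_of_notMem hx]
    rfl

/-- The differential `d : iA^0 → iA^1`. -/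
def dA0 [IsManifold (𝓡 n) ∞ M] (τ : SmoothInvolution n M) :
    C2Sheaf.Hom (sheafA0 τ) (sheafA1 τ) where
  app U :=
    { toFun := fun f => ⟨diffOn U f.1, fun _ hx => diffOn_of_notMem hx,
        diffOn_re f.2.2.1 f.2.2.2,
        fun _ hx => (smoothFormAt_mvfderiv (f.2.2.2 _ hx)).congr (eventually_cutoff _ hx)⟩
      map_zero' := Subtype.ext (diffOn_zero U)
      map_add' := fun f g => Subtype.ext (diffOn_add f.2.2.2 g.2.2.2) }
  app_restrict h s := diffOn_cutoff h s.1
  app_act s := diffOn_conj τ s.2.2.2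

/-- The Real Deligne complex `ℤ(2) : iℤ → iA^0 → iA^1`, with `iℤ` in degree `0`. -/
def deligneComplex2 [IsManifold (𝓡 n) ∞ M] (τ : SmoothInvolution n M) :
    C2Complex τ.toInvolution where
  F0 := sheafIZ τ
  F1 := sheafA0 τ
  F2 := sheafA1 τ
  d0 := inclIZ τ
  d1 := dA0 τ
  d_d _ s := Subtype.ext (diffOn_locallyConst s.2.2)

/-- The Real smooth Deligne cohomology group `H²_{D,R}(M; ℤ(2))`. -/
abbrev DeligneH2 [IsManifold (𝓡 n) ∞ M] (τ : SmoothInvolution n M) :=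
  Hypercohomology2 (deligneComplex2 τ)

/-! ### Real line bundles with Real connection -/

/-- A Real line bundle over `(M, τ)`: a smooth complex line bundle with a smooth involution `σ` of
its total space covering `τ` and antilinear on fibres. (A smooth complex line bundle is a complex
topological one that, viewed over `ℝ`, has smooth transition functions. Fibres are taken in `Type`,
which contains a copy of `ℂ`, hence every line bundle up to isomorphism.) -/
structure RealLineBundle (τ : SmoothInvolution n M) where
  fiber : M → Type
  [addCommGroup : ∀ x, AddCommGroup (fiber x)]
  [module : ∀ x, Module ℂ (fiber x)]
  [topTotal : TopologicalSpace (TotalSpace ℂ fiber)]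
  [top : ∀ x, TopologicalSpace (fiber x)]
  [topAddGroup : ∀ x, IsTopologicalAddGroup (fiber x)]
  [contSMul : ∀ x, ContinuousSMul ℝ (fiber x)]
  [fiberBundle : FiberBundle ℂ fiber]
  [vectorBundle : VectorBundle ℂ ℂ fiber]
  [realVectorBundle : VectorBundle ℝ ℂ fiber]
  [smoothBundle : ContMDiffVectorBundle ∞ ℂ fiber (𝓡 n)]
  σ : ∀ x, fiber x →ₛₗ[starRingEnd ℂ] fiber (τ x)
  σ_involutive : Function.Involutive
    (fun e : TotalSpace ℂ fiber => (⟨τ e.1, σ e.1 e.2⟩ : TotalSpace ℂ fiber))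
  σ_smooth : ContMDiff ((𝓡 n).prod 𝓘(ℝ, ℂ)) ((𝓡 n).prod 𝓘(ℝ, ℂ)) ∞
    (fun e : TotalSpace ℂ fiber => (⟨τ e.1, σ e.1 e.2⟩ : TotalSpace ℂ fiber))

namespace RealLineBundle

attribute [instance] addCommGroup module topTotal top topAddGroup contSMul fiberBundle
  vectorBundle realVectorBundle smoothBundle

variable {τ : SmoothInvolution n M}

/-- Smoothness at `x` of a section. -/
def SmoothAt (L : RealLineBundle τ) (s : ∀ x, L.fiber x) (x : M) : Prop :=
  ContMDiffAt (𝓡 n) ((𝓡 n).prod 𝓘(ℝ, ℂ)) ∞ (fun y => TotalSpace.mk' ℂ y (s y)) x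

/-- Differentiability at `x` of a section. -/
def DiffAt (L : RealLineBundle τ) (s : ∀ x, L.fiber x) (x : M) : Prop :=
  MDifferentiableAt (𝓡 n) ((𝓡 n).prod 𝓘(ℝ, ℂ)) (fun y => TotalSpace.mk' ℂ y (s y)) x

/-- The involution `s ↦ σ ∘ s ∘ τ` on sections. -/
def conjSection (L : RealLineBundle τ) (s : ∀ x, L.fiber x) : ∀ x, L.fiber x :=
  fun x => cast (congrArg L.fiber (τ.involutive x)) (L.σ (τ x) (s (τ x)))

theorem conjSection_apply (L : RealLineBundle τ) (s : ∀ x, L.fiber x) (x : M) :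
    L.conjSection s (τ x) = L.σ x (s x) := by
  have h : ∀ (y : M) (hy : y = x) (h' : L.fiber (τ y) = L.fiber (τ x)),
      cast h' (L.σ y (s y)) = L.σ x (s x) := by
    rintro y rfl h'
    rfl
  exact h (τ (τ x)) (τ.involutive x) _

/-- A smooth Hermitian metric on `L` compatible with the Real structure. -/
structure HermitianMetric (L : RealLineBundle τ) where
  form : ∀ x, L.fiber x →ₗ⋆[ℂ] L.fiber x →ₗ[ℂ] ℂ
  conj_symm : ∀ x v w, conj (form x v w) = form x w v
  pos : ∀ x v, v ≠ 0 → 0 < (form x v v).re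
  smooth : ∀ s t x, L.SmoothAt s x → L.SmoothAt t x →
    ContMDiffAt (𝓡 n) 𝓘(ℝ, ℂ) ∞ (fun y => form y (s y) (t y)) x
  real : ∀ x v w, form (τ x) (L.σ x v) (L.σ x w) = conj (form x v w)

/-- A Hermitian Real connection on `(L, h)`: a smooth complex-linear covariant derivative `∇` with
`d h(s, t) = h(∇s, t) + h(s, ∇t)` that commutes with the involutions, that is,
`∇_{dτ X}(σ ∘ s ∘ τ) = σ(∇_X s)`. -/
structure RealConnection [IsManifold (𝓡 n) ∞ M] (L : RealLineBundle τ)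
    (h : L.HermitianMetric) where
  cov : CovariantDerivative (𝓡 n) ℂ L.fiber
  smooth : CovariantDerivative.ContMDiffCovariantDerivative cov ∞
  smul : ∀ (c : ℂ) (s : ∀ x, L.fiber x) (x : M), L.DiffAt s x →
    ∀ X : TangentSpace (𝓡 n) x, cov (c • s) x X = c • cov s x X
  hermitian : ∀ (s t : ∀ x, L.fiber x) (x : M), L.DiffAt s x → L.DiffAt t x →
    ∀ X : TangentSpace (𝓡 n) x, mvfderiv (𝓡 n) (fun y => h.form y (s y) (t y)) x X =
      h.form x (cov s x X) (t x) + h.form x (s x) (cov t x X)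
  real : ∀ (s : ∀ x, L.fiber x) (x : M), L.DiffAt s x → ∀ X : TangentSpace (𝓡 n) x,
    cov (L.conjSection s) (τ x) (mfderiv (𝓡 n) (𝓡 n) τ x X) = L.σ x (cov s x X)

end RealLineBundle

variable [IsManifold (𝓡 n) ∞ M]

/-- A Real Hermitian line bundle with Hermitian Real connection. -/
structure RealLineBundleWithConnection (τ : SmoothInvolution n M) extends RealLineBundle τ where
  metric : toRealLineBundle.HermitianMetric
  conn : toRealLineBundle.RealConnection metric

namespace RealLineBundleWithConnection

variable {τ : SmoothInvolution n M}

/-- An isomorphism: a smooth isometric complex-linear bundle isomorphism over the identity of `M`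
that commutes with the Real structures and with the connections. -/
structure Iso (L L' : RealLineBundleWithConnection τ) where
  map : ∀ x, L.fiber x ≃ₗ[ℂ] L'.fiber x
  smooth : ContMDiff ((𝓡 n).prod 𝓘(ℝ, ℂ)) ((𝓡 n).prod 𝓘(ℝ, ℂ)) ∞
    (fun e : TotalSpace ℂ L.fiber => (⟨e.1, map e.1 e.2⟩ : TotalSpace ℂ L'.fiber))
  smooth_symm : ContMDiff ((𝓡 n).prod 𝓘(ℝ, ℂ)) ((𝓡 n).prod 𝓘(ℝ, ℂ)) ∞
    (fun e : TotalSpace ℂ L'.fiber => (⟨e.1, (map e.1).symm e.2⟩ : TotalSpace ℂ L.fiber))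
  metric : ∀ x v w, L'.metric.form x (map x v) (map x w) = L.metric.form x v w
  real : ∀ x v, map (τ x) (L.σ x v) = L'.σ x (map x v)
  conn : ∀ (s : ∀ x, L.fiber x) (x : M), L.DiffAt s x → ∀ X : TangentSpace (𝓡 n) x,
    L'.conn.cov (fun y => map y (s y)) x X = map x (L.conn.cov s x X)

theorem Iso.diffAt {L L' : RealLineBundleWithConnection τ} (f : Iso L L') {s : ∀ x, L.fiber x}
    {x : M} (hs : L.DiffAt s x) : L'.DiffAt (fun y => f.map y (s y)) x :=
  MDifferentiableAt.comp x ((f.smooth _).mdifferentiableAt (by simp)) hs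

theorem Iso.diffAt_symm {L L' : RealLineBundleWithConnection τ} (f : Iso L L')
    {s : ∀ x, L'.fiber x} {x : M} (hs : L'.DiffAt s x) :
    L.DiffAt (fun y => (f.map y).symm (s y)) x :=
  MDifferentiableAt.comp x ((f.smooth_symm _).mdifferentiableAt (by simp)) hs

def Iso.refl (L : RealLineBundleWithConnection τ) : Iso L L where
  map x := LinearEquiv.refl ℂ (L.fiber x)
  smooth := contMDiff_id
  smooth_symm := contMDiff_id
  metric _ _ _ := rfl
  real _ _ := rfl
  conn _ _ _ _ := rfl

def Iso.symm {L L' : RealLineBundleWithConnection τ} (f : Iso L L') : Iso L' L where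
  map x := (f.map x).symm
  smooth := f.smooth_symm
  smooth_symm := f.smooth
  metric x v w := by rw [← f.metric]; simp
  real x v := by
    rw [LinearEquiv.symm_apply_eq, f.real]; simp
  conn s x hs X := by
    rw [LinearEquiv.eq_symm_apply, ← f.conn _ x (f.diffAt_symm hs) X]
    simp

def Iso.trans {L L' L'' : RealLineBundleWithConnection τ} (f : Iso L L') (g : Iso L' L'') :
    Iso L L'' where
  map x := (f.map x).trans (g.map x)
  smooth := g.smooth.comp f.smooth
  smooth_symm := f.smooth_symm.comp g.smooth_symm
  metric x v w := by simp [g.metric, f.metric]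
  real x v := by simp [f.real, g.real]
  conn s x hs X := by
    simp only [LinearEquiv.trans_apply]
    rw [g.conn _ x (f.diffAt hs) X, f.conn _ x hs X]

/-- The data exhibiting `L''` as the tensor product of `L` and `L'`: its fibres are identified with
`L_x ⊗ L'_x` smoothly, with `h'' = h ⊗ h'`, `σ'' = σ ⊗ σ'` and `∇'' = ∇ ⊗ 1 + 1 ⊗ ∇'`. -/
structure TensorIso (L L' L'' : RealLineBundleWithConnection τ) where
  map : ∀ x, L.fiber x ⊗[ℂ] L'.fiber x ≃ₗ[ℂ] L''.fiber x
  smooth : ∀ s t x, L.SmoothAt s x → L'.SmoothAt t x →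
    L''.SmoothAt (fun y => map y (s y ⊗ₜ[ℂ] t y)) x
  metric : ∀ x v w v' w', L''.metric.form x (map x (v ⊗ₜ[ℂ] v')) (map x (w ⊗ₜ[ℂ] w')) =
    L.metric.form x v w * L'.metric.form x v' w'
  real : ∀ x v v', map (τ x) (L.σ x v ⊗ₜ[ℂ] L'.σ x v') = L''.σ x (map x (v ⊗ₜ[ℂ] v'))
  conn : ∀ s t x, L.DiffAt s x → L'.DiffAt t x → ∀ X : TangentSpace (𝓡 n) x,
    L''.conn.cov (fun y => map y (s y ⊗ₜ[ℂ] t y)) x X =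
      map x (L.conn.cov s x X ⊗ₜ[ℂ] t x + s x ⊗ₜ[ℂ] L'.conn.cov t x X)

/-- The relation of being isomorphic. -/
instance setoid (τ : SmoothInvolution n M) : Setoid (RealLineBundleWithConnection τ) where
  r L L' := Nonempty (Iso L L')
  iseqv := ⟨fun L => ⟨Iso.refl L⟩, fun ⟨f⟩ => ⟨f.symm⟩, fun ⟨f⟩ ⟨g⟩ => ⟨f.trans g⟩⟩

/-- Isomorphism classes of Real Hermitian line bundles with Hermitian Real connection. -/
def Classes (τ : SmoothInvolution n M) := Quotient (setoid τ)

/-- The isomorphism class of a Real Hermitian line bundle with Hermitian Real connection. -/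
def toClass (L : RealLineBundleWithConnection τ) : Classes τ := Quotient.mk _ L

end RealLineBundleWithConnection

end Smooth

end RealDeligne

end

noncomputable section

/-! ### Calculus of complex-valued functions, coordinates and unit vectors in a Real line bundle. -/

namespace RealDeligne

variable {n : ℕ} {M : Type u} [TopologicalSpace M] [ChartedSpace (EuclideanSpace ℝ (Fin n)) M]

/-! A Real Hermitian line bundle with Real connection is encoded by unit frames `e_i` over the sets
of a `C_2`-cover with `e_{τ(i)} ∘ τ = σ ∘ e_i`. Write `e_j = exp(2π f_ij) e_i` and `∇ e_i = 2π α_i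
e_i`. The metric makes `f_ij` and `α_i` imaginary, and the Real structure makes them equivariant.
Associativity of the transition functions says that `f_jk - f_ik + f_ij` lies in `iℤ`, and the
Leibniz rule says that `α_j - α_i = d f_ij`. With `z = -∂f` these are exactly the equations for `(z,
f, α)` to be a degree two cocycle. Replacing `e_i` by `exp(2π b_i) e_i` and choosing other
logarithms adds a coboundary `D1 (m, b)`. Tensoring frames adds cocycles.

The predicate `Realizes L 𝒰 c e` expresses this encoding, and four facts about it carry the proof.
Every cocycle is realized, by gluing copies of `ℂ` (`cocycleLine_realizes`). Every bundle realizes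
some cocycle (`exists_realizes`). Bundles realizing the same cocycle are isomorphic
(`isoOfRealizes`), and a bundle realizing a sum is a tensor product (`tensorIsoOfRealizes`). Two
cocycles realized by one bundle differ by a coboundary after refinement
(`Realizes.exists_sub_eq_D1`). Hence the group law on isomorphism classes can be transported from
addition of cocycles, and the class of the glued bundle defines an isomorphism out of the colimit.

The analytic point is the choice of logarithms. For functions on single sets of a cover it is enough
to shrink around each point. For transition functions on all double overlaps at once one needs
paracompactness (`exists_log_one_cochain`). Equivariance costs nothing, even at fixed points of `τ`:
since `C_2` acts freely on the indices, choices are made on one index of each orbit and conjugated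
to the other. -/

theorem contMDiffAt_complex_mul {E H N : Type*} [NormedAddCommGroup E] [NormedSpace ℝ E]
    [TopologicalSpace H] {I : ModelWithCorners ℝ E H} [TopologicalSpace N] [ChartedSpace H N]
    {f g : N → ℂ} {x : N} (hf : ContMDiffAt I 𝓘(ℝ, ℂ) ∞ f x)
    (hg : ContMDiffAt I 𝓘(ℝ, ℂ) ∞ g x) : ContMDiffAt I 𝓘(ℝ, ℂ) ∞ (fun y => f y * g y) x :=
  (contDiff_mul (𝕜 := ℝ) (𝔸 := ℂ) (n := ∞)).contMDiff.contMDiffAt.comp x (hf.prodMk_space hg)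

theorem contMDiffAt_complex_inv {E H N : Type*} [NormedAddCommGroup E] [NormedSpace ℝ E]
    [TopologicalSpace H] {I : ModelWithCorners ℝ E H} [TopologicalSpace N] [ChartedSpace H N]
    {f : N → ℂ} {x : N} (hf : ContMDiffAt I 𝓘(ℝ, ℂ) ∞ f x) (h : f x ≠ 0) :
    ContMDiffAt I 𝓘(ℝ, ℂ) ∞ (fun y => (f y)⁻¹) x :=
  ContMDiffAt.comp x (g := fun z : ℂ => z⁻¹) (contDiffAt_inv ℝ h).contMDiffAt hf

theorem contMDiffAt_complex_conj {E H N : Type*} [NormedAddCommGroup E] [NormedSpace ℝ E]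
    [TopologicalSpace H] {I : ModelWithCorners ℝ E H} [TopologicalSpace N] [ChartedSpace H N]
    {f : N → ℂ} {x : N} (hf : ContMDiffAt I 𝓘(ℝ, ℂ) ∞ f x) :
    ContMDiffAt I 𝓘(ℝ, ℂ) ∞ (fun y => conj (f y)) x :=
  Complex.conjCLE.contDiff.contMDiff.contMDiffAt.comp x hf

theorem mdifferentiableAt_complex_mul {f g : M → ℂ} {x : M}
    (hf : MDifferentiableAt (𝓡 n) 𝓘(ℝ, ℂ) f x) (hg : MDifferentiableAt (𝓡 n) 𝓘(ℝ, ℂ) g x) :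
    MDifferentiableAt (𝓡 n) 𝓘(ℝ, ℂ) (fun y => f y * g y) x :=
  hf.mul hg

theorem mdifferentiableAt_complex_inv {f : M → ℂ} {x : M}
    (hf : MDifferentiableAt (𝓡 n) 𝓘(ℝ, ℂ) f x) (h : f x ≠ 0) :
    MDifferentiableAt (𝓡 n) 𝓘(ℝ, ℂ) (fun y => (f y)⁻¹) x :=
  MDifferentiableAt.comp x (g := fun z : ℂ => z⁻¹)
    (((contDiffAt_inv ℝ h (n := ∞)).differentiableAt (by simp)).mdifferentiableAt) hf

theorem mdifferentiableAt_complex_conj {f : M → ℂ} {x : M}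
    (hf : MDifferentiableAt (𝓡 n) 𝓘(ℝ, ℂ) f x) :
    MDifferentiableAt (𝓡 n) 𝓘(ℝ, ℂ) (fun y => conj (f y)) x :=
  MDifferentiableAt.comp x (g := fun z : ℂ => conj z)
    (Complex.conjCLE.differentiableAt.mdifferentiableAt) hf

theorem mvfderiv_complex_mul {f g : M → ℂ} {x : M}
    (hf : MDifferentiableAt (𝓡 n) 𝓘(ℝ, ℂ) f x) (hg : MDifferentiableAt (𝓡 n) 𝓘(ℝ, ℂ) g x)
    (X : TangentSpace (𝓡 n) x) :
    mvfderiv (𝓡 n) (fun y => f y * g y) x X =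
      f x * mvfderiv (𝓡 n) g x X + mvfderiv (𝓡 n) f x X * g x := by
  have h := (hf.hasMFDerivAt.mul hg.hasMFDerivAt).mfderiv
  have := congrArg (fun T => T X) h
  refine Eq.trans this ?_
  change f x * _ + g x * _ = _
  rw [mul_comm (g x)]
  rfl

theorem mvfderiv_complex_conj {f : M → ℂ} {x : M}
    (hf : MDifferentiableAt (𝓡 n) 𝓘(ℝ, ℂ) f x) (X : TangentSpace (𝓡 n) x) :
    mvfderiv (𝓡 n) (fun y => conj (f y)) x X = conj (mvfderiv (𝓡 n) f x X) :=
  congrArg (fun T => T X) (mvfderiv_clm_comp (Complex.conjCLE : ℂ →L[ℝ] ℂ) hf)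

namespace RealLineBundle

variable {τ : SmoothInvolution n M} (L : RealLineBundle τ)

/-- The coordinate of a vector in the preferred trivialization around `x₀`. -/
def coord (x₀ : M) {y : M} (v : L.fiber y) : ℂ := (trivializationAt ℂ L.fiber x₀ ⟨y, v⟩).2

/-- The domain of the preferred trivialization around `x₀`. -/
def chartSet (x₀ : M) : Opens M :=
  ⟨(trivializationAt ℂ L.fiber x₀).baseSet, (trivializationAt ℂ L.fiber x₀).open_baseSet⟩

theorem mem_chartSet (x₀ : M) : x₀ ∈ L.chartSet x₀ :=
  FiberBundle.mem_baseSet_trivializationAt' x₀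

theorem eventually_mem_chartSet (x₀ : M) : ∀ᶠ y in 𝓝 x₀, y ∈ L.chartSet x₀ :=
  (L.chartSet x₀).isOpen.mem_nhds (L.mem_chartSet x₀)

theorem smoothAt_iff_coord {s : ∀ x, L.fiber x} {x : M} :
    L.SmoothAt s x ↔ ContMDiffAt (𝓡 n) 𝓘(ℝ, ℂ) ∞ (fun y => L.coord x (s y)) x :=
  contMDiffAt_section x

theorem diffAt_iff_coord {s : ∀ x, L.fiber x} {x : M} :
    L.DiffAt s x ↔ MDifferentiableAt (𝓡 n) 𝓘(ℝ, ℂ) (fun y => L.coord x (s y)) x :=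
  mdifferentiableAt_section _ s

variable {L}

theorem SmoothAt.diffAt {s : ∀ x, L.fiber x} {x : M} (h : L.SmoothAt s x) : L.DiffAt s x :=
  ContMDiffAt.mdifferentiableAt h (by simp)

theorem SmoothAt.congr {s t : ∀ x, L.fiber x} {x : M} (h : L.SmoothAt s x)
    (hst : ∀ᶠ y in 𝓝 x, t y = s y) : L.SmoothAt t x :=
  ContMDiffAt.congr_of_eventuallyEq h (hst.mono fun y hy => by simp only [hy])

theorem DiffAt.congr {s t : ∀ x, L.fiber x} {x : M} (h : L.DiffAt s x)
    (hst : ∀ᶠ y in 𝓝 x, t y = s y) : L.DiffAt t x :=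
  MDifferentiableAt.congr_of_eventuallyEq h (hst.mono fun y hy => by simp only [hy])

theorem coord_smul {x₀ y : M} (hy : y ∈ L.chartSet x₀) (c : ℂ) (v : L.fiber y) :
    L.coord x₀ (c • v) = c * L.coord x₀ v :=
  ((trivializationAt ℂ L.fiber x₀).linear ℂ hy).map_smul c v

theorem coord_injective {x₀ y : M} (hy : y ∈ L.chartSet x₀) {v w : L.fiber y}
    (h : L.coord x₀ v = L.coord x₀ w) : v = w :=
  ((trivializationAt ℂ L.fiber x₀).continuousLinearEquivAt ℂ y hy).injective h

theorem coord_ne_zero {x₀ y : M} (hy : y ∈ L.chartSet x₀) {v : L.fiber y} (hv : v ≠ 0) :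
    L.coord x₀ v ≠ 0 := fun h => hv <| coord_injective hy <| by
  rw [h, ← zero_smul ℂ v, coord_smul hy, zero_mul]

theorem coord_div_smul {x₀ y : M} (hy : y ∈ L.chartSet x₀) {v : L.fiber y} (hv : v ≠ 0)
    (w : L.fiber y) : (L.coord x₀ w / L.coord x₀ v) • v = w :=
  coord_injective hy (by rw [coord_smul hy, div_mul_cancel₀ _ (coord_ne_zero hy hv)])

theorem exists_smul_eq {y : M} {v : L.fiber y} (hv : v ≠ 0) (w : L.fiber y) :
    ∃ c : ℂ, c • v = w :=
  ⟨_, coord_div_smul (L.mem_chartSet y) hv w⟩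

theorem SmoothAt.csmul {φ : M → ℂ} {s : ∀ x, L.fiber x} {x : M}
    (hφ : ContMDiffAt (𝓡 n) 𝓘(ℝ, ℂ) ∞ φ x) (hs : L.SmoothAt s x) :
    L.SmoothAt (fun y => φ y • s y) x := by
  rw [smoothAt_iff_coord] at hs ⊢
  refine (contMDiffAt_complex_mul hφ hs).congr_of_eventuallyEq ?_
  filter_upwards [L.eventually_mem_chartSet x] with y hy using coord_smul hy _ _

theorem DiffAt.csmul {φ : M → ℂ} {s : ∀ x, L.fiber x} {x : M}
    (hφ : MDifferentiableAt (𝓡 n) 𝓘(ℝ, ℂ) φ x) (hs : L.DiffAt s x) :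
    L.DiffAt (fun y => φ y • s y) x := by
  rw [diffAt_iff_coord] at hs ⊢
  refine (mdifferentiableAt_complex_mul hφ hs).congr_of_eventuallyEq ?_
  filter_upwards [L.eventually_mem_chartSet x] with y hy using coord_smul hy _ _

theorem DiffAt.continuousAt_coord {s : ∀ x, L.fiber x} {x : M} (hs : L.DiffAt s x) :
    ContinuousAt (fun y => L.coord x (s y)) x :=
  (diffAt_iff_coord L |>.1 hs).continuousAt

theorem coord_zero {x₀ y : M} (hy : y ∈ L.chartSet x₀) : L.coord x₀ (0 : L.fiber y) = 0 := by
  rw [← zero_smul ℂ (0 : L.fiber y), coord_smul hy, zero_mul]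

theorem DiffAt.eventually_ne_zero {s : ∀ x, L.fiber x} {x : M} (hs : L.DiffAt s x)
    (h : s x ≠ 0) : ∀ᶠ y in 𝓝 x, s y ≠ 0 := by
  filter_upwards [hs.continuousAt_coord.eventually_ne (coord_ne_zero (L.mem_chartSet x) h),
    L.eventually_mem_chartSet x] with y hy hy' h0
  exact hy (by rw [h0, coord_zero hy'])

/-- Locally the coefficient is a quotient of two coordinates, the denominator being nonzero. -/
theorem DiffAt.coeff {φ : M → ℂ} {e : ∀ x, L.fiber x} {x : M} (he : L.DiffAt e x)
    (h0 : e x ≠ 0) (hs : L.DiffAt (fun y => φ y • e y) x) :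
    MDifferentiableAt (𝓡 n) 𝓘(ℝ, ℂ) φ x := by
  have hne := he.eventually_ne_zero h0
  rw [diffAt_iff_coord] at hs he
  refine (mdifferentiableAt_complex_mul hs (mdifferentiableAt_complex_inv he
    (coord_ne_zero (L.mem_chartSet x) h0))).congr_of_eventuallyEq ?_
  filter_upwards [L.eventually_mem_chartSet x, hne] with y hy h
  rw [coord_smul hy, mul_assoc, mul_inv_cancel₀ (coord_ne_zero hy h), mul_one]

theorem SmoothAt.conjSection {s : ∀ x, L.fiber x} {x : M} (hs : L.SmoothAt s (τ x)) :
    L.SmoothAt (L.conjSection s) x := by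
  have h : ContMDiffAt (𝓡 n) ((𝓡 n).prod 𝓘(ℝ, ℂ)) ∞
      (fun y => TotalSpace.mk' ℂ y (s y)) (τ x) := hs
  have h1 := (L.σ_smooth _).comp x (h.comp x (τ.contMDiff_toFun x))
  refine h1.congr_of_eventuallyEq (.of_forall fun y => ?_)
  -- The transport along `τ (τ y) = y` becomes trivial once the endpoint is a variable.
  have key : ∀ z (hz : τ (τ y) = z) (h' : L.fiber (τ (τ y)) = L.fiber z),
      TotalSpace.mk' ℂ z (cast h' (L.σ (τ y) (s (τ y)))) =
        ⟨τ (τ y), L.σ (τ y) (s (τ y))⟩ := by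
    rintro z rfl h'
    rfl
  exact key y (τ.involutive y) _

namespace HermitianMetric

variable (h : L.HermitianMetric)

theorem ne_zero {x : M} {v : L.fiber x} (hv : h.form x v v = 1) : v ≠ 0 := by
  rintro rfl
  simp at hv

/-- Fibres are lines, so a single unit vector is an orthonormal basis. This converts between vectors
and coefficients throughout. -/
theorem form_smul_self {x : M} {v : L.fiber x} (hv : h.form x v v = 1) (w : L.fiber x) :
    h.form x v w • v = w := by
  obtain ⟨c, rfl⟩ := exists_smul_eq (h.ne_zero hv) w
  rw [map_smul, hv, smul_eq_mul, mul_one]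

theorem form_smul_smul {x : M} {v : L.fiber x} (hv : h.form x v v = 1) (a b : ℂ) :
    h.form x (a • v) (b • v) = conj a * b := by
  simp [hv, mul_comm]

theorem form_self_im {x : M} (v : L.fiber x) : (h.form x v v).im = 0 := by
  have := congrArg Complex.im (h.conj_symm x v v)
  rw [Complex.conj_im] at this
  linarith

theorem form_self_eq {x : M} (v : L.fiber x) : h.form x v v = ((h.form x v v).re : ℂ) :=
  Complex.ext (by simp) (by simp [h.form_self_im])

/-- The smoothness axiom of the metric speaks of smooth sections only. For a merely differentiable
`s`, the function is instead recognized as the coefficient of `s` in the frame `e`. -/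
theorem diffAt_form {e s : ∀ x, L.fiber x} {x : M} (he : L.SmoothAt e x)
    (h1 : ∀ᶠ y in 𝓝 x, h.form y (e y) (e y) = 1) (hs : L.DiffAt s x) :
    MDifferentiableAt (𝓡 n) 𝓘(ℝ, ℂ) (fun y => h.form y (e y) (s y)) x := by
  refine he.diffAt.coeff (h.ne_zero h1.self_of_nhds) (hs.congr ?_)
  filter_upwards [h1] with y hy using h.form_smul_self hy _

end HermitianMetric

end RealLineBundle

end RealDeligne

/-! ### Line-bundle-valued one-forms and connection forms. -/

namespace RealDeligne

variable {n : ℕ} {M : Type u} [TopologicalSpace M] [ChartedSpace (EuclideanSpace ℝ (Fin n)) M]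

namespace RealLineBundle

variable {τ : SmoothInvolution n M} {L : RealLineBundle τ}

section

variable [IsManifold (𝓡 n) ∞ M]

/-- Smoothness at `x` of a one-form with values in `L`. -/
def SmoothHomAt (L : RealLineBundle τ) (β : ∀ x : M, TangentSpace (𝓡 n) x →L[ℝ] L.fiber x)
    (x : M) : Prop :=
  ContMDiffAt (𝓡 n) ((𝓡 n).prod 𝓘(ℝ, EuclideanSpace ℝ (Fin n) →L[ℝ] ℂ)) ∞
    (fun y => TotalSpace.mk' (EuclideanSpace ℝ (Fin n) →L[ℝ] ℂ)
      (E := fun z : M => TangentSpace (𝓡 n) z →L[ℝ] L.fiber z) y (β y)) x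

theorem smoothHomAt_iff {β : ∀ x : M, TangentSpace (𝓡 n) x →L[ℝ] L.fiber x} {x : M} :
    L.SmoothHomAt β x ↔ ContMDiffAt (𝓡 n) 𝓘(ℝ, EuclideanSpace ℝ (Fin n) →L[ℝ] ℂ) ∞
      (fun y => ContinuousLinearMap.inCoordinates (EuclideanSpace ℝ (Fin n))
        (TangentSpace (𝓡 n) (M := M)) ℂ L.fiber x y x y (β y)) x := by
  unfold SmoothHomAt
  rw [contMDiffAt_hom_bundle]
  exact and_iff_right contMDiffAt_id

theorem inCoordinates_hom_apply {β : ∀ x : M, TangentSpace (𝓡 n) x →L[ℝ] L.fiber x} {x y : M}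
    (hy : y ∈ L.chartSet x) (v : EuclideanSpace ℝ (Fin n)) :
    ContinuousLinearMap.inCoordinates (EuclideanSpace ℝ (Fin n))
        (TangentSpace (𝓡 n) (M := M)) ℂ L.fiber x y x y (β y) v =
      L.coord x (β y ((trivializationAt (EuclideanSpace ℝ (Fin n))
        (TangentSpace (𝓡 n) (M := M)) x).symmL ℝ y v)) := by
  rw [ContinuousLinearMap.inCoordinates, ContinuousLinearMap.comp_apply,
    ContinuousLinearMap.comp_apply,
    Trivialization.continuousLinearMapAt_apply, Trivialization.coe_linearMapAt_of_mem _ hy]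
  rfl

theorem inCoordinates_form_apply {α : ∀ x : M, TangentSpace (𝓡 n) x →L[ℝ] ℂ} {x y : M}
    (v : EuclideanSpace ℝ (Fin n)) :
    ContinuousLinearMap.inCoordinates (EuclideanSpace ℝ (Fin n))
        (TangentSpace (𝓡 n) (M := M)) ℂ (Trivial M ℂ) x y x y (α y) v =
      α y ((trivializationAt (EuclideanSpace ℝ (Fin n))
        (TangentSpace (𝓡 n) (M := M)) x).symmL ℝ y v) := by
  simp [ContinuousLinearMap.inCoordinates]

omit [IsManifold (𝓡 n) ∞ M] in
theorem contMDiffAt_mul_clm {c : M → ℂ} {B : M → EuclideanSpace ℝ (Fin n) →L[ℝ] ℂ} {x : M}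
    (hc : ContMDiffAt (𝓡 n) 𝓘(ℝ, ℂ) ∞ c x)
    (hB : ContMDiffAt (𝓡 n) 𝓘(ℝ, EuclideanSpace ℝ (Fin n) →L[ℝ] ℂ) ∞ B x) :
    ContMDiffAt (𝓡 n) 𝓘(ℝ, EuclideanSpace ℝ (Fin n) →L[ℝ] ℂ) ∞
      (fun y => (ContinuousLinearMap.mul ℝ ℂ (c y)).comp (B y)) x := by
  have h : ContMDiffAt (𝓡 n) 𝓘(ℝ, ℂ →L[ℝ] ℂ) ∞
      (fun y => ContinuousLinearMap.mul ℝ ℂ (c y)) x :=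
    (ContinuousLinearMap.mul ℝ ℂ).contDiff.contMDiff.contMDiffAt.comp x hc
  exact h.clm_comp hB

/-- In coordinates `β` is `α` multiplied by the coordinate function of `e`; the converse below
divides by it. -/
theorem smoothHomAt_of_smoothFormAt {β : ∀ x : M, TangentSpace (𝓡 n) x →L[ℝ] L.fiber x}
    {α : ∀ x : M, TangentSpace (𝓡 n) x →L[ℝ] ℂ} {e : ∀ x, L.fiber x} {x : M}
    (he : L.SmoothAt e x) (hβ : ∀ᶠ y in 𝓝 x, ∀ X, β y X = α y X • e y)
    (hα : SmoothFormAt α x) : L.SmoothHomAt β x := by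
  rw [smoothFormAt_iff] at hα
  rw [smoothHomAt_iff]
  rw [smoothAt_iff_coord] at he
  refine (contMDiffAt_mul_clm he hα).congr_of_eventuallyEq ?_
  filter_upwards [hβ, L.eventually_mem_chartSet x] with y hy hy'
  ext v
  rw [inCoordinates_hom_apply hy', hy, coord_smul hy', mul_comm]
  exact congrArg _ (inCoordinates_form_apply v).symm

theorem smoothFormAt_of_smoothHomAt {β : ∀ x : M, TangentSpace (𝓡 n) x →L[ℝ] L.fiber x}
    {α : ∀ x : M, TangentSpace (𝓡 n) x →L[ℝ] ℂ} {e : ∀ x, L.fiber x} {x : M}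
    (he : L.SmoothAt e x) (h0 : e x ≠ 0) (hβ : ∀ᶠ y in 𝓝 x, ∀ X, β y X = α y X • e y)
    (h : L.SmoothHomAt β x) : SmoothFormAt α x := by
  have hne := he.diffAt.eventually_ne_zero h0
  rw [smoothFormAt_iff]
  rw [smoothHomAt_iff] at h
  rw [smoothAt_iff_coord] at he
  refine (contMDiffAt_mul_clm (contMDiffAt_complex_inv he
    (coord_ne_zero (L.mem_chartSet x) h0)) h).congr_of_eventuallyEq ?_
  filter_upwards [hβ, L.eventually_mem_chartSet x, hne] with y hy hy' hy0
  ext v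
  rw [inCoordinates_form_apply]
  refine Eq.trans ?_ (congrArg (fun z => (L.coord x (e y))⁻¹ * z)
    (inCoordinates_hom_apply (β := β) hy' v).symm)
  rw [hy, coord_smul hy', mul_left_comm, inv_mul_cancel₀ (coord_ne_zero hy' hy0), mul_one]

namespace RealConnection

variable {h : L.HermitianMetric} (D : L.RealConnection h)

theorem cov_congr {s t : ∀ x, L.fiber x} {x : M} (hs : L.DiffAt s x)
    (hst : ∀ᶠ y in 𝓝 x, s y = t y) : D.cov s x = D.cov t x :=
  D.cov.isCovariantDerivativeOnUniv.congr_of_eventuallyEq hs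
    (hs.congr (hst.mono fun _ hy => hy.symm)) Filter.univ_mem hst

theorem cov_add {s t : ∀ x, L.fiber x} {x : M} (hs : L.DiffAt s x) (ht : L.DiffAt t x) :
    D.cov (fun y => s y + t y) x = D.cov s x + D.cov t x :=
  D.cov.isCovariantDerivativeOnUniv.add hs ht

theorem cov_real_smul {s : ∀ x, L.fiber x} {a : M → ℝ} {x : M} (hs : L.DiffAt s x)
    (ha : MDifferentiableAt (𝓡 n) 𝓘(ℝ, ℝ) a x) (X : TangentSpace (𝓡 n) x) :
    D.cov (fun y => (a y : ℂ) • s y) x X =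
      (a x : ℂ) • D.cov s x X + ((mvfderiv (𝓡 n) a x X : ℝ) : ℂ) • s x := by
  have h1 := congrArg (fun T => T X) (D.cov.isCovariantDerivativeOnUniv.leibniz hs ha)
  exact h1

/-- `CovariantDerivative` provides the Leibniz rule for real functions only. Splitting `φ` into real
and imaginary parts and using that `∇` commutes with `i` gives the complex rule. -/
theorem cov_smul {s : ∀ x, L.fiber x} {φ : M → ℂ} {x : M} (hs : L.DiffAt s x)
    (hφ : MDifferentiableAt (𝓡 n) 𝓘(ℝ, ℂ) φ x) (X : TangentSpace (𝓡 n) x) :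
    D.cov (fun y => φ y • s y) x X = φ x • D.cov s x X + mvfderiv (𝓡 n) φ x X • s x := by
  have hr : MDifferentiableAt (𝓡 n) 𝓘(ℝ, ℝ) (fun y => (φ y).re) x :=
    MDifferentiableAt.comp x (g := Complex.re) Complex.reCLM.mdifferentiableAt hφ
  have hi : MDifferentiableAt (𝓡 n) 𝓘(ℝ, ℝ) (fun y => (φ y).im) x :=
    MDifferentiableAt.comp x (g := Complex.im) Complex.imCLM.mdifferentiableAt hφ
  have hc : ∀ a : M → ℝ, MDifferentiableAt (𝓡 n) 𝓘(ℝ, ℝ) a x →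
      MDifferentiableAt (𝓡 n) 𝓘(ℝ, ℂ) (fun y => (a y : ℂ)) x := fun a ha =>
    MDifferentiableAt.comp x (g := fun r : ℝ => (r : ℂ)) Complex.ofRealCLM.mdifferentiableAt ha
  have hIs : L.DiffAt (fun y => Complex.I • s y) x := hs.csmul mdifferentiableAt_const
  have h0 : (fun y => φ y • s y) =
      fun y => ((φ y).re : ℂ) • s y + ((φ y).im : ℂ) • Complex.I • s y := by
    funext y
    rw [smul_smul, ← add_smul, Complex.re_add_im]
  have hre : mvfderiv (𝓡 n) (fun y => (φ y).re) x X = (mvfderiv (𝓡 n) φ x X).re :=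
    congrArg (fun T => T X) (mvfderiv_clm_comp Complex.reCLM hφ)
  have him : mvfderiv (𝓡 n) (fun y => (φ y).im) x X = (mvfderiv (𝓡 n) φ x X).im :=
    congrArg (fun T => T X) (mvfderiv_clm_comp Complex.imCLM hφ)
  have hI : D.cov (fun y => Complex.I • s y) x X = Complex.I • D.cov s x X :=
    D.smul Complex.I s x hs X
  rw [h0, D.cov_add (hs.csmul (hc _ hr)) (hIs.csmul (hc _ hi)), add_apply,
    D.cov_real_smul hs hr, D.cov_real_smul hIs hi, hI, hre, him]
  conv_rhs => rw [← Complex.re_add_im (φ x), ← Complex.re_add_im (mvfderiv (𝓡 n) φ x X)]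
  module

/-- Smoothness of the connection is a statement about sections smooth on all of `M`. A bump function
equal to one near `x` globalizes `s`, and `∇` is local. -/
theorem smoothHomAt_cov [T2Space M] {s : ∀ x, L.fiber x} {x : M}
    (hs : ∀ᶠ y in 𝓝 x, L.SmoothAt s y) : L.SmoothHomAt (D.cov s) x := by
  obtain ⟨U, hU, hUo, hxU⟩ := eventually_nhds_iff.1 hs
  obtain ⟨f, hf⟩ := (SmoothBumpFunction.nhds_basis_tsupport (I := 𝓡 n) x).mem_iff.1
    (hUo.mem_nhds hxU)
  have h1 : ContMDiff (𝓡 n) ((𝓡 n).prod 𝓘(ℝ, ℂ)) ∞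
      (fun y => TotalSpace.mk' ℂ y (((f : M → ℝ) • s) y)) :=
    ContMDiffOn.smul_section_of_tsupport f.contMDiff.contMDiffOn hUo hf.2
      fun y hy => (hU y hy).contMDiffWithinAt
  have h2 := D.smooth.contMDiff.contMDiff (h1.contMDiffOn (s := Set.univ))
  have h3 : ContMDiffAt _ _ _ _ x := (h2 x trivial).contMDiffAt Filter.univ_mem
  refine h3.congr_of_eventuallyEq ?_
  filter_upwards [f.eventuallyEq_one.eventually_nhds, hs] with y hy hsy
  have : D.cov s y = D.cov ((f : M → ℝ) • s) y :=
    D.cov_congr hsy.diffAt (hy.mono fun z hz => by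
      simp only [Pi.one_apply] at hz
      simp [hz])
  simp only [this]

/-- The connection form of a unit section. -/
def form (e : ∀ x, L.fiber x) (x : M) : TangentSpace (𝓡 n) x →L[ℝ] ℂ :=
  haveI : FiniteDimensional ℝ (TangentSpace (𝓡 n) x) :=
    inferInstanceAs (FiniteDimensional ℝ (EuclideanSpace ℝ (Fin n)))
  haveI : T2Space (TangentSpace (𝓡 n) x) :=
    inferInstanceAs (T2Space (EuclideanSpace ℝ (Fin n)))
  LinearMap.toContinuousLinearMap
    (((h.form x (e x)).restrictScalars ℝ).comp (D.cov e x : TangentSpace (𝓡 n) x →ₗ[ℝ] L.fiber x))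

theorem form_apply (e : ∀ x, L.fiber x) (x : M) (X : TangentSpace (𝓡 n) x) :
    D.form e x X = h.form x (e x) (D.cov e x X) := rfl

theorem form_smul {e : ∀ x, L.fiber x} {x : M} (h1 : h.form x (e x) (e x) = 1)
    (X : TangentSpace (𝓡 n) x) : D.form e x X • e x = D.cov e x X :=
  h.form_smul_self h1 _

/-- Differentiating `h(e, e) = 1` gives `conj A + A = 0` for the connection form `A`. -/
theorem form_re {e : ∀ x, L.fiber x} {x : M} (he : L.DiffAt e x)
    (h1 : ∀ᶠ y in 𝓝 x, h.form y (e y) (e y) = 1) (X : TangentSpace (𝓡 n) x) :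
    (D.form e x X).re = 0 := by
  have h2 := D.hermitian e e x he he X
  rw [mvfderiv_congr_eventually h1, mvfderiv_const, ← h.conj_symm] at h2
  have h3 := congrArg Complex.re h2
  rw [Complex.add_re, Complex.conj_re] at h3
  rw [form_apply]
  simp only [zero_apply, Complex.zero_re] at h3
  linarith

theorem smoothFormAt_form [T2Space M] {e : ∀ x, L.fiber x} {x : M}
    (he : ∀ᶠ y in 𝓝 x, L.SmoothAt e y) (h1 : ∀ᶠ y in 𝓝 x, h.form y (e y) (e y) = 1) :
    SmoothFormAt (D.form e) x :=
  smoothFormAt_of_smoothHomAt he.self_of_nhds (h.ne_zero h1.self_of_nhds)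
    (h1.mono fun _ hy X => (D.form_smul hy X).symm) (D.smoothHomAt_cov he)

end RealConnection

end

end RealLineBundle

end RealDeligne

/-! ### Components of Čech cochains of the Deligne complex, and the exponential. -/

namespace RealDeligne

namespace C2Cover

variable {M : Type u} [TopologicalSpace M] {τ : Involution M} (𝒰 : C2Cover τ)

variable {𝒰} in
theorem mem_inter_one {i : 𝒰.ι} {x : M} : x ∈ 𝒰.inter ![i] ↔ x ∈ 𝒰.U i := by
  simp [mem_inter]

variable {𝒰} in
theorem mem_inter_two {i j : 𝒰.ι} {x : M} :
    x ∈ 𝒰.inter ![i, j] ↔ x ∈ 𝒰.U i ∧ x ∈ 𝒰.U j := by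
  simp [mem_inter, Fin.forall_fin_two]

variable {𝒰} in
theorem mem_inter_three {i j k : 𝒰.ι} {x : M} :
    x ∈ 𝒰.inter ![i, j, k] ↔ x ∈ 𝒰.U i ∧ x ∈ 𝒰.U j ∧ x ∈ 𝒰.U k := by
  simp [mem_inter, Fin.forall_fin_succ]

theorem coboundary_zero_apply (F : C2Sheaf τ) (b : 𝒰.cochain F 0) {i j : 𝒰.ι} {x : M}
    (hi : x ∈ 𝒰.U i) (hj : x ∈ 𝒰.U j) :
    (𝒰.coboundary F 0 b).1 ![i, j] x = b.1 ![j] x - b.1 ![i] x := by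
  change cutoff (𝒰.inter ![i, j]) (fun x => ∑ k : Fin 2, ((-1) ^ (k : ℕ) : ℤ) •
    b.1 (![i, j] ∘ k.succAbove) x) x = _
  rw [cutoff_of_mem (mem_inter_two.2 ⟨hi, hj⟩)]
  have h0 : ![i, j] ∘ Fin.succAbove 0 = ![j] := by
    funext k; fin_cases k; rfl
  have h1 : ![i, j] ∘ Fin.succAbove 1 = ![i] := by
    funext k; fin_cases k; rfl
  rw [Fin.sum_univ_two, h0, h1]
  simp [sub_eq_add_neg]

theorem coboundary_one_apply (F : C2Sheaf τ) (c : 𝒰.cochain F 1) {i j k : 𝒰.ι} {x : M}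
    (hi : x ∈ 𝒰.U i) (hj : x ∈ 𝒰.U j) (hk : x ∈ 𝒰.U k) :
    (𝒰.coboundary F 1 c).1 ![i, j, k] x =
      c.1 ![j, k] x - c.1 ![i, k] x + c.1 ![i, j] x := by
  change cutoff (𝒰.inter ![i, j, k]) (fun x => ∑ l : Fin 3, ((-1) ^ (l : ℕ) : ℤ) •
    c.1 (![i, j, k] ∘ l.succAbove) x) x = _
  rw [cutoff_of_mem (mem_inter_three.2 ⟨hi, hj, hk⟩)]
  have h0 : ![i, j, k] ∘ Fin.succAbove 0 = ![j, k] := by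
    funext k; fin_cases k <;> rfl
  have h1 : ![i, j, k] ∘ Fin.succAbove 1 = ![i, k] := by
    funext k; fin_cases k <;> rfl
  have h2 : ![i, j, k] ∘ Fin.succAbove 2 = ![i, j] := by
    funext k; fin_cases k <;> rfl
  rw [Fin.sum_univ_three, h0, h1, h2]
  simp [sub_eq_add_neg]

variable {𝒰} in
theorem Refinement.pull_one_apply {𝒱 : C2Cover τ} (ρ : Refinement 𝒱 𝒰) (F : C2Sheaf τ)
    (c : 𝒰.cochain F 0) {i : 𝒱.ι} {x : M} (hi : x ∈ 𝒱.U i) :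
    (ρ.pull F 0 c).1 ![i] x = c.1 ![ρ.r i] x := by
  refine (cutoff_of_mem (B := F.B) (mem_inter_one.2 hi)).trans ?_
  have : ρ.r ∘ ![i] = ![ρ.r i] := by funext k; fin_cases k; rfl
  rw [this]

variable {𝒰} in
theorem Refinement.pull_two_apply {𝒱 : C2Cover τ} (ρ : Refinement 𝒱 𝒰) (F : C2Sheaf τ)
    (c : 𝒰.cochain F 1) {i j : 𝒱.ι} {x : M} (hi : x ∈ 𝒱.U i) (hj : x ∈ 𝒱.U j) :
    (ρ.pull F 1 c).1 ![i, j] x = c.1 ![ρ.r i, ρ.r j] x := by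
  refine (cutoff_of_mem (B := F.B) (mem_inter_two.2 ⟨hi, hj⟩)).trans ?_
  have : ρ.r ∘ ![i, j] = ![ρ.r i, ρ.r j] := by funext k; fin_cases k <;> rfl
  rw [this]

end C2Cover

variable {n : ℕ} {M : Type u} [TopologicalSpace M] [ChartedSpace (EuclideanSpace ℝ (Fin n)) M]
  [IsManifold (𝓡 n) ∞ M] {τ : SmoothInvolution n M}

section cochains

variable {𝒰 : C2Cover τ.toInvolution}

/-- The component `f_{ij}` of a degree two cochain of the Real Deligne complex. -/
def logTrans (c : 𝒰.T2 (deligneComplex2 τ)) (i j : 𝒰.ι) : M → ℂ := c.2.1.1 ![i, j]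

/-- The component `α_i` of a degree two cochain of the Real Deligne complex. -/
def potential (c : 𝒰.T2 (deligneComplex2 τ)) (i : 𝒰.ι) :
    ∀ x : M, TangentSpace (𝓡 n) x →L[ℝ] ℂ := c.2.2.1 ![i]

/-- The component `b_i` of a degree one cochain of the Real Deligne complex. -/
def logGauge (b : 𝒰.T1 (deligneComplex2 τ)) (i : 𝒰.ι) : M → ℂ := b.2.1 ![i]

/-- The component `m_{ij}` of a degree one cochain of the Real Deligne complex. -/
def intGauge (b : 𝒰.T1 (deligneComplex2 τ)) (i j : 𝒰.ι) : M → ℂ := b.1.1 ![i, j]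

theorem logTrans_add (c c' : 𝒰.T2 (deligneComplex2 τ)) (i j : 𝒰.ι) (x : M) :
    logTrans (c + c') i j x = logTrans c i j x + logTrans c' i j x := rfl

theorem potential_add (c c' : 𝒰.T2 (deligneComplex2 τ)) (i : 𝒰.ι) (x : M)
    (X : TangentSpace (𝓡 n) x) :
    potential (c + c') i x X = potential c i x X + potential c' i x X := rfl

theorem logTrans_contMDiffAt (c : 𝒰.T2 (deligneComplex2 τ)) {i j : 𝒰.ι} {x : M}
    (hi : x ∈ 𝒰.U i) (hj : x ∈ 𝒰.U j) : ContMDiffAt (𝓡 n) 𝓘(ℝ, ℂ) ∞ (logTrans c i j) x :=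
  (c.2.1.2.1 ![i, j]).2.2 x (C2Cover.mem_inter_two.2 ⟨hi, hj⟩)

theorem logTrans_re (c : 𝒰.T2 (deligneComplex2 τ)) (i j : 𝒰.ι) (x : M) :
    (logTrans c i j x).re = 0 :=
  (c.2.1.2.1 ![i, j]).2.1 x

theorem logTrans_real (c : 𝒰.T2 (deligneComplex2 τ)) (i j : 𝒰.ι) (x : M) :
    conj (logTrans c (𝒰.inv i) (𝒰.inv j) (τ x)) = logTrans c i j x := by
  have h := c.2.1.2.2 ![i, j] x
  have h1 : 𝒰.inv ∘ ![i, j] = ![𝒰.inv i, 𝒰.inv j] := by funext k; fin_cases k <;> rfl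
  rw [h1] at h
  exact h

theorem potential_smooth (c : 𝒰.T2 (deligneComplex2 τ)) {i : 𝒰.ι} {x : M}
    (hi : x ∈ 𝒰.U i) : SmoothFormAt (potential c i) x :=
  (c.2.2.2.1 ![i]).2.2 x (C2Cover.mem_inter_one.2 hi)

theorem potential_re (c : 𝒰.T2 (deligneComplex2 τ)) (i : 𝒰.ι) (x : M)
    (X : TangentSpace (𝓡 n) x) : (potential c i x X).re = 0 :=
  (c.2.2.2.1 ![i]).2.1 x X

theorem potential_real (c : 𝒰.T2 (deligneComplex2 τ)) (i : 𝒰.ι) (x : M)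
    (X : TangentSpace (𝓡 n) x) :
    conj (potential c (𝒰.inv i) (τ x) (mfderiv (𝓡 n) (𝓡 n) τ x X)) = potential c i x X := by
  have h := c.2.2.2.2 ![i] x
  have h1 : 𝒰.inv ∘ ![i] = ![𝒰.inv i] := by funext k; fin_cases k; rfl
  rw [h1] at h
  exact congrArg (fun T : TangentSpace (𝓡 n) x →L[ℝ] ℂ => T X) h

theorem logGauge_contMDiffAt (b : 𝒰.T1 (deligneComplex2 τ)) {i : 𝒰.ι} {x : M}
    (hi : x ∈ 𝒰.U i) : ContMDiffAt (𝓡 n) 𝓘(ℝ, ℂ) ∞ (logGauge b i) x :=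
  (b.2.2.1 ![i]).2.2 x (C2Cover.mem_inter_one.2 hi)

theorem logGauge_re (b : 𝒰.T1 (deligneComplex2 τ)) (i : 𝒰.ι) (x : M) :
    (logGauge b i x).re = 0 :=
  (b.2.2.1 ![i]).2.1 x

theorem logGauge_real (b : 𝒰.T1 (deligneComplex2 τ)) (i : 𝒰.ι) (x : M) :
    conj (logGauge b (𝒰.inv i) (τ x)) = logGauge b i x := by
  have h := b.2.2.2 ![i] x
  have h1 : 𝒰.inv ∘ ![i] = ![𝒰.inv i] := by funext k; fin_cases k; rfl
  rw [h1] at h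
  exact h

theorem intGauge_int (b : 𝒰.T1 (deligneComplex2 τ)) {i j : 𝒰.ι} {x : M}
    (hi : x ∈ 𝒰.U i) (hj : x ∈ 𝒰.U j) : ∃ k : ℤ, intGauge b i j x = k * Complex.I :=
  let ⟨k, hk⟩ := (b.1.2.1 ![i, j]).2 x (C2Cover.mem_inter_two.2 ⟨hi, hj⟩)
  ⟨k, hk.self_of_nhds⟩

/-- The minus sign before the integral part is the factor `(-1)^q` of the total differential in Čech
degree one. -/
theorem logTrans_D1 (b : 𝒰.T1 (deligneComplex2 τ)) {i j : 𝒰.ι} {x : M}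
    (hi : x ∈ 𝒰.U i) (hj : x ∈ 𝒰.U j) :
    logTrans (𝒰.D1 _ b) i j x = logGauge b j x - logGauge b i x - intGauge b i j x :=
  congrArg (fun z : ℂ => z - intGauge b i j x)
    (𝒰.coboundary_zero_apply (deligneComplex2 τ).F1 b.2 hi hj)

theorem potential_D1 (b : 𝒰.T1 (deligneComplex2 τ)) {i : 𝒰.ι} {x : M}
    (hi : x ∈ 𝒰.U i) :
    potential (𝒰.D1 _ b) i x = mvfderiv (𝓡 n) (logGauge b i) x :=
  diffOn_of_mem (C2Cover.mem_inter_one.2 hi)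

theorem logTrans_pull {𝒱 : C2Cover τ.toInvolution} (ρ : C2Cover.Refinement 𝒱 𝒰)
    (c : 𝒰.T2 (deligneComplex2 τ)) {i j : 𝒱.ι} {x : M} (hi : x ∈ 𝒱.U i) (hj : x ∈ 𝒱.U j) :
    logTrans (ρ.pullT2 _ c) i j x = logTrans c (ρ.r i) (ρ.r j) x :=
  ρ.pull_two_apply (deligneComplex2 τ).F1 c.2.1 hi hj

theorem potential_pull {𝒱 : C2Cover τ.toInvolution} (ρ : C2Cover.Refinement 𝒱 𝒰)
    (c : 𝒰.T2 (deligneComplex2 τ)) {i : 𝒱.ι} {x : M} (hi : x ∈ 𝒱.U i) :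
    potential (ρ.pullT2 _ c) i x = potential c (ρ.r i) x :=
  ρ.pull_one_apply (deligneComplex2 τ).F2 c.2.2 hi

theorem potential_sub_of_mem_ker {c : 𝒰.T2 (deligneComplex2 τ)} (hc : c ∈ (𝒰.D2 _).ker)
    {i j : 𝒰.ι} {x : M} (hi : x ∈ 𝒰.U i) (hj : x ∈ 𝒰.U j) :
    potential c j x - potential c i x = mvfderiv (𝓡 n) (logTrans c i j) x := by
  have h := congrArg (fun z => z.2.2) hc
  have h1 : 𝒰.coboundary (deligneComplex2 τ).F2 0 c.2.2 =
    𝒰.mapCochain (deligneComplex2 τ).d1 1 c.2.1 := sub_eq_zero.1 h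
  have h2 := congrFun (congrFun (congrArg Subtype.val h1) ![i, j]) x
  rw [𝒰.coboundary_zero_apply (deligneComplex2 τ).F2 c.2.2 hi hj] at h2
  exact h2.trans (diffOn_of_mem (C2Cover.mem_inter_two.2 ⟨hi, hj⟩))

theorem logTrans_of_mem_ker {c : 𝒰.T2 (deligneComplex2 τ)} (hc : c ∈ (𝒰.D2 _).ker)
    {i j k : 𝒰.ι} {x : M} (hi : x ∈ 𝒰.U i) (hj : x ∈ 𝒰.U j) (hk : x ∈ 𝒰.U k) :
    ∃ m : ℤ, logTrans c j k x - logTrans c i k x + logTrans c i j x = m * Complex.I := by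
  have h := congrArg (fun z => z.2.1) hc
  have h1 : 𝒰.coboundary (deligneComplex2 τ).F1 1 c.2.1 +
    𝒰.mapCochain (deligneComplex2 τ).d0 2 c.1 = 0 := h
  have h2 := congrFun (congrFun (congrArg Subtype.val h1) ![i, j, k]) x
  obtain ⟨m, hm⟩ := (c.1.2.1 ![i, j, k]).2 x (C2Cover.mem_inter_three.2 ⟨hi, hj, hk⟩)
  have h3 : (𝒰.coboundary (deligneComplex2 τ).F1 1 c.2.1).1 ![i, j, k] x = 
      logTrans c j k x - logTrans c i k x + logTrans c i j x :=
    𝒰.coboundary_one_apply (deligneComplex2 τ).F1 c.2.1 hi hj hk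
  have h4 : (𝒰.coboundary (deligneComplex2 τ).F1 1 c.2.1).1 ![i, j, k] x =
      -(c.1.1 ![i, j, k] x : ℂ) := eq_neg_of_add_eq_zero_left h2
  refine ⟨-m, ?_⟩
  rw [← h3, h4, hm.self_of_nhds, Int.cast_neg, neg_mul]
  rfl

end cochains

/-- The function `exp(2π z)`, which is trivial exactly on `iℤ`. -/
def expTwoPi (z : ℂ) : ℂ := Complex.exp (2 * Real.pi * z)

theorem expTwoPi_add (z w : ℂ) : expTwoPi (z + w) = expTwoPi z * expTwoPi w := by
  rw [expTwoPi, mul_add, Complex.exp_add]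
  rfl

theorem expTwoPi_zero : expTwoPi 0 = 1 := by simp [expTwoPi]

theorem expTwoPi_ne_zero (z : ℂ) : expTwoPi z ≠ 0 := Complex.exp_ne_zero _

theorem expTwoPi_neg (z : ℂ) : expTwoPi (-z) = (expTwoPi z)⁻¹ := by
  rw [expTwoPi, mul_neg, Complex.exp_neg]
  rfl

theorem expTwoPi_int (k : ℤ) : expTwoPi (k * Complex.I) = 1 := by
  rw [expTwoPi, Complex.exp_eq_one_iff]
  exact ⟨k, by ring⟩

theorem expTwoPi_eq_one {z : ℂ} (h : expTwoPi z = 1) : ∃ k : ℤ, z = k * Complex.I := by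
  rw [expTwoPi, Complex.exp_eq_one_iff] at h
  obtain ⟨k, hk⟩ := h
  refine ⟨k, ?_⟩
  have : (2 * Real.pi : ℂ) ≠ 0 := by simp [Real.pi_ne_zero]
  apply mul_left_cancel₀ this
  rw [hk]
  ring

theorem expTwoPi_conj (z : ℂ) : expTwoPi (conj z) = conj (expTwoPi z) := by
  rw [expTwoPi, expTwoPi, ← Complex.exp_conj, map_mul, map_mul, Complex.conj_ofReal, map_ofNat]

theorem conj_mul_expTwoPi {z : ℂ} (h : z.re = 0) : conj (expTwoPi z) * expTwoPi z = 1 := by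
  rw [← expTwoPi_conj, ← expTwoPi_add]
  have : conj z + z = 0 := by
    rw [add_comm, Complex.add_conj, h]
    simp
  rw [this, expTwoPi_zero]

omit [IsManifold (𝓡 n) ∞ M] in
theorem contMDiffAt_expTwoPi {f : M → ℂ} {x : M} (hf : ContMDiffAt (𝓡 n) 𝓘(ℝ, ℂ) ∞ f x) :
    ContMDiffAt (𝓡 n) 𝓘(ℝ, ℂ) ∞ (fun y => expTwoPi (f y)) x :=
  ContMDiffAt.comp x (g := fun z : ℂ => expTwoPi z)
    (((contDiff_const.mul contDiff_id).cexp).contMDiff.contMDiffAt) hf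

omit [IsManifold (𝓡 n) ∞ M] in
theorem mvfderiv_expTwoPi {f : M → ℂ} {x : M} (hf : MDifferentiableAt (𝓡 n) 𝓘(ℝ, ℂ) f x)
    (X : TangentSpace (𝓡 n) x) :
    mvfderiv (𝓡 n) (fun y => expTwoPi (f y)) x X =
      (2 * Real.pi * mvfderiv (𝓡 n) f x X) * expTwoPi (f x) := by
  have h0 : HasDerivAt expTwoPi (expTwoPi (f x) * (2 * Real.pi)) (f x) := by
    have := ((hasDerivAt_id (f x)).const_mul (2 * Real.pi : ℂ)).cexp
    simp only [id, mul_one] at this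
    exact this
  have h1 := (h0.hasFDerivAt.restrictScalars ℝ).hasMFDerivAt.comp x hf.hasMFDerivAt
  have h2 := congrArg (fun T => T X) h1.mfderiv
  refine Eq.trans h2 ?_
  change mvfderiv (𝓡 n) f x X * (expTwoPi (f x) * (2 * Real.pi)) = _
  ring

/-! ### Frames realizing a cochain, and operations on them. -/

namespace RealLineBundleWithConnection

/-- Local unit sections over the sets of a `C_2`-cover that are permuted by the Real structure. -/
structure IsFrame (L : RealLineBundleWithConnection τ) (𝒰 : C2Cover τ.toInvolution)
    (e : 𝒰.ι → ∀ x, L.fiber x) : Prop where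
  smooth : ∀ i, ∀ x ∈ 𝒰.U i, L.SmoothAt (e i) x
  unit : ∀ i, ∀ x ∈ 𝒰.U i, L.metric.form x (e i x) (e i x) = 1
  real : ∀ i, ∀ x ∈ 𝒰.U i, e (𝒰.inv i) (τ x) = L.σ x (e i x)

/-- Frames of `L` with transition functions and connection forms given by a cochain `c`. -/
structure Realizes (L : RealLineBundleWithConnection τ) (𝒰 : C2Cover τ.toInvolution)
    (c : 𝒰.T2 (deligneComplex2 τ)) (e : 𝒰.ι → ∀ x, L.fiber x) : Prop extends
    IsFrame L 𝒰 e where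
  trans : ∀ i j x, x ∈ 𝒰.U i → x ∈ 𝒰.U j → e j x = expTwoPi (logTrans c i j x) • e i x
  conn : ∀ i x, x ∈ 𝒰.U i → ∀ X : TangentSpace (𝓡 n) x,
    L.conn.cov (e i) x X = (2 * Real.pi * potential c i x X) • e i x

variable {L L' L'' : RealLineBundleWithConnection τ} {𝒰 𝒱 : C2Cover τ.toInvolution}
  {c c' : 𝒰.T2 (deligneComplex2 τ)} {e : 𝒰.ι → ∀ x, L.fiber x} {e' : 𝒰.ι → ∀ x, L'.fiber x}

theorem IsFrame.ne_zero (h : IsFrame L 𝒰 e) {i : 𝒰.ι} {x : M} (hi : x ∈ 𝒰.U i) : e i x ≠ 0 :=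
  L.metric.ne_zero (h.unit i x hi)

theorem IsFrame.diffAt (h : IsFrame L 𝒰 e) {i : 𝒰.ι} {x : M} (hi : x ∈ 𝒰.U i) :
    L.DiffAt (e i) x :=
  (h.smooth i x hi).diffAt

omit [IsManifold (𝓡 n) ∞ M] in
theorem eventually_mem {i : 𝒰.ι} {x : M} (hi : x ∈ 𝒰.U i) : ∀ᶠ y in 𝓝 x, y ∈ 𝒰.U i :=
  (𝒰.U i).isOpen.mem_nhds hi

theorem IsFrame.diffAt_coeff (h : IsFrame L 𝒰 e) {i : 𝒰.ι} {x : M} (hi : x ∈ 𝒰.U i)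
    {s : ∀ x, L.fiber x} (hs : L.DiffAt s x) :
    MDifferentiableAt (𝓡 n) 𝓘(ℝ, ℂ) (fun y => L.metric.form y (e i y) (s y)) x :=
  L.metric.diffAt_form (h.smooth i x hi) ((eventually_mem hi).mono (h.unit i)) hs

theorem IsFrame.pull (h : IsFrame L 𝒰 e) (ρ : C2Cover.Refinement 𝒱 𝒰) :
    IsFrame L 𝒱 (fun i => e (ρ.r i)) where
  smooth i x hx := h.smooth _ x (ρ.le i hx)
  unit i x hx := h.unit _ x (ρ.le i hx)
  real i x hx := by rw [ρ.r_inv]; exact h.real _ x (ρ.le i hx)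

theorem Realizes.pull (h : Realizes L 𝒰 c e) (ρ : C2Cover.Refinement 𝒱 𝒰) :
    Realizes L 𝒱 (ρ.pullT2 _ c) (fun i => e (ρ.r i)) where
  toIsFrame := h.toIsFrame.pull ρ
  trans i j x hi hj := by rw [logTrans_pull ρ c hi hj]; exact h.trans _ _ x (ρ.le i hi) (ρ.le j hj)
  conn i x hi X := by rw [potential_pull ρ c hi]; exact h.conn _ x (ρ.le i hi) X

theorem Realizes.iso (h : Realizes L 𝒰 c e) (f : Iso L L') :
    Realizes L' 𝒰 c (fun i x => f.map x (e i x)) where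
  smooth i x hx := ContMDiffAt.comp x (f.smooth _) (h.smooth i x hx)
  unit i x hx := by rw [f.metric, h.unit i x hx]
  real i x hx := by rw [h.real i x hx, f.real]
  trans i j x hi hj := by rw [h.trans i j x hi hj, map_smul]
  conn i x hi X := by rw [f.conn _ x (h.diffAt hi), h.conn i x hi, map_smul]

/-- Transition functions of product frames multiply, hence their logarithms add; by `∇ ⊗ 1 + 1 ⊗ ∇'`
so do the connection forms. This is why tensor product corresponds to addition. -/
theorem Realizes.tensor (h : Realizes L 𝒰 c e) (h' : Realizes L' 𝒰 c' e')
    (f : TensorIso L L' L'') :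
    Realizes L'' 𝒰 (c + c') (fun i x => f.map x (e i x ⊗ₜ[ℂ] e' i x)) where
  smooth i x hx := f.smooth _ _ x (h.smooth i x hx) (h'.smooth i x hx)
  unit i x hx := by rw [f.metric, h.unit i x hx, h'.unit i x hx, one_mul]
  real i x hx := by rw [h.real i x hx, h'.real i x hx, f.real]
  trans i j x hi hj := by
    rw [h.trans i j x hi hj, h'.trans i j x hi hj, logTrans_add, expTwoPi_add,
      TensorProduct.smul_tmul_smul, map_smul]
  conn i x hi X := by
    rw [f.conn _ _ x (h.diffAt hi) (h'.diffAt hi), h.conn i x hi, h'.conn i x hi, potential_add,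
      ← TensorProduct.smul_tmul', TensorProduct.tmul_smul, ← add_smul, map_smul, mul_add]

/-- A coboundary is a change of gauge: `b` rotates the frames, and the integral component of a
degree one cochain is invisible to `expTwoPi`. So cohomologous cocycles are realized by the same
bundle. -/
theorem Realizes.add_D1 (h : Realizes L 𝒰 c e) (b : 𝒰.T1 (deligneComplex2 τ)) :
    Realizes L 𝒰 (c + 𝒰.D1 _ b) (fun i x => expTwoPi (logGauge b i x) • e i x) where
  smooth i x hx := .csmul (contMDiffAt_expTwoPi (logGauge_contMDiffAt b hx)) (h.smooth i x hx)
  unit i x hx := by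
    rw [L.metric.form_smul_smul (h.unit i x hx), conj_mul_expTwoPi (logGauge_re b i x)]
  real i x hx := by
    rw [h.real i x hx, LinearMap.map_smulₛₗ, ← expTwoPi_conj, ← logGauge_real b i x,
      Complex.conj_conj]
  trans i j x hi hj := by
    obtain ⟨k, hk⟩ := intGauge_int b hi hj
    -- The factor `expTwoPi (-k * I) = 1` is inserted to absorb the integer, after which the
    -- exponents agree.
    rw [h.trans i j x hi hj, logTrans_add, logTrans_D1 b hi hj, smul_smul, smul_smul,
      ← expTwoPi_add, ← expTwoPi_add, hk, ← mul_one (expTwoPi (_ + _)), ← expTwoPi_int (-k),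
      ← expTwoPi_add]
    congr 2
    push_cast
    ring
  conn i x hi X := by
    have hb := (logGauge_contMDiffAt b hi)
    rw [L.conn.cov_smul (h.diffAt hi) ((contMDiffAt_expTwoPi hb).mdifferentiableAt (by simp)),
      mvfderiv_expTwoPi (hb.mdifferentiableAt (by simp)), h.conn i x hi, potential_add,
      potential_D1 b hi]
    module

end RealLineBundleWithConnection

end RealDeligne

/-! ### Isomorphisms and tensor products determined by realized cochains. -/

namespace RealDeligne

variable {n : ℕ} {M : Type u} [TopologicalSpace M] [ChartedSpace (EuclideanSpace ℝ (Fin n)) M]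
  [IsManifold (𝓡 n) ∞ M] {τ : SmoothInvolution n M}

namespace C2Cover

/-- A set of the cover containing a given point. -/
def idx {M : Type u} [TopologicalSpace M] {τ : Involution M} (𝒰 : C2Cover τ) (x : M) : 𝒰.ι :=
  (𝒰.covers x).choose

theorem mem_idx {M : Type u} [TopologicalSpace M] {τ : Involution M} (𝒰 : C2Cover τ) (x : M) :
    x ∈ 𝒰.U (𝒰.idx x) :=
  (𝒰.covers x).choose_spec

theorem mem_inv {M : Type u} [TopologicalSpace M] {τ : Involution M} {𝒰 : C2Cover τ} {x : M}
    {i : 𝒰.ι} (hi : x ∈ 𝒰.U i) : τ x ∈ 𝒰.U (𝒰.inv i) := by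
  rw [𝒰.U_inv, τ.mem_translate, τ.involutive]
  exact hi

end C2Cover

namespace RealLineBundleWithConnection

variable {L L' L'' : RealLineBundleWithConnection τ} {𝒰 𝒱 : C2Cover τ.toInvolution}
  {c c' : 𝒰.T2 (deligneComplex2 τ)} {e : 𝒰.ι → ∀ x, L.fiber x} {e' : 𝒰.ι → ∀ x, L'.fiber x}
  {e'' : 𝒰.ι → ∀ x, L''.fiber x}

/-- The isomorphism `v ↦ h(e, v) e'` between fibres given by unit vectors `e` and `e'`. -/
def fiberEquiv (L L' : RealLineBundleWithConnection τ) {x : M} (v : L.fiber x) (v' : L'.fiber x)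
    (hv : L.metric.form x v v = 1) (hv' : L'.metric.form x v' v' = 1) :
    L.fiber x ≃ₗ[ℂ] L'.fiber x where
  toFun w := L.metric.form x v w • v'
  map_add' a b := by rw [map_add, add_smul]
  map_smul' a b := by rw [map_smul, smul_assoc, RingHom.id_apply]
  invFun w := L'.metric.form x v' w • v
  left_inv w := by
    simp only [map_smul, hv', smul_eq_mul, mul_one, L.metric.form_smul_self hv]
  right_inv w := by
    simp only [map_smul, hv, smul_eq_mul, mul_one, L'.metric.form_smul_self hv']

/-- The bundle isomorphism that matches two frames. -/
def frameMap (h : IsFrame L 𝒰 e) (h' : IsFrame L' 𝒰 e') (x : M) : L.fiber x ≃ₗ[ℂ] L'.fiber x :=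
  fiberEquiv L L' (e (𝒰.idx x) x) (e' (𝒰.idx x) x) (h.unit _ x (𝒰.mem_idx x))
    (h'.unit _ x (𝒰.mem_idx x))

/-- `frameMap` is defined with one chosen index at each point. As both bundles have the same
transition functions, it matches the frames of every index, so the choice does not matter. -/
theorem frameMap_frame (h : Realizes L 𝒰 c e) (h' : Realizes L' 𝒰 c e') {i : 𝒰.ι} {x : M}
    (hi : x ∈ 𝒰.U i) : frameMap h.toIsFrame h'.toIsFrame x (e i x) = e' i x := by
  change L.metric.form x (e (𝒰.idx x) x) (e i x) • e' (𝒰.idx x) x = e' i x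
  rw [h.trans _ i x (𝒰.mem_idx x) hi, h'.trans _ i x (𝒰.mem_idx x) hi, map_smul,
    h.unit _ x (𝒰.mem_idx x), smul_eq_mul, mul_one]

theorem frameMap_apply (h : Realizes L 𝒰 c e) (h' : Realizes L' 𝒰 c e') {i : 𝒰.ι} {x : M}
    (hi : x ∈ 𝒰.U i) (v : L.fiber x) :
    frameMap h.toIsFrame h'.toIsFrame x v = L.metric.form x (e i x) v • e' i x := by
  rw [← frameMap_frame h h' hi, ← map_smul, L.metric.form_smul_self (h.unit i x hi)]

/-- In coordinates the map sends `v` to `v / e_i` times the coordinate of `e'_i`, a smooth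
expression since `e_i` does not vanish. -/
theorem contMDiff_of_frame (h : IsFrame L 𝒰 e) (h' : IsFrame L' 𝒰 e')
    (φ : ∀ x, L.fiber x →ₗ[ℂ] L'.fiber x) (hφ : ∀ i, ∀ x ∈ 𝒰.U i, φ x (e i x) = e' i x) :
    ContMDiff ((𝓡 n).prod 𝓘(ℝ, ℂ)) ((𝓡 n).prod 𝓘(ℝ, ℂ)) ∞
      (fun p : TotalSpace ℂ L.fiber => (⟨p.1, φ p.1 p.2⟩ : TotalSpace ℂ L'.fiber)) := by
  rintro ⟨x, v⟩
  set i := 𝒰.idx x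
  have hi := 𝒰.mem_idx x
  have hp : ContMDiffAt ((𝓡 n).prod 𝓘(ℝ, ℂ)) (𝓡 n) ∞
      (fun p : TotalSpace ℂ L.fiber => p.1) ⟨x, v⟩ := contMDiffAt_proj L.fiber
  rw [contMDiffAt_totalSpace]
  refine ⟨hp, ?_⟩
  have h1 : ContMDiffAt ((𝓡 n).prod 𝓘(ℝ, ℂ)) 𝓘(ℝ, ℂ) ∞
      (fun p : TotalSpace ℂ L.fiber => L.coord x p.2) ⟨x, v⟩ :=
    (contMDiffAt_totalSpace.1 (contMDiffAt_id (I := (𝓡 n).prod 𝓘(ℝ, ℂ)) (n := ∞)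
      (x := (⟨x, v⟩ : TotalSpace ℂ L.fiber)))).2
  have h2 : ContMDiffAt ((𝓡 n).prod 𝓘(ℝ, ℂ)) 𝓘(ℝ, ℂ) ∞
      (fun p : TotalSpace ℂ L.fiber => L.coord x (e i p.1)) ⟨x, v⟩ :=
    ContMDiffAt.comp (⟨x, v⟩ : TotalSpace ℂ L.fiber) (g := fun y : M => L.coord x (e i y))
      (L.smoothAt_iff_coord.1 (h.smooth i x hi)) hp
  have h3 : ContMDiffAt ((𝓡 n).prod 𝓘(ℝ, ℂ)) 𝓘(ℝ, ℂ) ∞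
      (fun p : TotalSpace ℂ L.fiber => L'.coord x (e' i p.1)) ⟨x, v⟩ :=
    ContMDiffAt.comp (⟨x, v⟩ : TotalSpace ℂ L.fiber) (g := fun y : M => L'.coord x (e' i y))
      (L'.smoothAt_iff_coord.1 (h'.smooth i x hi)) hp
  refine (contMDiffAt_complex_mul (contMDiffAt_complex_mul h1 (contMDiffAt_complex_inv h2
    (RealLineBundle.coord_ne_zero (L.mem_chartSet x) (h.ne_zero hi)))) h3).congr_of_eventuallyEq ?_
  have hev : ∀ᶠ y in 𝓝 x, y ∈ 𝒰.U i ∧ y ∈ L.chartSet x ∧ y ∈ L'.chartSet x :=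
    (eventually_mem hi).and ((L.eventually_mem_chartSet x).and (L'.eventually_mem_chartSet x))
  have hev' := (hp.continuousAt.eventually hev)
  filter_upwards [hev'] with p hp
  obtain ⟨hp1, hp2, hp3⟩ := hp
  have h4 : φ p.1 p.2 = (L.coord x p.2 / L.coord x (e i p.1)) • e' i p.1 := by
    rw [← hφ i p.1 hp1, ← map_smul, RealLineBundle.coord_div_smul hp2 (h.ne_zero hp1)]
  change L'.coord x (φ p.1 p.2) = _
  rw [h4, RealLineBundle.coord_smul hp3, div_eq_mul_inv]

/-- Line bundles realizing the same cochain are isomorphic. -/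
def isoOfRealizes (h : Realizes L 𝒰 c e) (h' : Realizes L' 𝒰 c e') : Iso L L' where
  map := frameMap h.toIsFrame h'.toIsFrame
  smooth := contMDiff_of_frame h.toIsFrame h'.toIsFrame
    (fun x => (frameMap h.toIsFrame h'.toIsFrame x).toLinearMap)
    fun _ _ hx => frameMap_frame h h' hx
  smooth_symm := contMDiff_of_frame h'.toIsFrame h.toIsFrame
    (fun x => (frameMap h.toIsFrame h'.toIsFrame x).symm.toLinearMap)
    fun _ _ hx => (LinearEquiv.symm_apply_eq _).2 (frameMap_frame h h' hx).symm
  metric x v w := by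
    have hi := 𝒰.mem_idx x
    rw [frameMap_apply h h' hi, frameMap_apply h h' hi, L'.metric.form_smul_smul (h'.unit _ x hi),
      ← L.metric.form_smul_smul (h.unit _ x hi), L.metric.form_smul_self (h.unit _ x hi),
      L.metric.form_smul_self (h.unit _ x hi)]
  real x v := by
    have hi := 𝒰.mem_idx x
    rw [frameMap_apply h h' hi, frameMap_apply h h' (C2Cover.mem_inv hi), h.real _ x hi,
      h'.real _ x hi, L.metric.real, LinearMap.map_smulₛₗ]
  conn s x hs X := by
    have hi := 𝒰.mem_idx x
    set i := 𝒰.idx x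
    -- Write `s = φ e_i` near `x`. Both connections send `φ` times the frame to `(dφ + 2π φ α_i)`
    -- times the frame, with the same `α_i`.
    have hφ := h.diffAt_coeff hi hs
    have h1 : L'.conn.cov (fun y => frameMap h.toIsFrame h'.toIsFrame y (s y)) x =
        L'.conn.cov (fun y => L.metric.form y (e i y) (s y) • e' i y) x := by
      refine (L'.conn.cov_congr ((h'.diffAt hi).csmul hφ) ?_).symm
      filter_upwards [eventually_mem hi] with y hy using (frameMap_apply h h' hy _).symm
    have h2 : L.conn.cov s x = L.conn.cov (fun y => L.metric.form y (e i y) (s y) • e i y) x := by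
      refine (L.conn.cov_congr ((h.diffAt hi).csmul hφ) ?_).symm
      filter_upwards [eventually_mem hi] with y hy using L.metric.form_smul_self (h.unit i y hy) _
    rw [h1, h2, L'.conn.cov_smul (h'.diffAt hi) hφ, L.conn.cov_smul (h.diffAt hi) hφ,
      h.conn i x hi, h'.conn i x hi, map_add, map_smul, map_smul, map_smul, frameMap_frame h h' hi]

/-- The isomorphism `v ⊗ v' ↦ h(e, v) h'(e', v') e''` given by unit vectors. -/
def fiberTensorEquiv (L L' L'' : RealLineBundleWithConnection τ) {x : M} (v : L.fiber x)
    (v' : L'.fiber x) (v'' : L''.fiber x) (hv : L.metric.form x v v = 1)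
    (hv' : L'.metric.form x v' v' = 1) (hv'' : L''.metric.form x v'' v'' = 1) :
    L.fiber x ⊗[ℂ] L'.fiber x ≃ₗ[ℂ] L''.fiber x :=
  LinearEquiv.ofLinearMap
    ((LinearMap.toSpanSingleton ℂ (L''.fiber x) v'').comp
      ((LinearMap.mul' ℂ ℂ).comp (TensorProduct.map (L.metric.form x v) (L'.metric.form x v'))))
    ((LinearMap.toSpanSingleton ℂ _ (v ⊗ₜ[ℂ] v')).comp (L''.metric.form x v''))
    (by
      ext w
      simp [hv, hv', L''.metric.form_smul_self hv''])
    (by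
      ext w w'
      simp [hv'', ← TensorProduct.smul_tmul_smul, L.metric.form_smul_self hv,
        L'.metric.form_smul_self hv'])

/-- The tensor product map that matches frames. -/
def frameTensorMap (h : IsFrame L 𝒰 e) (h' : IsFrame L' 𝒰 e') (h'' : IsFrame L'' 𝒰 e'') (x : M) :
    L.fiber x ⊗[ℂ] L'.fiber x ≃ₗ[ℂ] L''.fiber x :=
  fiberTensorEquiv L L' L'' (e (𝒰.idx x) x) (e' (𝒰.idx x) x) (e'' (𝒰.idx x) x)
    (h.unit _ x (𝒰.mem_idx x)) (h'.unit _ x (𝒰.mem_idx x)) (h''.unit _ x (𝒰.mem_idx x))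

theorem frameTensorMap_frame (h : Realizes L 𝒰 c e) (h' : Realizes L' 𝒰 c' e')
    (h'' : Realizes L'' 𝒰 (c + c') e'') {i : 𝒰.ι} {x : M} (hi : x ∈ 𝒰.U i) :
    frameTensorMap h.toIsFrame h'.toIsFrame h''.toIsFrame x (e i x ⊗ₜ[ℂ] e' i x) = e'' i x := by
  have hx := 𝒰.mem_idx x
  change (L.metric.form x (e (𝒰.idx x) x) (e i x) * L'.metric.form x (e' (𝒰.idx x) x) (e' i x)) •
    e'' (𝒰.idx x) x = e'' i x
  rw [h.trans _ i x hx hi, h'.trans _ i x hx hi, h''.trans _ i x hx hi, map_smul, map_smul,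
    h.unit _ x hx, h'.unit _ x hx, smul_eq_mul, mul_one, smul_eq_mul, mul_one, logTrans_add,
    expTwoPi_add]

theorem frameTensorMap_apply (h : Realizes L 𝒰 c e) (h' : Realizes L' 𝒰 c' e')
    (h'' : Realizes L'' 𝒰 (c + c') e'') {i : 𝒰.ι} {x : M} (hi : x ∈ 𝒰.U i) (v : L.fiber x)
    (v' : L'.fiber x) :
    frameTensorMap h.toIsFrame h'.toIsFrame h''.toIsFrame x (v ⊗ₜ[ℂ] v') =
      (L.metric.form x (e i x) v * L'.metric.form x (e' i x) v') • e'' i x := by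
  rw [← frameTensorMap_frame h h' h'' hi, ← map_smul, ← TensorProduct.smul_tmul_smul,
    L.metric.form_smul_self (h.unit i x hi), L'.metric.form_smul_self (h'.unit i x hi)]

/-- A line bundle realizing `c + c'` is a tensor product of line bundles realizing `c` and `c'`. -/
def tensorIsoOfRealizes (h : Realizes L 𝒰 c e) (h' : Realizes L' 𝒰 c' e')
    (h'' : Realizes L'' 𝒰 (c + c') e'') : TensorIso L L' L'' where
  map := frameTensorMap h.toIsFrame h'.toIsFrame h''.toIsFrame
  smooth s t x hs ht := by
    have hi := 𝒰.mem_idx x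
    refine (RealLineBundle.SmoothAt.csmul (contMDiffAt_complex_mul
      (L.metric.smooth _ _ x (h.smooth _ x hi) hs) (L'.metric.smooth _ _ x (h'.smooth _ x hi) ht))
      (h''.smooth _ x hi)).congr ?_
    filter_upwards [eventually_mem hi] with y hy using frameTensorMap_apply h h' h'' hy _ _
  metric x v w v' w' := by
    have hi := 𝒰.mem_idx x
    rw [frameTensorMap_apply h h' h'' hi, frameTensorMap_apply h h' h'' hi,
      L''.metric.form_smul_smul (h''.unit _ x hi), map_mul, mul_mul_mul_comm,
      -- Products of coefficients are read backwards as metrics of multiples of the unit frames,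
      -- which are the original vectors.
      ← L.metric.form_smul_smul (h.unit _ x hi), ← L'.metric.form_smul_smul (h'.unit _ x hi)]
    simp only [L.metric.form_smul_self (h.unit _ x hi), L'.metric.form_smul_self (h'.unit _ x hi)]
  real x v v' := by
    have hi := 𝒰.mem_idx x
    rw [frameTensorMap_apply h h' h'' hi, frameTensorMap_apply h h' h'' (C2Cover.mem_inv hi),
      h.real _ x hi, h'.real _ x hi, h''.real _ x hi, L.metric.real, L'.metric.real,
      LinearMap.map_smulₛₗ, map_mul]
  conn s t x hs ht X := by
    have hi := 𝒰.mem_idx x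
    set i := 𝒰.idx x
    -- With `s = φ e_i` and `t = ψ e'_i`, the claim is the product rule for `φ ψ` together with
    -- additivity of the connection forms.
    have hφ := h.diffAt_coeff hi hs
    have hψ := h'.diffAt_coeff hi ht
    have h1 : L''.conn.cov
        (fun y => frameTensorMap h.toIsFrame h'.toIsFrame h''.toIsFrame y (s y ⊗ₜ[ℂ] t y)) x =
        L''.conn.cov (fun y => (L.metric.form y (e i y) (s y) * L'.metric.form y (e' i y) (t y)) •
          e'' i y) x := by
      refine (L''.conn.cov_congr ((h''.diffAt hi).csmul (mdifferentiableAt_complex_mul hφ hψ))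
        ?_).symm
      filter_upwards [eventually_mem hi] with y hy using (frameTensorMap_apply h h' h'' hy _ _).symm
    have h2 : L.conn.cov s x = L.conn.cov (fun y => L.metric.form y (e i y) (s y) • e i y) x := by
      refine (L.conn.cov_congr ((h.diffAt hi).csmul hφ) ?_).symm
      filter_upwards [eventually_mem hi] with y hy using L.metric.form_smul_self (h.unit i y hy) _
    have h3 : L'.conn.cov t x =
        L'.conn.cov (fun y => L'.metric.form y (e' i y) (t y) • e' i y) x := by
      refine (L'.conn.cov_congr ((h'.diffAt hi).csmul hψ) ?_).symm
      filter_upwards [eventually_mem hi] with y hy using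
        L'.metric.form_smul_self (h'.unit i y hy) _
    rw [h1, h2, h3, L''.conn.cov_smul (h''.diffAt hi) (mdifferentiableAt_complex_mul hφ hψ),
      L.conn.cov_smul (h.diffAt hi) hφ, L'.conn.cov_smul (h'.diffAt hi) hψ,
      mvfderiv_complex_mul hφ hψ, map_add, frameTensorMap_apply h h' h'' hi,
      frameTensorMap_apply h h' h'' hi, h.conn i x hi, h'.conn i x hi, h''.conn i x hi,
      potential_add]
    simp only [map_add, map_smul, h.unit i x hi, h'.unit i x hi, smul_eq_mul, mul_one]
    module

end RealLineBundleWithConnection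

end RealDeligne

/-! ### The Real line bundle glued from a cocycle. -/

namespace RealDeligne

variable {n : ℕ} {M : Type u} [TopologicalSpace M] [ChartedSpace (EuclideanSpace ℝ (Fin n)) M]
  [IsManifold (𝓡 n) ∞ M] {τ : SmoothInvolution n M}

theorem SmoothFormAt.add {α β : ∀ x : M, TangentSpace (𝓡 n) x →L[ℝ] ℂ} {x : M}
    (hα : SmoothFormAt α x) (hβ : SmoothFormAt β x) : SmoothFormAt (fun y => α y + β y) x :=
  ContMDiffAt.add_section hα hβ

theorem SmoothFormAt.mul {α : ∀ x : M, TangentSpace (𝓡 n) x →L[ℝ] ℂ} {φ : M → ℂ} {x : M}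
    (hφ : ContMDiffAt (𝓡 n) 𝓘(ℝ, ℂ) ∞ φ x) (hα : SmoothFormAt α x) :
    SmoothFormAt (fun y => (ContinuousLinearMap.mul ℝ ℂ (φ y)).comp (α y)) x := by
  rw [smoothFormAt_iff] at hα ⊢
  refine (RealLineBundle.contMDiffAt_mul_clm hφ hα).congr_of_eventuallyEq (.of_forall fun y => ?_)
  ext v
  exact (RealLineBundle.inCoordinates_form_apply
    (α := fun z => (ContinuousLinearMap.mul ℝ ℂ (φ z)).comp (α z)) v).trans
    (congrArg (fun z => φ y * z) (RealLineBundle.inCoordinates_form_apply v).symm)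

omit [IsManifold (𝓡 n) ∞ M] in
theorem RealLineBundle.DiffAt.conjSection {L : RealLineBundle τ} {s : ∀ x, L.fiber x} {x : M}
    (hs : L.DiffAt s (τ x)) : L.DiffAt (L.conjSection s) x := by
  have h : MDifferentiableAt (𝓡 n) ((𝓡 n).prod 𝓘(ℝ, ℂ))
      (fun y => TotalSpace.mk' ℂ y (s y)) (τ x) := hs
  have h1 := ((L.σ_smooth _).mdifferentiableAt (by simp)).comp x
    (h.comp x ((τ.contMDiff_toFun x).mdifferentiableAt (by simp)))
  refine h1.congr_of_eventuallyEq (.of_forall fun y => ?_)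
  have key : ∀ z (hz : τ (τ y) = z) (h' : L.fiber (τ (τ y)) = L.fiber z),
      TotalSpace.mk' ℂ z (cast h' (L.σ (τ y) (s (τ y)))) =
        ⟨τ (τ y), L.σ (τ y) (s (τ y))⟩ := by
    rintro z rfl h'
    rfl
  exact key y (τ.involutive y) _

section cocycle

variable {𝒰 : C2Cover τ.toInvolution}

/-- The transition function `g_{ij} = exp(2π f_{ij})`. -/
def transFun (c : 𝒰.T2 (deligneComplex2 τ)) (i j : 𝒰.ι) (x : M) : ℂ :=
  expTwoPi (logTrans c i j x)

theorem transFun_ne_zero (c : 𝒰.T2 (deligneComplex2 τ)) (i j : 𝒰.ι) (x : M) :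
    transFun c i j x ≠ 0 := expTwoPi_ne_zero _

theorem conj_mul_transFun (c : 𝒰.T2 (deligneComplex2 τ)) (i j : 𝒰.ι) (x : M) :
    conj (transFun c i j x) * transFun c i j x = 1 :=
  conj_mul_expTwoPi (logTrans_re c i j x)

theorem transFun_inv (c : 𝒰.T2 (deligneComplex2 τ)) (i j : 𝒰.ι) (x : M) :
    transFun c (𝒰.inv i) (𝒰.inv j) (τ x) = conj (transFun c i j x) := by
  rw [transFun, transFun, ← expTwoPi_conj, ← logTrans_real c i j x, Complex.conj_conj]

theorem transFun_contMDiffAt (c : 𝒰.T2 (deligneComplex2 τ)) {i j : 𝒰.ι} {x : M}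
    (hi : x ∈ 𝒰.U i) (hj : x ∈ 𝒰.U j) : ContMDiffAt (𝓡 n) 𝓘(ℝ, ℂ) ∞ (transFun c i j) x :=
  contMDiffAt_expTwoPi (logTrans_contMDiffAt c hi hj)

/-- The logarithms satisfy the cocycle relation only up to `iℤ`, which `expTwoPi` kills. -/
theorem transFun_mul {c : 𝒰.T2 (deligneComplex2 τ)} (hc : c ∈ (𝒰.D2 _).ker) {i j k : 𝒰.ι} {x : M}
    (hi : x ∈ 𝒰.U i) (hj : x ∈ 𝒰.U j) (hk : x ∈ 𝒰.U k) :
    transFun c i j x * transFun c j k x = transFun c i k x := by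
  obtain ⟨m, hm⟩ := logTrans_of_mem_ker hc hi hj hk
  have : logTrans c i j x + logTrans c j k x = m * Complex.I + logTrans c i k x := by
    rw [← hm]; ring
  rw [transFun, transFun, ← expTwoPi_add, this, expTwoPi_add, expTwoPi_int, one_mul]
  rfl

theorem transFun_self {c : 𝒰.T2 (deligneComplex2 τ)} (hc : c ∈ (𝒰.D2 _).ker) {i : 𝒰.ι} {x : M}
    (hi : x ∈ 𝒰.U i) : transFun c i i x = 1 :=
  mul_left_cancel₀ (transFun_ne_zero c i i x) (by rw [transFun_mul hc hi hi hi, mul_one])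

theorem contMDiffAt_mul_transFun (c : 𝒰.T2 (deligneComplex2 τ)) {i j : 𝒰.ι} {x : M}
    (hi : x ∈ 𝒰.U i) (hj : x ∈ 𝒰.U j) :
    ContMDiffAt (𝓡 n) 𝓘(ℝ, ℂ →L[ℝ] ℂ) ∞
      (fun y => ContinuousLinearMap.mul ℝ ℂ (transFun c i j y)) x :=
  (ContinuousLinearMap.mul ℝ ℂ).contDiff.contMDiff.contMDiffAt.comp x
    (transFun_contMDiffAt c hi hj)

variable (c : 𝒰.T2 (deligneComplex2 τ)) (hc : c ∈ (𝒰.D2 (deligneComplex2 τ)).ker)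

/-- The gluing data of the line bundle of a cocycle. -/
def cocycleCore : VectorBundleCore ℝ M ℂ 𝒰.ι where
  baseSet i := 𝒰.U i
  isOpen_baseSet i := (𝒰.U i).isOpen
  indexAt := 𝒰.idx
  mem_baseSet_at := 𝒰.mem_idx
  -- The indices are reversed because coordinates change inversely to frames: from `e_i = g_ji e_j`
  -- the `j`-th coordinate is `g_ji` times the `i`-th.
  coordChange i j x := ContinuousLinearMap.mul ℝ ℂ (transFun c j i x)
  coordChange_self _ _ hx _ := by simp [transFun_self hc hx]
  continuousOn_coordChange _ _ _ hx :=
    (contMDiffAt_mul_transFun c hx.2 hx.1).continuousAt.continuousWithinAt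
  coordChange_comp _ _ _ _ hx _ := by
    simp only [ContinuousLinearMap.mul_apply', ← mul_assoc, transFun_mul hc hx.2 hx.1.2 hx.1.1]

instance cocycleCore_isContMDiff : (cocycleCore c hc).IsContMDiff (𝓡 n) ∞ where
  contMDiffOn_coordChange _ _ _ hx :=
    (contMDiffAt_mul_transFun c hx.2 hx.1).contMDiffWithinAt

/-- The gluing data are real because the manifold and all smoothness are real. The complex structure
is restored afterwards, and is compatible because the coordinate changes are multiplications by
complex numbers. -/
instance cocycleFiberModule (x : M) : Module ℂ ((cocycleCore c hc).Fiber x) :=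
  inferInstanceAs (Module ℂ ℂ)

/-- The fibre over `x` is a copy of `ℂ`. -/
def cocycleVal (x : M) : (cocycleCore c hc).Fiber x ≃ₗ[ℂ] ℂ := LinearEquiv.refl ℂ ℂ

/-- The coordinate with respect to the `i`-th local trivialization. -/
def cocycleCoord (i : 𝒰.ι) (p : TotalSpace ℂ (cocycleCore c hc).Fiber) : ℂ :=
  transFun c i (𝒰.idx p.1) p.1 * cocycleVal c hc p.1 p.2

instance localTriv_isLinear (i : 𝒰.ι) : ((cocycleCore c hc).localTriv i).IsLinear ℂ :=
  ⟨fun x _ => ⟨fun v w => mul_add (transFun c i (𝒰.idx x) x) (v : ℂ) (w : ℂ),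
    fun a v => mul_left_comm (transFun c i (𝒰.idx x) x) a (v : ℂ)⟩⟩

instance cocycleVectorBundle : VectorBundle ℂ ℂ (cocycleCore c hc).Fiber where
  trivialization_linear' := by
    rintro _ ⟨i, rfl⟩
    exact localTriv_isLinear c hc i
  continuousOn_coordChange' := by
    rintro _ _ ⟨i, rfl⟩ ⟨j, rfl⟩
    have h : ContinuousOn (fun x => ContinuousLinearMap.mul ℂ ℂ (transFun c j i x))
        ((𝒰.U i : Set M) ∩ 𝒰.U j) := fun x hx =>
      ((ContinuousLinearMap.mul ℂ ℂ).continuous.continuousAt.comp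
        (transFun_contMDiffAt c hx.2 hx.1).continuousAt).continuousWithinAt
    refine h.congr fun x hx => ?_
    ext
    have h1 := Trivialization.coordChangeL_apply (R := ℂ) ((cocycleCore c hc).localTriv i)
      ((cocycleCore c hc).localTriv j) hx 1
    have h2 := Trivialization.coordChangeL_apply (R := ℝ) ((cocycleCore c hc).localTriv i)
      ((cocycleCore c hc).localTriv j) hx 1
    exact h1.trans (h2.symm.trans ((cocycleCore c hc).localTriv_coordChange_eq i j hx 1))

/-- The `i`-th local unit section. -/
def cocycleFrame (i : 𝒰.ι) (x : M) : (cocycleCore c hc).Fiber x :=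
  (cocycleVal c hc x).symm (transFun c (𝒰.idx x) i x)

theorem cocycleCoord_frame {i : 𝒰.ι} {x : M} (hi : x ∈ 𝒰.U i) :
    cocycleCoord c hc i ⟨x, cocycleFrame c hc i x⟩ = 1 :=
  (transFun_mul hc hi (𝒰.mem_idx x) hi).trans (transFun_self hc hi)

theorem cocycleCoord_idx (x : M) (v : (cocycleCore c hc).Fiber x) :
    cocycleCoord c hc (𝒰.idx x) ⟨x, v⟩ = cocycleVal c hc x v := by
  rw [cocycleCoord, transFun_self hc (𝒰.mem_idx x), one_mul]

theorem cocycleCoord_change {i j : 𝒰.ι} {p : TotalSpace ℂ (cocycleCore c hc).Fiber}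
    (hi : p.1 ∈ 𝒰.U i) (hj : p.1 ∈ 𝒰.U j) :
    transFun c i j p.1 * cocycleCoord c hc j p = cocycleCoord c hc i p := by
  rw [cocycleCoord, cocycleCoord, ← mul_assoc, transFun_mul hc hi hj (𝒰.mem_idx _)]

/-- Smoothness may be tested in the trivialization of any index whose set contains the base point,
not only of the preferred index `𝒰.idx`; later computations can thus fix `i` while the point varies.
-/
theorem cocycle_contMDiffAt_iff {E H N : Type*} [NormedAddCommGroup E] [NormedSpace ℝ E]
    [TopologicalSpace H] {I : ModelWithCorners ℝ E H} [TopologicalSpace N] [ChartedSpace H N]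
    {F : N → TotalSpace ℂ (cocycleCore c hc).Fiber} {y : N} {i : 𝒰.ι} (hi : (F y).1 ∈ 𝒰.U i) :
    ContMDiffAt I ((𝓡 n).prod 𝓘(ℝ, ℂ)) ∞ F y ↔ ContMDiffAt I (𝓡 n) ∞ (fun z => (F z).1) y ∧
      ContMDiffAt I 𝓘(ℝ, ℂ) ∞ (fun z => cocycleCoord c hc i (F z)) y :=
  haveI : MemTrivializationAtlas ((cocycleCore c hc).localTriv i) := ⟨⟨i, rfl⟩⟩
  ((cocycleCore c hc).localTriv i).contMDiffAt_iff hi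

theorem cocycleCoord_injective {i : 𝒰.ι} {p q : TotalSpace ℂ (cocycleCore c hc).Fiber}
    (hi : p.1 ∈ 𝒰.U i) (h1 : p.1 = q.1) (h2 : cocycleCoord c hc i p = cocycleCoord c hc i q) :
    p = q :=
  ((cocycleCore c hc).localTriv i).toOpenPartialHomeomorph.injOn
    (((cocycleCore c hc).mem_localTriv_source i p).2 hi)
    (((cocycleCore c hc).mem_localTriv_source i q).2 (h1 ▸ hi)) (Prod.ext h1 h2)

/-- The Real structure of the line bundle of a cocycle. -/
def cocycleσ (x : M) :
    (cocycleCore c hc).Fiber x →ₛₗ[starRingEnd ℂ] (cocycleCore c hc).Fiber (τ x) where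
  toFun v := (cocycleVal c hc (τ x)).symm
    -- Conjugation naturally lands in the trivialization of index `𝒰.inv (𝒰.idx x)`; the transition
    -- function converts to the preferred index at `τ x`.
    (transFun c (𝒰.idx (τ x)) (𝒰.inv (𝒰.idx x)) (τ x) * conj (cocycleVal c hc x v))
  map_add' v w := by simp only [map_add, mul_add]
  map_smul' a v := by
    rw [map_smul, smul_eq_mul, (starRingEnd ℂ).map_mul, mul_left_comm,
      ← smul_eq_mul (conj a), map_smul]

/-- Equivariance of the cocycle makes the definition of `cocycleσ` independent of the index: in
every pair of trivializations `i` and `τ(i)` it is plain conjugation. Involutivity and smoothness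
follow at once. -/
theorem cocycleCoord_σ {i : 𝒰.ι} (p : TotalSpace ℂ (cocycleCore c hc).Fiber)
    (hi : p.1 ∈ 𝒰.U i) :
    cocycleCoord c hc (𝒰.inv i) ⟨τ p.1, cocycleσ c hc p.1 p.2⟩ =
      conj (cocycleCoord c hc i p) := by
  obtain ⟨x, v⟩ := p
  change transFun c (𝒰.inv i) (𝒰.idx (τ x)) (τ x) *
    (transFun c (𝒰.idx (τ x)) (𝒰.inv (𝒰.idx x)) (τ x) * conj (cocycleVal c hc x v)) =
      conj (transFun c i (𝒰.idx x) x * cocycleVal c hc x v)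
  rw [← mul_assoc, transFun_mul hc (C2Cover.mem_inv hi) (𝒰.mem_idx _)
    (C2Cover.mem_inv (𝒰.mem_idx x)), transFun_inv, map_mul]

/-- The Real line bundle of a cocycle. -/
def cocycleBundle : RealLineBundle τ where
  fiber := (cocycleCore c hc).Fiber
  topAddGroup _ := inferInstanceAs (IsTopologicalAddGroup ℂ)
  contSMul _ := inferInstanceAs (ContinuousSMul ℝ ℂ)
  realVectorBundle := (cocycleCore c hc).vectorBundle
  smoothBundle := VectorBundleCore.instContMDiffVectorBundle (cocycleCore c hc)
  σ := cocycleσ c hc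
  σ_involutive p := by
    have hi := 𝒰.mem_idx p.1
    refine cocycleCoord_injective c hc (i := 𝒰.idx p.1) ?_ (τ.involutive p.1) ?_
    · change τ (τ p.1) ∈ 𝒰.U _
      rw [τ.involutive p.1]
      exact hi
    · have h1 := cocycleCoord_σ c hc ⟨τ p.1, cocycleσ c hc p.1 p.2⟩ (C2Cover.mem_inv hi)
      rw [𝒰.inv_inv, cocycleCoord_σ c hc p hi, Complex.conj_conj] at h1
      exact h1
  σ_smooth p := by
    have hi := 𝒰.mem_idx p.1
    have h0 : ContMDiffAt ((𝓡 n).prod 𝓘(ℝ, ℂ)) (𝓡 n) ∞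
        (fun q : TotalSpace ℂ (cocycleCore c hc).Fiber => q.1) p := contMDiffAt_proj _
    have h1 : ContMDiffAt ((𝓡 n).prod 𝓘(ℝ, ℂ)) 𝓘(ℝ, ℂ) ∞ (cocycleCoord c hc (𝒰.idx p.1)) p :=
      ((cocycle_contMDiffAt_iff c hc (F := id) hi).1 contMDiffAt_id).2
    refine (cocycle_contMDiffAt_iff c hc (i := 𝒰.inv (𝒰.idx p.1)) (C2Cover.mem_inv hi)).2
      ⟨(τ.contMDiff_toFun _).comp p h0, ?_⟩
    refine (contMDiffAt_complex_conj h1).congr_of_eventuallyEq ?_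
    filter_upwards [h0.continuousAt.eventually
      (RealLineBundleWithConnection.eventually_mem hi)] with q hq
    exact cocycleCoord_σ c hc q hq

end cocycle

end RealDeligne

/-! ### Metric and connection on the glued bundle. -/

namespace RealDeligne

variable {n : ℕ} {M : Type u} [TopologicalSpace M] [ChartedSpace (EuclideanSpace ℝ (Fin n)) M]
  [IsManifold (𝓡 n) ∞ M] {τ : SmoothInvolution n M} {𝒰 : C2Cover τ.toInvolution}

section cocycle

variable (c : 𝒰.T2 (deligneComplex2 τ)) (hc : c ∈ (𝒰.D2 (deligneComplex2 τ)).ker)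

/-- The fibre over `x` of the line bundle of a cocycle is a copy of `ℂ`. -/
def fibVal (x : M) : (cocycleBundle c hc).fiber x ≃ₗ[ℂ] ℂ := cocycleVal c hc x

/-- The `i`-th local unit section of the line bundle of a cocycle. -/
def bundleFrame (i : 𝒰.ι) (x : M) : (cocycleBundle c hc).fiber x := cocycleFrame c hc i x

/-- The coordinate of a section in the `i`-th local trivialization. -/
def sectionCoord (i : 𝒰.ι) (s : ∀ x, (cocycleBundle c hc).fiber x) (x : M) : ℂ :=
  cocycleCoord c hc i ⟨x, s x⟩

theorem cocycleBundle_smoothAt_iff {i : 𝒰.ι} {x : M} (hi : x ∈ 𝒰.U i)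
    {s : ∀ x, (cocycleBundle c hc).fiber x} : (cocycleBundle c hc).SmoothAt s x ↔
      ContMDiffAt (𝓡 n) 𝓘(ℝ, ℂ) ∞ (sectionCoord c hc i s) x :=
  (cocycle_contMDiffAt_iff c hc (F := fun y => ⟨y, s y⟩) hi).trans
    (and_iff_right contMDiffAt_id)

theorem cocycleBundle_diffAt_iff {i : 𝒰.ι} {x : M} (hi : x ∈ 𝒰.U i)
    {s : ∀ x, (cocycleBundle c hc).fiber x} : (cocycleBundle c hc).DiffAt s x ↔
      MDifferentiableAt (𝓡 n) 𝓘(ℝ, ℂ) (sectionCoord c hc i s) x :=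
  haveI : MemTrivializationAtlas ((cocycleCore c hc).localTriv i) := ⟨⟨i, rfl⟩⟩
  haveI : ContMDiffVectorBundle 1 ℂ (cocycleCore c hc).Fiber (𝓡 n) :=
    ContMDiffVectorBundle.of_le (n := ∞) (by simp)
  Trivialization.mdifferentiableAt_section_iff (𝓡 n) ((cocycleCore c hc).localTriv i) s hi

theorem sectionCoord_idx (s : ∀ x, (cocycleBundle c hc).fiber x) (x : M) :
    sectionCoord c hc (𝒰.idx x) s x = fibVal c hc x (s x) :=
  cocycleCoord_idx c hc x (s x)

/-- The transition functions have absolute value one, so the standard Hermitian form of `ℂ` does not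
depend on the trivialization. -/
theorem conj_mul_sectionCoord {i : 𝒰.ι} {x : M} (s t : ∀ x, (cocycleBundle c hc).fiber x) :
    conj (sectionCoord c hc i s x) * sectionCoord c hc i t x =
      conj (fibVal c hc x (s x)) * fibVal c hc x (t x) := by
  change conj (transFun c i (𝒰.idx x) x * fibVal c hc x (s x)) *
    (transFun c i (𝒰.idx x) x * fibVal c hc x (t x)) = _
  rw [map_mul, mul_mul_mul_comm, conj_mul_transFun, one_mul]

/-- The Hermitian metric of the line bundle of a cocycle. -/
def cocycleMetric : (cocycleBundle c hc).HermitianMetric where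
  form x := LinearMap.mk₂'ₛₗ (starRingEnd ℂ) (RingHom.id ℂ)
    (fun v w => conj (fibVal c hc x v) * fibVal c hc x w)
    (fun v v' w => by simp only [map_add, add_mul])
    (fun a v w => by simp only [map_smul, smul_eq_mul, (starRingEnd ℂ).map_mul, mul_assoc])
    (fun v w w' => by simp only [map_add, mul_add])
    (fun a v w => by simp only [map_smul, smul_eq_mul, RingHom.id_apply, mul_left_comm])
  conj_symm x v w := by
    simp only [LinearMap.mk₂'ₛₗ_apply, map_mul, Complex.conj_conj, mul_comm]
  pos x v hv := by
    have : fibVal c hc x v ≠ 0 := fun h => hv ((fibVal c hc x).map_eq_zero_iff.1 h)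
    rw [LinearMap.mk₂'ₛₗ_apply, ← Complex.normSq_eq_conj_mul_self, Complex.ofReal_re]
    exact Complex.normSq_pos.2 this
  smooth s t x hs ht := by
    have hi := 𝒰.mem_idx x
    rw [cocycleBundle_smoothAt_iff c hc hi] at hs ht
    exact (contMDiffAt_complex_mul (contMDiffAt_complex_conj hs) ht).congr_of_eventuallyEq
      (.of_forall fun y => (conj_mul_sectionCoord c hc s t).symm)
  real x v w := by
    change conj (transFun c _ _ (τ x) * conj (fibVal c hc x v)) *
      (transFun c _ _ (τ x) * conj (fibVal c hc x w)) =
        conj (conj (fibVal c hc x v) * fibVal c hc x w)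
    rw [map_mul, mul_mul_mul_comm, conj_mul_transFun, one_mul, map_mul]

theorem cocycleMetric_form {i : 𝒰.ι} {x : M} (s t : ∀ x, (cocycleBundle c hc).fiber x) :
    (cocycleMetric c hc).form x (s x) (t x) =
      conj (sectionCoord c hc i s x) * sectionCoord c hc i t x :=
  (conj_mul_sectionCoord c hc s t).symm

/-- The real-linear isomorphism of the fibre over `x` with `ℂ`. -/
def fibValCLM (x : M) : ℂ →L[ℝ] (cocycleBundle c hc).fiber x :=
  LinearMap.toContinuousLinearMap ((fibVal c hc x).symm.toLinearMap.restrictScalars ℝ)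

/-- The covariant derivative `dφ + 2π α φ` in the `i`-th local trivialization. -/
def covCoord (i : 𝒰.ι) (s : ∀ x, (cocycleBundle c hc).fiber x) (x : M) :
    TangentSpace (𝓡 n) x →L[ℝ] ℂ :=
  mvfderiv (𝓡 n) (sectionCoord c hc i s) x +
    (ContinuousLinearMap.mul ℝ ℂ (2 * Real.pi * sectionCoord c hc i s x)).comp (potential c i x)

theorem covCoord_apply (i : 𝒰.ι) (s : ∀ x, (cocycleBundle c hc).fiber x) (x : M)
    (X : TangentSpace (𝓡 n) x) : covCoord c hc i s x X =
      mvfderiv (𝓡 n) (sectionCoord c hc i s) x X +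
        2 * Real.pi * sectionCoord c hc i s x * potential c i x X := rfl

/-- The covariant derivative of sections of the line bundle of a cocycle. -/
def cocycleCov (s : ∀ x, (cocycleBundle c hc).fiber x) (x : M) :
    TangentSpace (𝓡 n) x →L[ℝ] (cocycleBundle c hc).fiber x :=
  (fibValCLM c hc x).comp (covCoord c hc (𝒰.idx x) s x)

theorem cocycleCov_apply (s : ∀ x, (cocycleBundle c hc).fiber x) (x : M)
    (X : TangentSpace (𝓡 n) x) :
    fibVal c hc x (cocycleCov c hc s x X) = covCoord c hc (𝒰.idx x) s x X :=
  rfl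

variable {s t : ∀ x, (cocycleBundle c hc).fiber x} {x : M}

/-- From `α_j - α_i = d f_ij` one gets `d g_ij = 2π (α_j - α_i) g_ij`, which exactly compensates the
change of connection form. Hence the local operators `dφ + 2π α_i φ` glue. -/
theorem covCoord_change {i j : 𝒰.ι} (hi : x ∈ 𝒰.U i) (hj : x ∈ 𝒰.U j)
    (hs : (cocycleBundle c hc).DiffAt s x) (X : TangentSpace (𝓡 n) x) :
    covCoord c hc i s x X = transFun c i j x * covCoord c hc j s x X := by
  have hs' := (cocycleBundle_diffAt_iff c hc hj).1 hs
  have hf := (logTrans_contMDiffAt c hi hj).mdifferentiableAt (by simp)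
  have hg : MDifferentiableAt (𝓡 n) 𝓘(ℝ, ℂ) (transFun c i j) x :=
    (transFun_contMDiffAt c hi hj).mdifferentiableAt (by simp)
  have h1 : mvfderiv (𝓡 n) (sectionCoord c hc i s) x =
      mvfderiv (𝓡 n) (fun y => transFun c i j y * sectionCoord c hc j s y) x := by
    refine mvfderiv_congr_eventually ?_
    filter_upwards [RealLineBundleWithConnection.eventually_mem hi,
      RealLineBundleWithConnection.eventually_mem hj] with y h1 h2
    exact (cocycleCoord_change c hc (p := ⟨y, s y⟩) h1 h2).symm
  have h2 : sectionCoord c hc i s x = transFun c i j x * sectionCoord c hc j s x :=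
    (cocycleCoord_change c hc (p := ⟨x, s x⟩) hi hj).symm
  have h3 : mvfderiv (𝓡 n) (transFun c i j) x X =
      2 * Real.pi * (potential c j x X - potential c i x X) * transFun c i j x := by
    have h4 := congrArg (fun T : TangentSpace (𝓡 n) x →L[ℝ] ℂ => T X)
      (potential_sub_of_mem_ker hc hi hj)
    exact (mvfderiv_expTwoPi hf X).trans (congrArg (fun z => 2 * Real.pi * z * transFun c i j x)
      h4.symm)
  rw [covCoord_apply, covCoord_apply, h1, h2, mvfderiv_complex_mul hg hs', h3]
  ring

theorem cocycleCov_eq {i : 𝒰.ι} (hi : x ∈ 𝒰.U i) (hs : (cocycleBundle c hc).DiffAt s x)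
    (X : TangentSpace (𝓡 n) x) :
    cocycleCov c hc s x X = covCoord c hc i s x X • bundleFrame c hc i x := by
  apply (fibVal c hc x).injective
  rw [cocycleCov_apply, covCoord_change c hc (𝒰.mem_idx x) hi hs, map_smul, smul_eq_mul, mul_comm]
  rfl

theorem sectionCoord_smul (i : 𝒰.ι) (a : ℂ) :
    sectionCoord c hc i (a • s) = fun y => a * sectionCoord c hc i s y := by
  funext y
  change transFun c i (𝒰.idx y) y * fibVal c hc y (a • s y) = _
  rw [map_smul, smul_eq_mul, mul_left_comm]
  rfl

theorem sectionCoord_add (i : 𝒰.ι) :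
    sectionCoord c hc i (s + t) = sectionCoord c hc i s + sectionCoord c hc i t := by
  funext y
  change transFun c i (𝒰.idx y) y * fibVal c hc y (s y + t y) = _
  rw [map_add, mul_add]
  rfl

theorem sectionCoord_real_smul (i : 𝒰.ι) (a : M → ℝ) :
    sectionCoord c hc i (a • s) = fun y => (a y : ℂ) * sectionCoord c hc i s y := by
  funext y
  change transFun c i (𝒰.idx y) y * fibVal c hc y ((a y : ℂ) • s y) = _
  rw [map_smul, smul_eq_mul, mul_left_comm]
  rfl

theorem sectionCoord_frame {i : 𝒰.ι} (hi : x ∈ 𝒰.U i) :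
    sectionCoord c hc i (bundleFrame c hc i) x = 1 :=
  cocycleCoord_frame c hc hi

theorem smoothAt_bundleFrame {i : 𝒰.ι} (hi : x ∈ 𝒰.U i) :
    (cocycleBundle c hc).SmoothAt (bundleFrame c hc i) x := by
  rw [cocycleBundle_smoothAt_iff c hc hi]
  refine (contMDiffAt_const (c := (1 : ℂ))).congr_of_eventuallyEq ?_
  filter_upwards [RealLineBundleWithConnection.eventually_mem hi] with y hy using
    sectionCoord_frame c hc hy

theorem isCovariantDerivativeOn_cocycleCov :
    IsCovariantDerivativeOn (I := 𝓡 n) ℂ (cocycleCov c hc) Set.univ where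
  add {s t x} hs ht _ := by
    have hs' := (cocycleBundle_diffAt_iff c hc (𝒰.mem_idx x)).1 hs
    have ht' := (cocycleBundle_diffAt_iff c hc (𝒰.mem_idx x)).1 ht
    ext X
    apply (fibVal c hc x).injective
    rw [add_apply, map_add, cocycleCov_apply, cocycleCov_apply, cocycleCov_apply, covCoord_apply,
      covCoord_apply, covCoord_apply, sectionCoord_add, mvfderiv_add hs' ht', Pi.add_apply,
      add_apply]
    ring
  leibniz {s a x} hs ha _ := by
    have hs' := (cocycleBundle_diffAt_iff c hc (𝒰.mem_idx x)).1 hs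
    have hac : MDifferentiableAt (𝓡 n) 𝓘(ℝ, ℂ) (fun y => (a y : ℂ)) x :=
      MDifferentiableAt.comp x (g := fun r : ℝ => (r : ℂ)) Complex.ofRealCLM.mdifferentiableAt ha
    ext X
    apply (fibVal c hc x).injective
    have h1 : mvfderiv (𝓡 n) (fun y => (a y : ℂ)) x X = (mvfderiv (𝓡 n) a x X : ℝ) := by
      have h := (Complex.ofRealCLM.hasMFDerivAt (x := a x)).comp x ha.hasMFDerivAt
      exact congrArg (fun T => T X) h.mfderiv
    have h2 : (a x • cocycleCov c hc s x + (mvfderiv (𝓡 n) a x).smulRight (s x)) X =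
        (a x : ℂ) • cocycleCov c hc s x X + ((mvfderiv (𝓡 n) a x X : ℝ) : ℂ) • s x := rfl
    rw [h2, map_add, map_smul, map_smul, cocycleCov_apply, cocycleCov_apply, covCoord_apply,
      covCoord_apply, sectionCoord_real_smul, mvfderiv_complex_mul hac hs', h1, smul_eq_mul,
      smul_eq_mul, ← sectionCoord_idx]
    ring

theorem smoothHomAt_cocycleCov (hs : ∀ y, (cocycleBundle c hc).SmoothAt s y) :
    (cocycleBundle c hc).SmoothHomAt (cocycleCov c hc s) x := by
  have hi := 𝒰.mem_idx x
  set i := 𝒰.idx x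
  have hs' := (cocycleBundle_smoothAt_iff c hc hi).1 (hs x)
  refine RealLineBundle.smoothHomAt_of_smoothFormAt (α := covCoord c hc i s)
    (smoothAt_bundleFrame c hc hi) ?_ ?_
  -- The definition of `cocycleCov` at `y` uses the index `𝒰.idx y`, which varies discontinuously;
  -- `cocycleCov_eq` replaces it by the fixed `i`.
  · filter_upwards [RealLineBundleWithConnection.eventually_mem hi] with y hy X
    exact cocycleCov_eq c hc hy (hs y).diffAt X
  · exact (smoothFormAt_mvfderiv hs').add
      (.mul (contMDiffAt_complex_mul contMDiffAt_const hs') (potential_smooth c hi))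

/-- The Real connection of the line bundle of a cocycle. -/
def cocycleConn : (cocycleBundle c hc).RealConnection (cocycleMetric c hc) where
  cov := ⟨cocycleCov c hc, isCovariantDerivativeOn_cocycleCov c hc⟩
  smooth := ⟨⟨fun {s} hs x _ => (smoothHomAt_cocycleCov c hc
    (fun y => (hs y trivial).contMDiffAt Filter.univ_mem)).contMDiffWithinAt⟩⟩
  smul a s x hs X := by
    have hs' := (cocycleBundle_diffAt_iff c hc (𝒰.mem_idx x)).1 hs
    apply (fibVal c hc x).injective
    change fibVal c hc x (cocycleCov c hc (a • s) x X) =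
      fibVal c hc x (a • cocycleCov c hc s x X)
    rw [map_smul, cocycleCov_apply, cocycleCov_apply, covCoord_apply,
      covCoord_apply, sectionCoord_smul, mvfderiv_complex_mul mdifferentiableAt_const hs',
      mvfderiv_const, smul_eq_mul, zero_apply]
    ring
  hermitian s t x hs ht X := by
    have hs' := (cocycleBundle_diffAt_iff c hc (𝒰.mem_idx x)).1 hs
    have ht' := (cocycleBundle_diffAt_iff c hc (𝒰.mem_idx x)).1 ht
    set i := 𝒰.idx x
    have h1 : (fun y => (cocycleMetric c hc).form y (s y) (t y)) =
        fun y => conj (sectionCoord c hc i s y) * sectionCoord c hc i t y :=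
      funext fun y => cocycleMetric_form c hc s t
    have h2 : (cocycleMetric c hc).form x (cocycleCov c hc s x X) (t x) =
        conj (covCoord c hc i s x X) * sectionCoord c hc i t x :=
      congrArg (fun z => conj (covCoord c hc i s x X) * z) (sectionCoord_idx c hc t x).symm
    have h3 : (cocycleMetric c hc).form x (s x) (cocycleCov c hc t x X) =
        conj (sectionCoord c hc i s x) * covCoord c hc i t x X :=
      congrArg (fun z => conj z * covCoord c hc i t x X) (sectionCoord_idx c hc s x).symm
    -- Since `α_i` is imaginary, its contributions to the two metric terms cancel.
    have h4 : conj (potential c i x X) = -potential c i x X :=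
      Complex.ext (by simp [potential_re]) (by simp)
    refine Eq.trans ?_ (congrArg₂ (· + ·) h2 h3).symm
    rw [h1, mvfderiv_complex_mul (mdifferentiableAt_complex_conj hs') ht',
      mvfderiv_complex_conj hs', covCoord_apply, covCoord_apply]
    simp only [map_add, map_mul, map_ofNat, Complex.conj_ofReal, h4]
    ring
  real s x hs X := by
    set i := 𝒰.idx x with hi_def
    have hi : x ∈ 𝒰.U i := 𝒰.mem_idx x
    set F := sectionCoord c hc (𝒰.inv i) ((cocycleBundle c hc).conjSection s) with hF_def
    have hcs : (cocycleBundle c hc).DiffAt ((cocycleBundle c hc).conjSection s) (τ x) := by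
      refine RealLineBundle.DiffAt.conjSection ?_
      rw [τ.involutive x]
      exact hs
    have hF := (cocycleBundle_diffAt_iff c hc (C2Cover.mem_inv hi)).1 hcs
    have hs' := (cocycleBundle_diffAt_iff c hc hi).1 hs
    have hτ : MDifferentiableAt (𝓡 n) (𝓡 n) τ x :=
      (τ.contMDiff_toFun x).mdifferentiableAt (by simp)
    -- The `τ(i)`-th coordinate of `σ ∘ s ∘ τ`, pulled back by `τ`, is the conjugate of the `i`-th
    -- coordinate of `s`. The chain rule carries this over to derivatives, and `potential_real` does
    -- the same for the connection form.
    have h1 : ∀ y ∈ 𝒰.U i, F (τ y) = conj (sectionCoord c hc i s y) := fun y hy => by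
      rw [hF_def, sectionCoord, RealLineBundle.conjSection_apply]
      exact cocycleCoord_σ c hc ⟨y, s y⟩ hy
    have h2 : mvfderiv (𝓡 n) F (τ x) (mfderiv (𝓡 n) (𝓡 n) τ x X) =
        conj (mvfderiv (𝓡 n) (sectionCoord c hc i s) x X) := by
      rw [← mvfderiv_complex_conj hs']
      have h3 : mvfderiv (𝓡 n) (fun y => F (τ y)) x X =
          mvfderiv (𝓡 n) F (τ x) (mfderiv (𝓡 n) (𝓡 n) τ x X) :=
        congrArg (fun T => T X) (mfderiv_comp x hF hτ)
      rw [← h3]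
      refine congrArg (fun T : TangentSpace (𝓡 n) x →L[ℝ] ℂ => T X) (mvfderiv_congr_eventually ?_)
      filter_upwards [RealLineBundleWithConnection.eventually_mem hi] with y hy using h1 y hy
    have h4 : potential c (𝒰.inv i) (τ x) (mfderiv (𝓡 n) (𝓡 n) τ x X) =
        conj (potential c i x X) := by
      rw [← potential_real c i x X, Complex.conj_conj]
    have h5 := cocycleCov_eq c hc (C2Cover.mem_inv hi) hcs (mfderiv (𝓡 n) (𝓡 n) τ x X)
    refine h5.trans ?_
    apply (fibVal c hc (τ x)).injective
    rw [map_smul, smul_eq_mul, mul_comm, covCoord_apply]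
    change transFun c (𝒰.idx (τ x)) (𝒰.inv i) (τ x) * _ =
      transFun c (𝒰.idx (τ x)) (𝒰.inv i) (τ x) * conj (covCoord c hc i s x X)
    rw [h4, h2, covCoord_apply]
    change _ * (_ + 2 * Real.pi * F (τ x) * _) = _
    rw [h1 x hi]
    simp only [map_add, map_mul, map_ofNat, Complex.conj_ofReal]

/-- The Real Hermitian line bundle with Real connection of a cocycle. -/
def cocycleLine : RealLineBundleWithConnection τ where
  toRealLineBundle := cocycleBundle c hc
  metric := cocycleMetric c hc
  conn := cocycleConn c hc

theorem cocycleLine_realizes : (cocycleLine c hc).Realizes 𝒰 c (bundleFrame c hc) where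
  smooth i x hi := smoothAt_bundleFrame c hc hi
  unit i x hi := by
    have := cocycleMetric_form c hc (i := i) (x := x) (bundleFrame c hc i) (bundleFrame c hc i)
    rw [sectionCoord_frame c hc hi, map_one, mul_one] at this
    exact this
  real i x hi := by
    have h1 := (cocycleCoord_σ c hc ⟨x, cocycleFrame c hc i x⟩ hi).trans
      ((congrArg conj (cocycleCoord_frame c hc hi)).trans
        ((map_one _).trans (cocycleCoord_frame c hc (C2Cover.mem_inv hi)).symm))
    have h2 := cocycleCoord_injective c hc (p := ⟨τ x, cocycleσ c hc x (cocycleFrame c hc i x)⟩)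
      (q := ⟨τ x, cocycleFrame c hc (𝒰.inv i) (τ x)⟩) (C2Cover.mem_inv hi) rfl h1
    exact (TotalSpace.mk_inj.1 h2).symm
  trans i j x hi hj := by
    apply (fibVal c hc x).injective
    refine ((transFun_mul hc (𝒰.mem_idx x) hi hj).symm.trans (mul_comm _ _)).trans ?_
    exact (map_smul (fibVal c hc x) (transFun c i j x) (bundleFrame c hc i x)).symm
  conn i x hi X := by
    have h := cocycleCov_eq c hc hi (smoothAt_bundleFrame c hc hi).diffAt X
    refine h.trans ?_
    -- The frame has constant coordinate one, so only the connection form survives.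
    have h1 : mvfderiv (𝓡 n) (sectionCoord c hc i (bundleFrame c hc i)) x = 0 := by
      rw [mvfderiv_congr_eventually (g := fun _ => (1 : ℂ)), mvfderiv_const]
      filter_upwards [RealLineBundleWithConnection.eventually_mem hi] with y hy using
        sectionCoord_frame c hc hy
    rw [covCoord_apply, h1, sectionCoord_frame c hc hi, zero_apply, zero_add, mul_one]
    rfl

end cocycle

end RealDeligne

/-! ### Recognizing cocycles and coboundaries from their smooth components. -/

namespace RealDeligne

namespace C2Cover

variable {M : Type u} [TopologicalSpace M] {τ : Involution M} (𝒰 : C2Cover τ)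

variable {𝒰} in
theorem mem_inter_four {i j k l : 𝒰.ι} {x : M} : x ∈ 𝒰.inter ![i, j, k, l] ↔
    x ∈ 𝒰.U i ∧ x ∈ 𝒰.U j ∧ x ∈ 𝒰.U k ∧ x ∈ 𝒰.U l := by
  simp [mem_inter, Fin.forall_fin_succ]

theorem coboundary_two_apply (F : C2Sheaf τ) (c : 𝒰.cochain F 2) {i j k l : 𝒰.ι} {x : M}
    (hi : x ∈ 𝒰.U i) (hj : x ∈ 𝒰.U j) (hk : x ∈ 𝒰.U k) (hl : x ∈ 𝒰.U l) :
    (𝒰.coboundary F 2 c).1 ![i, j, k, l] x =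
      c.1 ![j, k, l] x - c.1 ![i, k, l] x + c.1 ![i, j, l] x - c.1 ![i, j, k] x := by
  change cutoff (𝒰.inter ![i, j, k, l]) (fun x => ∑ m : Fin 4, ((-1) ^ (m : ℕ) : ℤ) •
    c.1 (![i, j, k, l] ∘ m.succAbove) x) x = _
  rw [cutoff_of_mem (mem_inter_four.2 ⟨hi, hj, hk, hl⟩)]
  have h0 : ![i, j, k, l] ∘ Fin.succAbove 0 = ![j, k, l] := by
    funext k; fin_cases k <;> rfl
  have h1 : ![i, j, k, l] ∘ Fin.succAbove 1 = ![i, k, l] := by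
    funext k; fin_cases k <;> rfl
  have h2 : ![i, j, k, l] ∘ Fin.succAbove 2 = ![i, j, l] := by
    funext k; fin_cases k <;> rfl
  have h3 : ![i, j, k, l] ∘ Fin.succAbove 3 = ![i, j, k] := by
    funext k; fin_cases k <;> rfl
  rw [Fin.sum_univ_four, h0, h1, h2, h3]
  simp [sub_eq_add_neg, pow_succ]

variable {𝒰} in
-- Sections are encoded as functions vanishing off their open set, so only values on the
-- intersections matter.
theorem cochain_ext {F : C2Sheaf τ} {q : ℕ} {c c' : 𝒰.cochain F q}
    (h : ∀ s x, x ∈ 𝒰.inter s → c.1 s x = c'.1 s x) : c = c' := by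
  ext s x
  by_cases hx : x ∈ 𝒰.inter s
  · exact h s x hx
  · rw [F.eq_zero (c.2.1 s) x hx, F.eq_zero (c'.2.1 s) x hx]

variable {𝒰} in
theorem eta_one (s : Fin 1 → 𝒰.ι) : s = ![s 0] := by funext k; fin_cases k; rfl

variable {𝒰} in
theorem eta_two (s : Fin 2 → 𝒰.ι) : s = ![s 0, s 1] := by funext k; fin_cases k <;> rfl

variable {𝒰} in
theorem eta_three (s : Fin 3 → 𝒰.ι) : s = ![s 0, s 1, s 2] := by funext k; fin_cases k <;> rfl

variable {𝒰} in
theorem eta_four (s : Fin 4 → 𝒰.ι) : s = ![s 0, s 1, s 2, s 3] := by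
  funext k; fin_cases k <;> rfl

theorem coboundary_one_coboundary_zero (F : C2Sheaf τ) (b : 𝒰.cochain F 0) :
    𝒰.coboundary F 1 (𝒰.coboundary F 0 b) = 0 := by
  refine cochain_ext fun s x hx => ?_
  rw [eta_three s] at hx ⊢
  obtain ⟨hi, hj, hk⟩ := mem_inter_three.1 hx
  rw [coboundary_one_apply _ _ _ hi hj hk, coboundary_zero_apply _ _ _ hi hj,
    coboundary_zero_apply _ _ _ hi hk, coboundary_zero_apply _ _ _ hj hk]
  change _ = (0 : F.B x)
  abel

theorem coboundary_two_coboundary_one (F : C2Sheaf τ) (b : 𝒰.cochain F 1) :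
    𝒰.coboundary F 2 (𝒰.coboundary F 1 b) = 0 := by
  refine cochain_ext fun s x hx => ?_
  rw [eta_four s] at hx ⊢
  obtain ⟨hi, hj, hk, hl⟩ := mem_inter_four.1 hx
  rw [coboundary_two_apply _ _ _ hi hj hk hl, coboundary_one_apply _ _ _ hi hj hk,
    coboundary_one_apply _ _ _ hi hj hl, coboundary_one_apply _ _ _ hi hk hl,
    coboundary_one_apply _ _ _ hj hk hl]
  change _ = (0 : F.B x)
  abel

end C2Cover

variable {n : ℕ} {M : Type u} [TopologicalSpace M] [ChartedSpace (EuclideanSpace ℝ (Fin n)) M]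
  {τ : SmoothInvolution n M} {𝒰 : C2Cover τ.toInvolution}

/-- Distinct points of `iℤ` are at distance at least one, so a continuous function with values in
`iℤ` is locally constant. -/
theorem eventually_eq_of_int {f : M → ℂ} {x : M} (hf : ContinuousAt f x)
    (h : ∀ᶠ y in 𝓝 x, ∃ k : ℤ, f y = k * Complex.I) :
    ∃ k : ℤ, ∀ᶠ y in 𝓝 x, f y = k * Complex.I := by
  obtain ⟨k, hk⟩ := h.self_of_nhds
  refine ⟨k, ?_⟩
  filter_upwards [h, hf.eventually (Metric.ball_mem_nhds (f x) one_pos)] with y ⟨l, hl⟩ hy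
  rw [hl, hk, dist_eq_norm, ← sub_mul, norm_mul, Complex.norm_I, mul_one,
    ← Int.cast_sub, Complex.norm_intCast] at hy
  have h2 : |l - k| < 1 := by exact_mod_cast hy
  rw [hl, sub_eq_zero.1 (Int.abs_lt_one_iff.1 h2)]

theorem exists_integral_cochain {q : ℕ} (c : 𝒰.cochain (sheafA0 τ) q)
    (h : ∀ s, ∀ x ∈ 𝒰.inter s, ∃ k : ℤ, (c.1 s x : ℂ) = k * Complex.I) :
    ∃ z : 𝒰.cochain (sheafIZ τ) q, z.1 = c.1 :=
  ⟨⟨c.1, fun s => ⟨(c.2.1 s).1, fun x hx => eventually_eq_of_int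
    ((c.2.1 s).2.2 x hx).continuousAt
    (Filter.mem_of_superset ((𝒰.inter s).isOpen.mem_nhds hx) fun y hy => h s y hy)⟩, c.2.2⟩, rfl⟩

section

variable [IsManifold (𝓡 n) ∞ M]

/-- Geometry supplies only `f` and `α`. The integral component is forced by the middle cocycle
equation to be `-∂f`, which is a section of `iℤ` by `hf`. -/
theorem exists_mem_ker (f : 𝒰.cochain (sheafA0 τ) 1) (α : 𝒰.cochain (sheafA1 τ) 0)
    (hf : ∀ i j k x, x ∈ 𝒰.U i → x ∈ 𝒰.U j → x ∈ 𝒰.U k →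
      ∃ m : ℤ, (f.1 ![j, k] x - f.1 ![i, k] x + f.1 ![i, j] x : ℂ) = m * Complex.I)
    (hα : ∀ i j x, x ∈ 𝒰.U i → x ∈ 𝒰.U j →
      (α.1 ![j] x - α.1 ![i] x : TangentSpace (𝓡 n) x →L[ℝ] ℂ) = mvfderiv (𝓡 n) (f.1 ![i, j]) x) :
    ∃ c ∈ (𝒰.D2 (deligneComplex2 τ)).ker, c.2 = (f, α) := by
  obtain ⟨z, hz⟩ := exists_integral_cochain (-𝒰.coboundary (sheafA0 τ) 1 f) (by
    intro s x hx
    rw [C2Cover.eta_three s] at hx ⊢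
    obtain ⟨hi, hj, hk⟩ := C2Cover.mem_inter_three.1 hx
    obtain ⟨m, hm⟩ := hf _ _ _ x hi hj hk
    refine ⟨-m, ?_⟩
    rw [Int.cast_neg, neg_mul, ← hm]
    exact congrArg Neg.neg (𝒰.coboundary_one_apply (sheafA0 τ) f hi hj hk))
  refine ⟨(z, f, α), ?_, rfl⟩
  refine Prod.ext ?_ (Prod.ext ?_ ?_)
  -- The coboundaries in `iℤ` and in `iA⁰` are given by the same formula, so closedness of `z` is
  -- `∂∂ = 0` in `iA⁰`.
  · have h1 : (𝒰.coboundary (sheafIZ τ) 2 z).1 =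
        (𝒰.coboundary (sheafA0 τ) 2 (-𝒰.coboundary (sheafA0 τ) 1 f)).1 := by
      funext s
      change cutoff _ _ = cutoff _ _
      rw [hz]
    rw [map_neg, C2Cover.coboundary_two_coboundary_one, neg_zero] at h1
    exact Subtype.ext h1
  · refine Subtype.ext ?_
    change (𝒰.coboundary (sheafA0 τ) 1 f).1 + z.1 = 0
    rw [hz]
    exact add_neg_cancel (𝒰.coboundary (sheafA0 τ) 1 f).1
  · refine sub_eq_zero.2 (C2Cover.cochain_ext fun s x hx => ?_)
    rw [C2Cover.eta_two s] at hx ⊢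
    obtain ⟨hi, hj⟩ := C2Cover.mem_inter_two.1 hx
    refine (𝒰.coboundary_zero_apply (sheafA1 τ) α hi hj).trans ?_
    exact (hα _ _ x hi hj).trans (diffOn_of_mem hx).symm

/-- The component in `Č¹(iA⁰)` of a degree two cochain of the Real Deligne complex. -/
def logCochain (c : 𝒰.T2 (deligneComplex2 τ)) : 𝒰.cochain (sheafA0 τ) 1 := c.2.1

/-- The integral part is forced to be `m = ∂b - (f' - f)`. The equation in `Č²(iℤ)` is then
automatic, because a cocycle has first component `-∂f`. -/
theorem exists_sub_eq_D1 {c c' : 𝒰.T2 (deligneComplex2 τ)} (hc : c ∈ (𝒰.D2 _).ker)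
    (hc' : c' ∈ (𝒰.D2 _).ker) (b : 𝒰.cochain (sheafA0 τ) 0)
    (hf : ∀ i j x, x ∈ 𝒰.U i → x ∈ 𝒰.U j → ∃ m : ℤ,
      (b.1 ![j] x - b.1 ![i] x : ℂ) - (logTrans c' i j x - logTrans c i j x) = m * Complex.I)
    (hα : ∀ i x, x ∈ 𝒰.U i → potential c' i x - potential c i x = mvfderiv (𝓡 n) (b.1 ![i]) x) :
    ∃ m, c' - c = 𝒰.D1 _ (m, b) := by
  have hz : ∀ {c : 𝒰.T2 (deligneComplex2 τ)}, c ∈ (𝒰.D2 _).ker →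
      c.1.1 = (-𝒰.coboundary (sheafA0 τ) 1 (logCochain c)).1 := by
    intro c hc
    have h1 : 𝒰.coboundary (deligneComplex2 τ).F1 1 c.2.1 +
      𝒰.mapCochain (deligneComplex2 τ).d0 2 c.1 = 0 := congrArg (fun z => z.2.1) hc
    exact congrArg Subtype.val (eq_neg_of_add_eq_zero_right h1)
  obtain ⟨m, hm⟩ := exists_integral_cochain
    (𝒰.coboundary (sheafA0 τ) 0 b - (logCochain c' - logCochain c)) (by
      intro s x hx
      rw [C2Cover.eta_two s] at hx ⊢
      obtain ⟨hi, hj⟩ := C2Cover.mem_inter_two.1 hx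
      obtain ⟨k, hk⟩ := hf _ _ x hi hj
      refine ⟨k, ?_⟩
      rw [← hk]
      exact congrArg (fun t : ℂ => t - (logTrans c' (s 0) (s 1) x - logTrans c (s 0) (s 1) x))
        (𝒰.coboundary_zero_apply (sheafA0 τ) b hi hj))
  refine ⟨m, Prod.ext ?_ (Prod.ext ?_ ?_)⟩
  · have h1 : (𝒰.coboundary (sheafIZ τ) 1 m).1 = (𝒰.coboundary (sheafA0 τ) 1
        (𝒰.coboundary (sheafA0 τ) 0 b - (logCochain c' - logCochain c))).1 := by
      funext s
      change cutoff _ _ = cutoff _ _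
      rw [hm]
    rw [map_sub, C2Cover.coboundary_one_coboundary_zero, zero_sub, map_sub, neg_sub] at h1
    refine Subtype.ext (Eq.trans ?_ h1.symm)
    change c'.1.1 - c.1.1 = (𝒰.coboundary (sheafA0 τ) 1 (logCochain c)).1 -
      (𝒰.coboundary (sheafA0 τ) 1 (logCochain c')).1
    rw [hz hc, hz hc']
    change -(𝒰.coboundary (sheafA0 τ) 1 (logCochain c')).1 - -(𝒰.coboundary (sheafA0 τ) 1 (logCochain c)).1 = _
    abel
  · refine Subtype.ext ?_
    change (logCochain c').1 - (logCochain c).1 = (𝒰.coboundary (sheafA0 τ) 0 b).1 - m.1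
    rw [hm]
    change _ = (𝒰.coboundary (sheafA0 τ) 0 b).1 - ((𝒰.coboundary (sheafA0 τ) 0 b).1 -
      ((logCochain c').1 - (logCochain c).1))
    abel
  · refine C2Cover.cochain_ext fun s x hx => ?_
    rw [C2Cover.eta_one s] at hx ⊢
    exact (hα _ x (C2Cover.mem_inter_one.1 hx)).trans (diffOn_of_mem hx).symm

end

end RealDeligne

/-! ### Equivariant covers, shrinkings and logarithms. -/

namespace RealDeligne

namespace C2Cover

section

variable {M : Type u} [TopologicalSpace M] {τ : Involution M}

/-- The `C_2`-cover consisting of a family of neighbourhoods of all points and its translates. -/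
def double (τ : Involution M) (W : M → Opens M) (hW : ∀ x, x ∈ W x) : C2Cover τ where
  ι := M × Bool
  U a := bif a.2 then τ.translate (W a.1) else W a.1
  covers x := ⟨(x, false), hW x⟩
  inv a := (a.1, !a.2)
  inv_inv a := by simp
  -- The Boolean label makes the involution free on indices even over fixed points of `τ`.
  inv_free a h := by simpa using congrArg Prod.snd h
  U_inv a := by
    obtain ⟨x, _ | _⟩ := a
    · rfl
    · refine Opens.ext (Set.ext fun y => ?_)
      change y ∈ W x ↔ τ (τ y) ∈ W x
      rw [τ.involutive y]

/-- A family of neighbourhoods subordinate to a `C_2`-cover gives a refinement. -/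
def doubleRefinement (𝒰 : C2Cover τ) {W : M → Opens M} (hW : ∀ x, x ∈ W x) (i : M → 𝒰.ι)
    (hi : ∀ x, W x ≤ 𝒰.U (i x)) : Refinement (double τ W hW) 𝒰 where
  r a := bif a.2 then 𝒰.inv (i a.1) else i a.1
  r_inv a := by
    obtain ⟨x, _ | _⟩ := a
    · rfl
    · exact (𝒰.inv_inv _).symm
  le a := by
    obtain ⟨x, _ | _⟩ := a
    · exact hi x
    · intro y hy
      change y ∈ 𝒰.U (𝒰.inv (i x))
      rw [𝒰.U_inv]
      exact hi x hy

/-- The common refinement of two `C_2`-covers. -/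
def prod (𝒰 𝒱 : C2Cover τ) : C2Cover τ where
  ι := 𝒰.ι × 𝒱.ι
  U a := 𝒰.U a.1 ⊓ 𝒱.U a.2
  covers x :=
    let ⟨i, hi⟩ := 𝒰.covers x
    let ⟨j, hj⟩ := 𝒱.covers x
    ⟨(i, j), hi, hj⟩
  inv a := (𝒰.inv a.1, 𝒱.inv a.2)
  inv_inv a := by simp [inv_inv]
  inv_free a h := 𝒰.inv_free a.1 (congrArg Prod.fst h)
  U_inv a := by rw [𝒰.U_inv, 𝒱.U_inv]; rfl

def prodFst (𝒰 𝒱 : C2Cover τ) : Refinement (𝒰.prod 𝒱) 𝒰 where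
  r := Prod.fst
  r_inv _ := rfl
  le _ := inf_le_left

def prodSnd (𝒰 𝒱 : C2Cover τ) : Refinement (𝒰.prod 𝒱) 𝒱 where
  r := Prod.snd
  r_inv _ := rfl
  le _ := inf_le_right

/-- The equivariant cochain obtained from functions that are sections and equivariant on the
intersections of the cover. -/
def mkCochain {𝒰 : C2Cover τ} (F : C2Sheaf τ) {q : ℕ} (c : (Fin (q + 1) → 𝒰.ι) → ∀ x, F.B x)
    (h : ∀ s, cutoff (𝒰.inter s) (c s) ∈ F.sec (𝒰.inter s))
    (h' : ∀ s x, x ∈ 𝒰.inter s → F.act x (c (𝒰.inv ∘ s) (τ x)) = c s x) : 𝒰.cochain F q :=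
  ⟨fun s => cutoff (𝒰.inter s) (c s), h, fun s x => by
    by_cases hx : x ∈ 𝒰.inter s
    · dsimp only
      rw [cutoff_of_mem hx, cutoff_of_mem (mem_inter_inv.2 hx), h' s x hx]
    · dsimp only
      rw [cutoff_of_notMem hx, cutoff_of_notMem fun h => hx (mem_inter_inv.1 h), map_zero]⟩

theorem mkCochain_apply {𝒰 : C2Cover τ} {F : C2Sheaf τ} {q : ℕ}
    {c : (Fin (q + 1) → 𝒰.ι) → ∀ x, F.B x}
    {h : ∀ s, cutoff (𝒰.inter s) (c s) ∈ F.sec (𝒰.inter s)}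
    {h' : ∀ s x, x ∈ 𝒰.inter s → F.act x (c (𝒰.inv ∘ s) (τ x)) = c s x}
    {s : Fin (q + 1) → 𝒰.ι} {x : M} (hx : x ∈ 𝒰.inter s) :
    (mkCochain F c h h').1 s x = c s x :=
  cutoff_of_mem hx

/-- Every open cover of a paracompact Hausdorff space has a closed, locally finite and equivariant
shrinking that contains an open cover. -/
theorem exists_shrinking [T2Space M] [ParacompactSpace M] (𝒰 : C2Cover τ) :
    ∃ (S : 𝒰.ι → Opens M) (C : 𝒰.ι → Set M), (∀ x, ∃ i, x ∈ S i) ∧ (∀ i, (S i : Set M) ⊆ C i) ∧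
      (∀ i, IsClosed (C i)) ∧ (∀ i, C i ⊆ 𝒰.U i) ∧ LocallyFinite C ∧
      ∀ i x, τ x ∈ C (𝒰.inv i) ↔ x ∈ C i := by
  obtain ⟨V, hVo, hVc, hVf, hVU⟩ := precise_refinement (fun i => (𝒰.U i : Set M))
    (fun i => (𝒰.U i).isOpen)
    (Set.iUnion_eq_univ_iff.2 fun x => 𝒰.covers x)
  obtain ⟨S, hSc, hSo, hSV⟩ := exists_iUnion_eq_closure_subset hVo hVf.point_finite hVc
  have hinj : Function.Injective 𝒰.inv := fun i j h => by
    rw [← 𝒰.inv_inv i, h, 𝒰.inv_inv]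
  have h1 : LocallyFinite fun i => closure (S i) := hVf.subset hSV
  have h2 : LocallyFinite fun i => τ ⁻¹' closure (S (𝒰.inv i)) :=
    (h1.comp_injective hinj).preimage_continuous τ.continuous_toFun
  -- Adjoining the translate of the closure attached to `τ(i)` makes the closed family equivariant.
  -- It remains locally finite, since reindexing by a bijection and pulling back along `τ` preserve
  -- that.
  refine ⟨fun i => ⟨S i, hSo i⟩, fun i => closure (S i) ∪ τ ⁻¹' closure (S (𝒰.inv i)),
    fun x => Set.iUnion_eq_univ_iff.1 hSc x, fun i => subset_closure.trans Set.subset_union_left,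
    fun i => isClosed_closure.union (isClosed_closure.preimage τ.continuous_toFun), ?_, ?_, ?_⟩
  · rintro i x (hx | hx)
    · exact hVU i (hSV i hx)
    · have h3 : τ x ∈ 𝒰.U (𝒰.inv i) := hVU _ (hSV _ hx)
      rwa [𝒰.U_inv, τ.mem_translate, τ.involutive x] at h3
  · intro x
    obtain ⟨t, ht, h3⟩ := h1 x
    obtain ⟨t', ht', h4⟩ := h2 x
    refine ⟨t ∩ t', Filter.inter_mem ht ht', (h3.union h4).subset ?_⟩
    rintro i ⟨y, hy | hy, hyt, hyt'⟩
    · exact Or.inl ⟨y, hy, hyt⟩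
    · exact Or.inr ⟨y, hy, hyt'⟩
  · intro i x
    simp only [Set.mem_union, Set.mem_preimage, 𝒰.inv_inv, τ.involutive x]
    exact or_comm

end

end C2Cover

variable {n : ℕ} {M : Type u} [TopologicalSpace M] [ChartedSpace (EuclideanSpace ℝ (Fin n)) M]
  {τ : SmoothInvolution n M}

theorem cutoff_mem_sheafA0 {U : Opens M} {f : M → ℂ} (h : ∀ x ∈ U, (f x).re = 0)
    (h' : ∀ x ∈ U, ContMDiffAt (𝓡 n) 𝓘(ℝ, ℂ) ∞ f x) :
    cutoff (B := fun _ => ℂ) U f ∈ (sheafA0 τ).sec U := by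
  refine ⟨fun x hx => cutoff_of_notMem hx, fun x => ?_, fun x hx =>
    (h' x hx).congr_of_eventuallyEq (eventually_cutoff (B := fun _ => ℂ) f hx)⟩
  by_cases hx : x ∈ U
  · exact (congrArg Complex.re (cutoff_of_mem (B := fun _ => ℂ) hx)).trans (h x hx)
  · exact congrArg Complex.re (cutoff_of_notMem (B := fun _ => ℂ) hx)

theorem cutoff_mem_sheafA1 [IsManifold (𝓡 n) ∞ M] {U : Opens M}
    {α : ∀ x : M, TangentSpace (𝓡 n) x →L[ℝ] ℂ} (h : ∀ x ∈ U, ∀ X, (α x X).re = 0)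
    (h' : ∀ x ∈ U, SmoothFormAt α x) : cutoff U α ∈ (sheafA1 τ).sec U := by
  refine ⟨fun x hx => cutoff_of_notMem hx, fun x X => ?_, fun x hx =>
    (h' x hx).congr (eventually_cutoff α hx)⟩
  by_cases hx : x ∈ U
  · rw [cutoff_of_mem hx, h x hx]
  · rw [cutoff_of_notMem hx]; rfl

/-- Near `x` the function `u / u(x)` is close to one, so the principal logarithm is smooth there;
adding `arg u(x)` undoes the division. -/
theorem exists_local_log {U : Opens M} {u : M → ℂ} {x : M} (hx : x ∈ U)
    (hu : ∀ y ∈ U, ContMDiffAt (𝓡 n) 𝓘(ℝ, ℂ) ∞ u y) (h1 : ∀ y ∈ U, conj (u y) * u y = 1) :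
    ∃ W : Opens M, x ∈ W ∧ W ≤ U ∧ ∃ b : M → ℂ, ∀ y ∈ W, (b y).re = 0 ∧
      ContMDiffAt (𝓡 n) 𝓘(ℝ, ℂ) ∞ b y ∧ expTwoPi (b y) = u y := by
  have hn : ∀ y ∈ U, ‖u y‖ = 1 := fun y hy => by
    have h := h1 y hy
    rw [← Complex.normSq_eq_conj_mul_self, ← Complex.ofReal_one, Complex.ofReal_inj,
      Complex.normSq_eq_norm_sq] at h
    exact (pow_eq_one_iff_of_nonneg (norm_nonneg _) two_ne_zero).1 h
  have hlim : ContinuousAt (fun y => u y * conj (u x)) x :=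
    (hu x hx).continuousAt.mul continuousAt_const
  have hslit : ∀ᶠ y in 𝓝 x, u y * conj (u x) ∈ Complex.slitPlane := by
    refine hlim.eventually (Complex.isOpen_slitPlane.mem_nhds ?_)
    change u x * conj (u x) ∈ _
    rw [mul_comm, h1 x hx]
    exact Complex.one_mem_slitPlane
  obtain ⟨W, hW, hWo, hxW⟩ := eventually_nhds_iff.1 (hslit.and (U.isOpen.mem_nhds hx))
  -- The division by `u(x)` is multiplication by its conjugate, as `|u| = 1`. Taking only the
  -- imaginary part makes the value exactly imaginary, and `(2π)⁻¹` matches the normalization of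
  -- `expTwoPi`.
  refine ⟨⟨W, hWo⟩, hxW, fun y hy => (hW y hy).2, fun y => ((Complex.log (u y * conj (u x))).im +
    Complex.arg (u x) : ℝ) * (Complex.I * (2 * Real.pi : ℂ)⁻¹), fun y hy => ⟨?_, ?_, ?_⟩⟩
  · rw [Complex.re_ofReal_mul]
    have : (Complex.I * (2 * Real.pi : ℂ)⁻¹) = ((2 * Real.pi)⁻¹ : ℝ) * Complex.I := by
      push_cast; ring
    rw [this, Complex.re_ofReal_mul]
    simp
  · have h2 : ContMDiffAt (𝓡 n) 𝓘(ℝ, ℂ) ∞ (fun y => Complex.log (u y * conj (u x))) y :=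
      ContMDiffAt.comp y (g := Complex.log)
        ((Complex.contDiffAt_log (hW y hy).1).restrict_scalars ℝ).contMDiffAt
        (contMDiffAt_complex_mul (hu y (hW y hy).2) contMDiffAt_const)
    refine contMDiffAt_complex_mul ?_ contMDiffAt_const
    exact ContMDiffAt.comp y (g := fun z : ℂ => ((z.im + Complex.arg (u x) : ℝ) : ℂ))
      ((Complex.ofRealCLM.contDiff.comp
        (Complex.imCLM.contDiff.add contDiff_const)).contMDiff.contMDiffAt) h2
  · have h3 : (2 * Real.pi : ℂ) ≠ 0 := by simp [Real.pi_ne_zero]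
    have h4 : ‖u y * conj (u x)‖ = 1 := by
      rw [norm_mul, RCLike.norm_conj, hn y (hW y hy).2, hn x hx, mul_one]
    have h5 := Complex.norm_mul_exp_arg_mul_I (u y * conj (u x))
    have h6 := Complex.norm_mul_exp_arg_mul_I (u x)
    rw [h4, Complex.ofReal_one, one_mul] at h5
    rw [hn x hx, Complex.ofReal_one, one_mul] at h6
    have h7 : (2 * Real.pi : ℂ) * (((Complex.log (u y * conj (u x))).im +
        Complex.arg (u x) : ℝ) * (Complex.I * (2 * Real.pi : ℂ)⁻¹)) =
        Complex.arg (u y * conj (u x)) * Complex.I + Complex.arg (u x) * Complex.I := by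
      rw [Complex.log_im]
      push_cast
      field_simp
    rw [expTwoPi, h7, Complex.exp_add, h5, h6, mul_assoc, h1 x hx, mul_one]

/-- Logarithms are chosen freely on neighbourhoods of all points and conjugated to the translates.
Distinct indices impose no compatibility on a degree zero cochain, so nothing needs checking at
fixed points. -/
theorem exists_log_zero_cochain (𝒰 : C2Cover τ.toInvolution) (u : 𝒰.ι → M → ℂ)
    (hu : ∀ i, ∀ x ∈ 𝒰.U i, ContMDiffAt (𝓡 n) 𝓘(ℝ, ℂ) ∞ (u i) x)
    (h1 : ∀ i, ∀ x ∈ 𝒰.U i, conj (u i x) * u i x = 1)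
    (hr : ∀ i, ∀ x ∈ 𝒰.U i, u (𝒰.inv i) (τ x) = conj (u i x)) :
    ∃ (𝒱 : C2Cover τ.toInvolution) (ρ : C2Cover.Refinement 𝒱 𝒰) (b : 𝒱.cochain (sheafA0 τ) 0),
      ∀ j, ∀ x ∈ 𝒱.U j, expTwoPi (b.1 ![j] x) = u (ρ.r j) x := by
  choose W hxW hW b hb using fun x => exists_local_log (𝒰.mem_idx x) (hu (𝒰.idx x)) (h1 (𝒰.idx x))
  let 𝒱 := C2Cover.double τ.toInvolution W hxW
  let β : M × Bool → M → ℂ := fun a y => bif a.2 then conj (b a.1 (τ y)) else b a.1 y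
  have hβ : ∀ a, ∀ y ∈ 𝒱.U a, (β a y).re = 0 ∧ ContMDiffAt (𝓡 n) 𝓘(ℝ, ℂ) ∞ (β a) y ∧
      expTwoPi (β a y) = u ((𝒰.doubleRefinement hxW 𝒰.idx hW).r a) y := by
    rintro ⟨x, _ | _⟩ y hy
    · exact hb x y hy
    · obtain ⟨h2, h3, h4⟩ := hb x (τ y) hy
      refine ⟨h2, contMDiffAt_complex_conj (h3.comp y (τ.contMDiff_toFun y)), ?_⟩
      change expTwoPi (conj (b x (τ y))) = u (𝒰.inv (𝒰.idx x)) y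
      rw [expTwoPi_conj, h4, ← hr _ _ (hW x hy), τ.involutive y]
  refine ⟨𝒱, 𝒰.doubleRefinement hxW 𝒰.idx hW, C2Cover.mkCochain (sheafA0 τ) (fun s => β (s 0))
    (fun s => cutoff_mem_sheafA0 (fun x hx => (hβ _ x (C2Cover.mem_inter.1 hx 0)).1)
      (fun x hx => (hβ _ x (C2Cover.mem_inter.1 hx 0)).2.1)) ?_, fun j x hx => ?_⟩
  · intro s x hx
    change conj (β (𝒱.inv (s 0)) (τ x)) = β (s 0) x
    obtain ⟨y, _ | _⟩ := s 0
    · change conj (conj (b y (τ (τ x)))) = b y x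
      rw [Complex.conj_conj, τ.involutive x]
    · rfl
  · rw [← (hβ j x hx).2.2]
    exact congrArg expTwoPi (C2Cover.mkCochain_apply (F := sheafA0 τ) (C2Cover.mem_inter_one.2 hx))

/-- An overlap need not carry a logarithm of a transition function, so each new set `W x` is chosen
so small that the functions `g (i x) j` have logarithms on the whole of `W x`, for all `j` that can
occur. Local finiteness leaves only finitely many such `j`: those with `x ∈ C j`. -/
theorem exists_log_one_cochain [T2Space M] [ParacompactSpace M] (𝒰 : C2Cover τ.toInvolution)
    (g : 𝒰.ι → 𝒰.ι → M → ℂ)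
    (hg : ∀ i j x, x ∈ 𝒰.U i → x ∈ 𝒰.U j → ContMDiffAt (𝓡 n) 𝓘(ℝ, ℂ) ∞ (g i j) x)
    (h1 : ∀ i j x, x ∈ 𝒰.U i → x ∈ 𝒰.U j → conj (g i j x) * g i j x = 1)
    (hr : ∀ i j x, x ∈ 𝒰.U i → x ∈ 𝒰.U j → g (𝒰.inv i) (𝒰.inv j) (τ x) = conj (g i j x)) :
    ∃ (𝒱 : C2Cover τ.toInvolution) (ρ : C2Cover.Refinement 𝒱 𝒰) (f : 𝒱.cochain (sheafA0 τ) 1),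
      ∀ i j x, x ∈ 𝒱.U i → x ∈ 𝒱.U j → expTwoPi (f.1 ![i, j] x) = g (ρ.r i) (ρ.r j) x := by
  obtain ⟨S, C, hS, hSC, hCc, hCU, hCf, hCr⟩ := 𝒰.exists_shrinking
  choose i hi using hS
  have hlog : ∀ x j, ∃ N : Opens M, x ∈ N ∧ ∃ b : M → ℂ, x ∈ C j → ∀ y ∈ N, (b y).re = 0 ∧
      ContMDiffAt (𝓡 n) 𝓘(ℝ, ℂ) ∞ b y ∧ expTwoPi (b y) = g (i x) j y := by
    intro x j
    by_cases hx : x ∈ C j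
    · obtain ⟨N, hxN, -, b, hb⟩ := exists_local_log (U := 𝒰.U (i x) ⊓ 𝒰.U j) (u := g (i x) j)
        ⟨hCU _ (hSC _ (hi x)), hCU _ hx⟩ (fun y hy => hg _ _ y hy.1 hy.2)
        (fun y hy => h1 _ _ y hy.1 hy.2)
      exact ⟨N, hxN, b, fun _ => hb⟩
    -- A dummy value: indices `j` with `x ∉ C j` are excluded below.
    · exact ⟨⊤, trivial, 0, fun h => (hx h).elim⟩
  choose N hxN b hb using hlog
  have hW : ∀ x, ∃ W : Opens M, x ∈ W ∧ W ≤ S (i x) ∧ ∀ j, ∀ y ∈ W, y ∈ C j →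
      x ∈ C j ∧ W ≤ N x j := by
    intro x
    have hfin : {j | x ∈ C j}.Finite := hCf.point_finite x
    have h2 : ⋂ j ∈ {j | x ∈ C j}, (N x j : Set M) ∈ 𝓝 x :=
      (Filter.biInter_mem hfin).2 fun j _ => (N x j).isOpen.mem_nhds (hxN x j)
    -- `W` lies in the finitely many relevant `N x j` and avoids every `C j` not containing `x`, so
    -- that any `C j` meeting `W` contains `x`.
    obtain ⟨W, hWs, hWo, hxW⟩ := mem_nhds_iff.1 (Filter.inter_mem
      (Filter.inter_mem ((S (i x)).isOpen.mem_nhds (hi x)) h2) (hCf.iInter_compl_mem_nhds hCc x))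
    refine ⟨⟨W, hWo⟩, hxW, fun y hy => (hWs hy).1.1, fun j y hy hyj => ?_⟩
    have hxj : x ∈ C j := by
      by_contra h
      exact Set.mem_iInter₂.1 (hWs hy).2 j h hyj
    exact ⟨hxj, fun z hz => Set.mem_iInter₂.1 (hWs hz).1.2 j hxj⟩
  choose W hxW hWS hWC using hW
  let 𝒱 := C2Cover.double τ.toInvolution W hxW
  let ρ : C2Cover.Refinement 𝒱 𝒰 := 𝒰.doubleRefinement hxW i
    fun x => (hWS x).trans fun y hy => hCU _ (hSC _ hy)
  have hρC : ∀ a, ∀ y ∈ 𝒱.U a, y ∈ C (ρ.r a) := by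
    rintro ⟨x, _ | _⟩ y hy
    · exact hSC _ (hWS x hy)
    · refine (hCr _ _).1 ?_
      change τ y ∈ C (𝒰.inv (𝒰.inv (i x)))
      rw [𝒰.inv_inv]
      exact hSC _ (hWS x hy)
  -- The logarithm depends on the second index only through its image in `𝒰`; the neighbourhood of
  -- the first index is where it was chosen. No antisymmetry is needed, as Čech cochains are not
  -- required to be alternating.
  let β : M × Bool → M × Bool → M → ℂ := fun a a' y =>
    bif a.2 then conj (b a.1 (𝒰.inv (ρ.r a')) (τ y)) else b a.1 (ρ.r a') y
  have hβ : ∀ a a' y, y ∈ 𝒱.U a → y ∈ 𝒱.U a' → (β a a' y).re = 0 ∧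
      ContMDiffAt (𝓡 n) 𝓘(ℝ, ℂ) ∞ (β a a') y ∧ expTwoPi (β a a' y) = g (ρ.r a) (ρ.r a') y := by
    rintro ⟨x, _ | _⟩ a' y hy hy'
    · obtain ⟨h2, h3⟩ := hWC x _ y hy (hρC a' y hy')
      exact hb x _ h2 y (h3 hy)
    · have h4 : τ y ∈ C (𝒰.inv (ρ.r a')) := (hCr _ _).2 (hρC a' y hy')
      obtain ⟨h2, h3⟩ := hWC x _ (τ y) hy h4
      obtain ⟨h5, h6, h7⟩ := hb x _ h2 (τ y) (h3 hy)
      refine ⟨h5, contMDiffAt_complex_conj (h6.comp y (τ.contMDiff_toFun y)), ?_⟩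
      change expTwoPi (conj (b x (𝒰.inv (ρ.r a')) (τ y))) = g (𝒰.inv (i x)) (ρ.r a') y
      rw [expTwoPi_conj, h7, ← hr _ _ _ (hCU _ (hSC _ (hWS x hy))) (hCU _ h4), τ.involutive y,
        𝒰.inv_inv]
  refine ⟨𝒱, ρ, C2Cover.mkCochain (sheafA0 τ) (fun s => β (s 0) (s 1))
    (fun s => cutoff_mem_sheafA0
      (fun x hx => (hβ _ _ x (C2Cover.mem_inter.1 hx 0) (C2Cover.mem_inter.1 hx 1)).1)
      (fun x hx => (hβ _ _ x (C2Cover.mem_inter.1 hx 0) (C2Cover.mem_inter.1 hx 1)).2.1)) ?_,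
    fun j k x hj hk => ?_⟩
  · intro s x hx
    change conj (β (𝒱.inv (s 0)) (𝒱.inv (s 1)) (τ x)) = β (s 0) (s 1) x
    obtain ⟨y, _ | _⟩ := s 0
    · change conj (conj (b y (𝒰.inv (ρ.r (𝒱.inv (s 1)))) (τ (τ x)))) = b y (ρ.r (s 1)) x
      rw [Complex.conj_conj, τ.involutive x, ρ.r_inv, 𝒰.inv_inv]
    · change conj (b y (ρ.r (𝒱.inv (s 1))) (τ x)) = conj (b y (𝒰.inv (ρ.r (s 1))) (τ x))
      rw [ρ.r_inv]
  · rw [← (hβ j k x hj hk).2.2]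
    exact congrArg expTwoPi (C2Cover.mkCochain_apply (F := sheafA0 τ) (C2Cover.mem_inter_two.2 ⟨hj, hk⟩))

end RealDeligne

/-! ### From bundles with connection to cocycles. -/

namespace RealDeligne

variable {n : ℕ} {M : Type u} [TopologicalSpace M] [ChartedSpace (EuclideanSpace ℝ (Fin n)) M]
  {τ : SmoothInvolution n M}

theorem mdifferentiableAt_expTwoPi {φ : M → ℂ} {x : M}
    (hφ : MDifferentiableAt (𝓡 n) 𝓘(ℝ, ℂ) φ x) :
    MDifferentiableAt (𝓡 n) 𝓘(ℝ, ℂ) (fun y => expTwoPi (φ y)) x := by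
  have h : Differentiable ℂ expTwoPi := ((differentiable_const _).mul differentiable_id).cexp
  exact ((h (φ x)).restrictScalars ℝ).mdifferentiableAt.comp x hφ

namespace RealLineBundle

variable {L : RealLineBundle τ}

theorem σ_conjSection (s : ∀ x, L.fiber x) (x : M) : L.σ x (L.conjSection s x) = s (τ x) := by
  have h1 : ∀ z (hz : τ (τ x) = z) (h' : L.fiber (τ (τ x)) = L.fiber z),
      TotalSpace.mk' ℂ z (cast h' (L.σ (τ x) (s (τ x)))) = ⟨τ (τ x), L.σ (τ x) (s (τ x))⟩ := by
    rintro z rfl h'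
    rfl
  have h2 := (congrArg (fun e : TotalSpace ℂ L.fiber =>
    (⟨τ e.1, L.σ e.1 e.2⟩ : TotalSpace ℂ L.fiber)) (h1 x (τ.involutive x)
      (congrArg L.fiber (τ.involutive x)))).trans (L.σ_involutive ⟨τ x, s (τ x)⟩)
  exact TotalSpace.mk_inj.1 h2

theorem exists_local_section (L : RealLineBundle τ) (x : M) :
    ∃ s : ∀ x, L.fiber x, ∀ y ∈ L.chartSet x, L.SmoothAt s y ∧ s y ≠ 0 := by
  have h : ∀ y ∈ L.chartSet x, L.coord x ((trivializationAt ℂ L.fiber x).symm y 1) = 1 :=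
    fun y hy => congrArg Prod.snd ((trivializationAt ℂ L.fiber x).apply_mk_symm hy 1)
  refine ⟨fun y => (trivializationAt ℂ L.fiber x).symm y 1, fun y hy => ⟨?_, fun h0 => ?_⟩⟩
  · refine ((trivializationAt ℂ L.fiber x).contMDiffAt_section_iff (IB := 𝓡 n) (n := ∞) hy).2 ?_
    refine (contMDiffAt_const (c := (1 : ℂ))).congr_of_eventuallyEq ?_
    filter_upwards [(L.chartSet x).isOpen.mem_nhds hy] with z hz using h z hz
  · have := h y hy
    rw [show (trivializationAt ℂ L.fiber x).symm y 1 = 0 from h0, coord_zero hy] at this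
    exact zero_ne_one this

theorem HermitianMetric.exists_local_unit_section (h : L.HermitianMetric) (x : M) :
    ∃ s : ∀ x, L.fiber x, ∀ y ∈ L.chartSet x, L.SmoothAt s y ∧ h.form y (s y) (s y) = 1 := by
  obtain ⟨s, hs⟩ := L.exists_local_section x
  -- The inverse length of a vector as a function of its squared norm; it is smooth where the real
  -- part is positive.
  let g : ℂ → ℂ := fun z => (((√z.re)⁻¹ : ℝ) : ℂ)
  refine ⟨fun y => g (h.form y (s y) (s y)) • s y, fun y hy => ?_⟩
  obtain ⟨h1, h2⟩ := hs y hy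
  have h3 := h.pos y (s y) h2
  constructor
  · refine .csmul ?_ h1
    refine ContMDiffAt.comp y (g := g) ?_ (h.smooth s s y h1 h1)
    refine ContDiffAt.contMDiffAt ?_
    refine Complex.ofRealCLM.contDiff.contDiffAt.comp _ ?_
    refine ContDiffAt.inv ?_ (Real.sqrt_ne_zero'.2 h3)
    exact Complex.reCLM.contDiff.contDiffAt.sqrt h3.ne'
  · change h.form y (g (h.form y (s y) (s y)) • s y) (g (h.form y (s y) (s y)) • s y) = 1
    rw [map_smul, (h.form y).map_smulₛₗ, LinearMap.smul_apply, smul_eq_mul, smul_eq_mul]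
    simp only [g, Complex.conj_ofReal]
    rw [h.form_self_eq, Complex.ofReal_re, ← Complex.ofReal_mul, ← Complex.ofReal_mul,
      ← Complex.ofReal_one]
    congr 1
    have h4 := Real.mul_self_sqrt h3.le
    have h5 : √(h.form y (s y) (s y)).re ≠ 0 := Real.sqrt_ne_zero'.2 h3
    field_simp
    nlinarith

end RealLineBundle

variable [IsManifold (𝓡 n) ∞ M]

namespace RealLineBundleWithConnection

variable {L : RealLineBundleWithConnection τ} {𝒰 : C2Cover τ.toInvolution}
  {c c' : 𝒰.T2 (deligneComplex2 τ)} {e e' : 𝒰.ι → ∀ x, L.fiber x}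

omit [IsManifold (𝓡 n) ∞ M] in
theorem _root_.RealDeligne.RealLineBundle.HermitianMetric.form_conjSection {L : RealLineBundle τ}
    (h : L.HermitianMetric) (s t : ∀ x, L.fiber x) (x : M) :
    h.form x (L.conjSection s x) (L.conjSection t x) = conj (h.form (τ x) (s (τ x)) (t (τ x))) := by
  rw [← L.σ_conjSection s x, ← L.σ_conjSection t x, h.real, Complex.conj_conj]

/-- Local unit sections around every point, together with their images under `σ` on the translated
neighbourhoods, form a frame over the doubled cover. -/
theorem exists_isFrame (L : RealLineBundleWithConnection τ) :
    ∃ (𝒰 : C2Cover τ.toInvolution) (e : 𝒰.ι → ∀ x, L.fiber x), IsFrame L 𝒰 e := by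
  choose s hs using fun x => L.metric.exists_local_unit_section x
  refine ⟨C2Cover.double τ.toInvolution L.chartSet L.mem_chartSet,
    fun a => bif a.2 then L.conjSection (s a.1) else s a.1, ?_, ?_, ?_⟩
  · rintro ⟨x, _ | _⟩ y hy
    · exact (hs x y hy).1
    · exact (hs x (τ y) hy).1.conjSection
  · rintro ⟨x, _ | _⟩ y hy
    · exact (hs x y hy).2
    · exact (L.metric.form_conjSection _ _ y).trans
        ((congrArg conj (hs x (τ y) hy).2).trans (map_one _))
  · rintro ⟨x, _ | _⟩ y hy
    · exact L.conjSection_apply _ y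
    · exact (L.σ_conjSection _ y).symm

theorem cov_expTwoPi_smul {s : ∀ x, L.fiber x} {φ : M → ℂ} {x : M} (hs : L.DiffAt s x)
    (hφ : MDifferentiableAt (𝓡 n) 𝓘(ℝ, ℂ) φ x) (X : TangentSpace (𝓡 n) x) :
    L.conn.cov (fun y => expTwoPi (φ y) • s y) x X = expTwoPi (φ x) • L.conn.cov s x X +
      (2 * Real.pi * mvfderiv (𝓡 n) φ x X) • expTwoPi (φ x) • s x := by
  rw [L.conn.cov_smul hs (mdifferentiableAt_expTwoPi hφ), mvfderiv_expTwoPi hφ, mul_smul]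

/-- Comparing the Leibniz rule for `exp(2π φ) s` with the connection form of `t` and cancelling the
nonzero vector gives the gauge transformation law. It yields both `α_j - α_i = d f_ij` and `α'_i -
α_i = d b_i`. -/
theorem mvfderiv_eq_of_expTwoPi_smul {s t : ∀ x, L.fiber x} {φ : M → ℂ} {x : M}
    (hs : L.DiffAt s x) (h0 : s x ≠ 0) (hφ : MDifferentiableAt (𝓡 n) 𝓘(ℝ, ℂ) φ x)
    (h : ∀ᶠ y in 𝓝 x, t y = expTwoPi (φ y) • s y) {X : TangentSpace (𝓡 n) x} {a b : ℂ}
    (ha : L.conn.cov s x X = (2 * Real.pi * a) • s x)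
    (hb : L.conn.cov t x X = (2 * Real.pi * b) • t x) : b - a = mvfderiv (𝓡 n) φ x X := by
  have hts : ∀ᶠ y in 𝓝 x, expTwoPi (φ y) • s y = t y := h.mono fun y hy => hy.symm
  have hd : L.DiffAt (fun y => expTwoPi (φ y) • s y) x :=
    hs.csmul (mdifferentiableAt_expTwoPi hφ)
  have h1 := cov_expTwoPi_smul hs hφ X
  rw [L.conn.cov_congr hd hts, hb, ha, h.self_of_nhds, smul_comm (expTwoPi (φ x)), ← add_smul,
    ← mul_add] at h1
  have h2 := smul_left_injective ℂ (smul_ne_zero (expTwoPi_ne_zero (φ x)) h0) h1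
  have h3 : (2 * Real.pi : ℂ) ≠ 0 := by simp [Real.pi_ne_zero]
  rw [mul_left_cancel₀ h3 h2, add_sub_cancel_left]

theorem IsFrame.conjSection_eventually (h : IsFrame L 𝒰 e) {i : 𝒰.ι} {x : M} (hi : x ∈ 𝒰.U i) :
    ∀ᶠ y in 𝓝 (τ x), L.conjSection (e i) y = e (𝒰.inv i) y := by
  filter_upwards [eventually_mem (C2Cover.mem_inv hi)] with y hy
  rw [𝒰.U_inv] at hy
  have h1 := h.real i (τ y) hy
  rw [← L.conjSection_apply (e i) (τ y), τ.involutive y] at h1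
  exact h1.symm

theorem IsFrame.form_real (h : IsFrame L 𝒰 e) {i : 𝒰.ι} {x : M} (hi : x ∈ 𝒰.U i)
    (X : TangentSpace (𝓡 n) x) :
    L.conn.form (e (𝒰.inv i)) (τ x) (mfderiv (𝓡 n) (𝓡 n) τ x X) =
      conj (L.conn.form (e i) x X) := by
  have hd : L.DiffAt (L.conjSection (e i)) (τ x) := by
    refine RealLineBundle.DiffAt.conjSection ?_
    rw [τ.involutive x]
    exact h.diffAt hi
  rw [L.conn.form_apply, L.conn.form_apply, ← L.metric.real, ← L.conn.real _ x (h.diffAt hi),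
    ← h.real i x hi, L.conn.cov_congr hd (h.conjSection_eventually hi)]

theorem IsFrame.trans_real (h : IsFrame L 𝒰 e) (h' : IsFrame L 𝒰 e') {i j : 𝒰.ι} {x : M}
    (hi : x ∈ 𝒰.U i) (hj : x ∈ 𝒰.U j) :
    L.metric.form (τ x) (e (𝒰.inv i) (τ x)) (e' (𝒰.inv j) (τ x)) =
      conj (L.metric.form x (e i x) (e' j x)) := by
  rw [h.real i x hi, h'.real j x hj, L.metric.real]

theorem conj_mul_form {x : M} {v w : L.fiber x} (hv : L.metric.form x v v = 1)
    (hw : L.metric.form x w w = 1) :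
    conj (L.metric.form x v w) * L.metric.form x v w = 1 := by
  rw [← L.metric.form_smul_smul hv, L.metric.form_smul_self hv, hw]

/-- The transition functions of an equivariant frame are unitary and equivariant; after refinement
they have logarithms `f`. The connection forms divided by `2π` give `α`. -/
theorem exists_realizes [T2Space M] [ParacompactSpace M] (L : RealLineBundleWithConnection τ) :
    ∃ (𝒰 : C2Cover τ.toInvolution) (c : 𝒰.T2 (deligneComplex2 τ)),
      c ∈ (𝒰.D2 _).ker ∧ ∃ e, Realizes L 𝒰 c e := by
  obtain ⟨𝒰, e, he⟩ := L.exists_isFrame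
  obtain ⟨𝒱, ρ, f, hf⟩ := exists_log_one_cochain 𝒰
    (fun i j x => L.metric.form x (e i x) (e j x))
    (fun i j x hi hj => L.metric.smooth _ _ x (he.smooth i x hi) (he.smooth j x hj))
    (fun i j x hi hj => conj_mul_form (he.unit i x hi) (he.unit j x hj))
    (fun i j x hi hj => he.trans_real he hi hj)
  have he' := he.pull ρ
  let r : ℂ := ((2 * Real.pi)⁻¹ : ℝ)
  have hr : (2 * Real.pi : ℂ) * r = 1 := by
    simp only [r]
    push_cast
    exact mul_inv_cancel₀ (by simp [Real.pi_ne_zero])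
  have htrans : ∀ i j x, x ∈ 𝒱.U i → x ∈ 𝒱.U j →
      e (ρ.r j) x = expTwoPi (f.1 ![i, j] x) • e (ρ.r i) x := fun i j x hi hj => by
    rw [hf i j x hi hj, L.metric.form_smul_self (he'.unit i x hi)]
  let α : 𝒱.cochain (sheafA1 τ) 0 := C2Cover.mkCochain (sheafA1 τ)
    (fun s x => (ContinuousLinearMap.mul ℝ ℂ r).comp (L.conn.form (e (ρ.r (s 0))) x))
    (fun s => cutoff_mem_sheafA1 (fun x hx X => by
        have hi := C2Cover.mem_inter.1 hx 0
        have := L.conn.form_re (he'.diffAt hi) ((eventually_mem hi).mono (he'.unit _)) X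
        refine (Complex.re_ofReal_mul _ _).trans ?_
        exact mul_eq_zero_of_right _ this)
      (fun x hx => by
        have hi := eventually_mem (C2Cover.mem_inter.1 hx 0)
        exact .mul contMDiffAt_const
          (L.conn.smoothFormAt_form (hi.mono (he'.smooth _)) (hi.mono (he'.unit _)))))
    (fun s x hx => by
      ext X
      change conj (r * L.conn.form (e (ρ.r (𝒱.inv (s 0)))) (τ x)
        (mfderiv (𝓡 n) (𝓡 n) τ x X)) = r * L.conn.form (e (ρ.r (s 0))) x X
      rw [he'.form_real (C2Cover.mem_inter.1 hx 0), map_mul, Complex.conj_conj,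
        Complex.conj_ofReal])
  have hα : ∀ i x, x ∈ 𝒱.U i → α.1 ![i] x =
      (ContinuousLinearMap.mul ℝ ℂ r).comp (L.conn.form (e (ρ.r i)) x) := fun i x hi =>
    C2Cover.mkCochain_apply (F := sheafA1 τ) (C2Cover.mem_inter_one.2 hi)
  have hconn : ∀ i x, x ∈ 𝒱.U i → ∀ X : TangentSpace (𝓡 n) x,
      L.conn.cov (e (ρ.r i)) x X =
        (2 * Real.pi * (α.1 ![i] x : TangentSpace (𝓡 n) x →L[ℝ] ℂ) X) • e (ρ.r i) x :=
    fun i x hi X => by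
      rw [hα i x hi, ContinuousLinearMap.comp_apply, ContinuousLinearMap.mul_apply', ← mul_assoc,
        hr, one_mul, L.conn.form_smul (he'.unit i x hi)]
  -- Going from `e_i` to `e_k` directly or through `e_j` gives the same result, so the exponential
  -- of the Čech defect of `f` is one.
  obtain ⟨c, hc, hcf⟩ := exists_mem_ker f α (fun i j k x hi hj hk => by
      apply expTwoPi_eq_one
      have h1 := htrans i j x hi hj
      have h2 := htrans j k x hj hk
      rw [h1, smul_smul, htrans i k x hi hk] at h2
      have h3 := smul_left_injective ℂ (he'.ne_zero hi) h2
      rw [expTwoPi_add, sub_eq_add_neg, expTwoPi_add, expTwoPi_neg, mul_right_comm, ← h3,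
        mul_inv_cancel₀ (expTwoPi_ne_zero _)])
    (fun i j x hi hj => by
      ext X
      refine mvfderiv_eq_of_expTwoPi_smul (he'.diffAt hi) (he'.ne_zero hi)
        (((f.2.1 ![i, j]).2.2 x (C2Cover.mem_inter_two.2 ⟨hi, hj⟩)).mdifferentiableAt (by simp))
        ?_ (hconn i x hi X) (hconn j x hj X)
      filter_upwards [eventually_mem hi, eventually_mem hj] with y h1 h2 using htrans i j y h1 h2)
  refine ⟨𝒱, c, hc, _, he', ?_, ?_⟩
  · intro i j x hi hj
    have : logTrans c i j = f.1 ![i, j] := congrFun (congrArg (fun z => z.1.1) hcf) _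
    rw [this]
    exact htrans i j x hi hj
  · intro i x hi X
    have : potential c i = α.1 ![i] := congrFun (congrArg (fun z => z.2.1) hcf) _
    rw [this]
    exact hconn i x hi X

/-- Two frames of one bundle differ by unitary functions `h(e_i, e'_i)`, whose logarithms on a
refinement give `b`. Exponentiating shows that `∂b` and `f' - f` agree modulo `iℤ`. -/
theorem Realizes.exists_sub_eq_D1 (h : Realizes L 𝒰 c e) (h' : Realizes L 𝒰 c' e')
    (hc : c ∈ (𝒰.D2 _).ker) (hc' : c' ∈ (𝒰.D2 _).ker) :
    ∃ (𝒱 : C2Cover τ.toInvolution) (ρ : C2Cover.Refinement 𝒱 𝒰)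
      (b : 𝒱.T1 (deligneComplex2 τ)), ρ.pullT2 _ c' - ρ.pullT2 _ c = 𝒱.D1 _ b := by
  obtain ⟨𝒱, ρ, b, hb⟩ := exists_log_zero_cochain 𝒰
    (fun i x => L.metric.form x (e i x) (e' i x))
    (fun i x hi => L.metric.smooth _ _ x (h.smooth i x hi) (h'.smooth i x hi))
    (fun i x hi => conj_mul_form (h.unit i x hi) (h'.unit i x hi))
    (fun i x hi => h.trans_real h'.toIsFrame hi hi)
  have hr := h.pull ρ
  have hr' := h'.pull ρ
  have hE : ∀ i x, x ∈ 𝒱.U i → e' (ρ.r i) x = expTwoPi (b.1 ![i] x) • e (ρ.r i) x :=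
    fun i x hi => by rw [hb i x hi, L.metric.form_smul_self (hr.unit i x hi)]
  obtain ⟨m, hm⟩ := RealDeligne.exists_sub_eq_D1 (ρ.pullCocycle _ ⟨c, hc⟩).2
    (ρ.pullCocycle _ ⟨c', hc'⟩).2 b (fun i j x hi hj => by
      apply expTwoPi_eq_one
      have h1 := hr'.trans i j x hi hj
      rw [hE i x hi, hE j x hj, hr.trans i j x hi hj, smul_smul, smul_smul] at h1
      have h2 := smul_left_injective ℂ (hr.ne_zero hi) h1
      change expTwoPi (_ - _ - (logTrans (ρ.pullT2 _ c') i j x - logTrans (ρ.pullT2 _ c) i j x)) = 1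
      dsimp only at h2
      rw [← expTwoPi_add, ← expTwoPi_add] at h2
      have h3 : ∀ p q r s : ℂ, p - q - (r - s) = (p + s) + -(r + q) := fun p q r s => by ring
      rw [h3, expTwoPi_add, h2, expTwoPi_neg, mul_inv_cancel₀ (expTwoPi_ne_zero _)])
    (fun i x hi => by
      ext X
      refine mvfderiv_eq_of_expTwoPi_smul (hr.diffAt hi) (hr.ne_zero hi)
        (((b.2.1 ![i]).2.2 x (C2Cover.mem_inter_one.2 hi)).mdifferentiableAt (by simp))
        ?_ (hr.conn i x hi X) (hr'.conn i x hi X)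
      filter_upwards [eventually_mem hi] with y hy using hE i y hy)
  exact ⟨𝒱, ρ, (m, b), hm⟩

end RealLineBundleWithConnection

end RealDeligne

/-! ### The colimit, the group structure and the isomorphism. -/

namespace RealDeligne

theorem nonempty_addEquiv_of_hom {H A : Type*} [AddCommGroup H] [AddCommGroup A] (Φ : H →+ A)
    (hinj : ∀ z, Φ z = 0 → z = 0) (hsurj : ∀ a, ∃ z, Φ z = a) : Nonempty (A ≃+ H) :=
  ⟨(AddEquiv.ofBijective Φ ⟨(injective_iff_map_eq_zero Φ).2 hinj, hsurj⟩).symm⟩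

section hypercohomology

variable {M : Type u} [TopologicalSpace M] {τ : Involution M} (K : C2Complex τ)

open Classical in
/-- The class of a cocycle on a `C_2`-cover in the equivariant Čech hypercohomology. -/
def hyperClass (𝒰 : C2Cover τ) : (𝒰.D2 K).ker →+ Hypercohomology2 K :=
  (QuotientAddGroup.mk' (hypercohomologyRelations K)).comp
    ((DirectSum.of (fun 𝒲 : C2Cover τ => 𝒲.H2 K) 𝒰).comp (QuotientAddGroup.mk' _))

variable {K}

theorem hyperClass_pull {𝒰 𝒱 : C2Cover τ} (ρ : C2Cover.Refinement 𝒱 𝒰) (c : (𝒰.D2 K).ker) :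
    hyperClass K 𝒱 (ρ.pullCocycle K c) = hyperClass K 𝒰 c := by
  classical
  refine QuotientAddGroup.eq_iff_sub_mem.2 (AddSubgroup.subset_closure ?_)
  exact ⟨𝒰, 𝒱, ρ, QuotientAddGroup.mk c, rfl⟩

theorem hyperClass_eq_of_sub {𝒰 : C2Cover τ} {c c' : (𝒰.D2 K).ker} {b : 𝒰.T1 K}
    (h : c'.1 - c.1 = 𝒰.D1 K b) : hyperClass K 𝒰 c' = hyperClass K 𝒰 c := by
  have h1 : (QuotientAddGroup.mk' ((𝒰.D1 K).range.addSubgroupOf (𝒰.D2 K).ker)) c' =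
      QuotientAddGroup.mk' _ c :=
    QuotientAddGroup.eq_iff_sub_mem.2 ⟨b, h.symm⟩
  simp only [hyperClass, AddMonoidHom.comp_apply, h1]

/-- Any two covers have the common refinement `C2Cover.prod`, so a finite sum of classes can be
represented on a single cover. -/
theorem exists_hyperClass (z : Hypercohomology2 K) : ∃ 𝒰 c, hyperClass K 𝒰 c = z := by
  classical
  obtain ⟨w, rfl⟩ := QuotientAddGroup.mk_surjective z
  induction w using DirectSum.induction_on with
  | zero =>
    exact ⟨C2Cover.double τ (fun _ => ⊤) fun _ => trivial, 0, map_zero _⟩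
  | of 𝒰 a =>
    obtain ⟨c, rfl⟩ := QuotientAddGroup.mk_surjective a
    exact ⟨𝒰, c, by simp only [hyperClass]; congr 1⟩
  | add v w hv hw =>
    obtain ⟨𝒰, c, hc⟩ := hv
    obtain ⟨𝒱, d, hd⟩ := hw
    refine ⟨𝒰.prod 𝒱, (𝒰.prodFst 𝒱).pullCocycle K c + (𝒰.prodSnd 𝒱).pullCocycle K d, ?_⟩
    rw [map_add, hyperClass_pull, hyperClass_pull, hc, hd]
    rfl

/-- A homomorphism on the equivariant Čech hypercohomology is given by homomorphisms on cocycles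
that vanish on coboundaries and are compatible with refinements. -/
theorem exists_hom_hypercohomology {A : Type*} [AddCommGroup A]
    (φ : ∀ 𝒰 : C2Cover τ, (𝒰.D2 K).ker →+ A)
    (h : ∀ (𝒰 : C2Cover τ) (c : (𝒰.D2 K).ker) b, c.1 = 𝒰.D1 K b → φ 𝒰 c = 0)
    (h' : ∀ (𝒰 𝒱 : C2Cover τ) (ρ : C2Cover.Refinement 𝒱 𝒰) (c : (𝒰.D2 K).ker),
      φ 𝒱 (ρ.pullCocycle K c) = φ 𝒰 c) :
    ∃ Φ : Hypercohomology2 K →+ A, ∀ 𝒰 c, Φ (hyperClass K 𝒰 c) = φ 𝒰 c := by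
  classical
  let ψ : ∀ 𝒰 : C2Cover τ, 𝒰.H2 K →+ A := fun 𝒰 => QuotientAddGroup.lift _ (φ 𝒰) (by
    rintro c ⟨b, hb⟩
    exact h 𝒰 c b hb.symm)
  refine ⟨QuotientAddGroup.lift _ (DirectSum.toAddMonoid ψ) ?_, fun 𝒰 c => ?_⟩
  · refine (AddSubgroup.closure_le _).2 ?_
    rintro _ ⟨𝒰, 𝒱, ρ, a, rfl⟩
    obtain ⟨c, rfl⟩ := QuotientAddGroup.mk_surjective a
    have h1 : ∀ 𝒲 x, DirectSum.toAddMonoid ψ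
        (DirectSum.of (fun 𝒲 : C2Cover τ => 𝒲.H2 K) 𝒲 x) = ψ 𝒲 x :=
      fun 𝒲 x => DirectSum.toAddMonoid_of ψ 𝒲 x
    refine (map_sub (DirectSum.toAddMonoid ψ) _ _).trans (sub_eq_zero.2 ?_)
    refine (h1 _ _).trans (Eq.trans ?_ (h1 _ _).symm)
    exact h' 𝒰 𝒱 ρ c
  · exact DirectSum.toAddMonoid_of ψ 𝒰 _

theorem exists_addEquiv_hypercohomology {A : Type*} [AddCommGroup A]
    (φ : ∀ 𝒰 : C2Cover τ, (𝒰.D2 K).ker →+ A)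
    (h : ∀ (𝒰 : C2Cover τ) (c : (𝒰.D2 K).ker) b, c.1 = 𝒰.D1 K b → φ 𝒰 c = 0)
    (h' : ∀ (𝒰 𝒱 : C2Cover τ) (ρ : C2Cover.Refinement 𝒱 𝒰) (c : (𝒰.D2 K).ker),
      φ 𝒱 (ρ.pullCocycle K c) = φ 𝒰 c)
    (hinj : ∀ 𝒰 c, φ 𝒰 c = 0 → hyperClass K 𝒰 c = 0) (hsurj : ∀ a, ∃ 𝒰 c, φ 𝒰 c = a) :
    Nonempty (A ≃+ Hypercohomology2 K) := by
  obtain ⟨Φ, hΦ⟩ := exists_hom_hypercohomology φ h h'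
  refine nonempty_addEquiv_of_hom Φ (fun z hz => ?_) fun a => ?_
  · obtain ⟨𝒰, c, rfl⟩ := exists_hyperClass z
    exact hinj 𝒰 c ((hΦ 𝒰 c).symm.trans hz)
  · obtain ⟨𝒰, c, rfl⟩ := hsurj a
    exact ⟨hyperClass K 𝒰 c, hΦ 𝒰 c⟩

end hypercohomology

namespace RealLineBundleWithConnection

variable {n : ℕ} {M : Type u} [TopologicalSpace M] [ChartedSpace (EuclideanSpace ℝ (Fin n)) M]
  [IsManifold (𝓡 n) ∞ M] {τ : SmoothInvolution n M}

section

variable {𝒰 𝒱 : C2Cover τ.toInvolution} {L L' L'' : RealLineBundleWithConnection τ}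

/-- The isomorphism class of the line bundle with connection of a cocycle. -/
def lineClass (𝒰 : C2Cover τ.toInvolution) (c : (𝒰.D2 (deligneComplex2 τ)).ker) : Classes τ :=
  toClass (cocycleLine c.1 c.2)

theorem toClass_eq_iff : toClass L = toClass L' ↔ Nonempty (Iso L L') :=
  Quotient.eq (r := setoid τ)

theorem Realizes.toClass_eq {c : (𝒰.D2 (deligneComplex2 τ)).ker} {e : 𝒰.ι → ∀ x, L.fiber x}
    (h : Realizes L 𝒰 c.1 e) : toClass L = lineClass 𝒰 c :=
  toClass_eq_iff.2 ⟨isoOfRealizes h (cocycleLine_realizes c.1 c.2)⟩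

theorem exists_realizes_of_toClass_eq {c : (𝒰.D2 (deligneComplex2 τ)).ker}
    (h : toClass L = lineClass 𝒰 c) : ∃ e, Realizes L 𝒰 c.1 e :=
  let ⟨f⟩ := toClass_eq_iff.1 h.symm
  ⟨_, (cocycleLine_realizes c.1 c.2).iso f⟩

theorem lineClass_pull (ρ : C2Cover.Refinement 𝒱 𝒰) (c : (𝒰.D2 (deligneComplex2 τ)).ker) :
    lineClass 𝒱 (ρ.pullCocycle _ c) = lineClass 𝒰 c :=
  (Realizes.toClass_eq (c := ρ.pullCocycle _ c) ((cocycleLine_realizes c.1 c.2).pull ρ)).symm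

/-- Both zero cocycles pull back to the zero cocycle on the common refinement. -/
theorem lineClass_zero (𝒰 𝒱 : C2Cover τ.toInvolution) : lineClass 𝒰 0 = lineClass 𝒱 0 := by
  rw [← lineClass_pull (𝒰.prodFst 𝒱), ← lineClass_pull (𝒰.prodSnd 𝒱), map_zero, map_zero]

theorem lineClass_eq_of_sub {c c' : (𝒰.D2 (deligneComplex2 τ)).ker}
    {b : 𝒰.T1 (deligneComplex2 τ)} (h : c'.1 - c.1 = 𝒰.D1 _ b) :
    lineClass 𝒰 c' = lineClass 𝒰 c := by
  have h1 := (cocycleLine_realizes c.1 c.2).add_D1 b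
  rw [← h, add_sub_cancel] at h1
  exact h1.toClass_eq.symm

theorem exists_tensorIso {c c' : (𝒰.D2 (deligneComplex2 τ)).ker} (h : toClass L = lineClass 𝒰 c)
    (h' : toClass L' = lineClass 𝒰 c') (h'' : toClass L'' = lineClass 𝒰 (c + c')) :
    Nonempty (TensorIso L L' L'') := by
  obtain ⟨e, he⟩ := exists_realizes_of_toClass_eq h
  obtain ⟨e', he'⟩ := exists_realizes_of_toClass_eq h'
  obtain ⟨e'', he''⟩ := exists_realizes_of_toClass_eq h''
  exact ⟨tensorIsoOfRealizes he he' he''⟩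

theorem TensorIso.toClass_eq (f : TensorIso L L' L'') {c c' : (𝒰.D2 (deligneComplex2 τ)).ker}
    (h : toClass L = lineClass 𝒰 c) (h' : toClass L' = lineClass 𝒰 c') :
    toClass L'' = lineClass 𝒰 (c + c') := by
  obtain ⟨e, he⟩ := exists_realizes_of_toClass_eq h
  obtain ⟨e', he'⟩ := exists_realizes_of_toClass_eq h'
  exact Realizes.toClass_eq (c := c + c') (he.tensor he' f)

/-- The bundle of `c + c'` is a tensor product of the bundles of `c` and `c'`, and a tensor product
has its class determined by those of the factors. This makes the group law well defined across
covers. -/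
theorem lineClass_add_congr {c c' : (𝒰.D2 (deligneComplex2 τ)).ker}
    {d d' : (𝒱.D2 (deligneComplex2 τ)).ker} (h : lineClass 𝒰 c = lineClass 𝒱 d)
    (h' : lineClass 𝒰 c' = lineClass 𝒱 d') : lineClass 𝒰 (c + c') = lineClass 𝒱 (d + d') := by
  obtain ⟨f⟩ := exists_tensorIso (c := c) (c' := c') rfl rfl rfl
  exact f.toClass_eq h h'

/-- Injectivity: the bundle of `c` also realizes `c'`, so the two cocycles differ by a coboundary
after refinement. -/
theorem hyperClass_eq_of_lineClass_eq {c c' : (𝒰.D2 (deligneComplex2 τ)).ker}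
    (h : lineClass 𝒰 c = lineClass 𝒰 c') : hyperClass _ 𝒰 c = hyperClass _ 𝒰 c' := by
  obtain ⟨e, he⟩ := exists_realizes_of_toClass_eq (L := cocycleLine c.1 c.2) h
  obtain ⟨𝒱, ρ, b, hb⟩ := he.exists_sub_eq_D1 (cocycleLine_realizes c.1 c.2) c'.2 c.2
  rw [← hyperClass_pull ρ c, ← hyperClass_pull ρ c']
  exact hyperClass_eq_of_sub hb

end

variable [T2Space M] [ParacompactSpace M]

theorem exists_lineClass (a : Classes τ) : ∃ 𝒰 c, a = lineClass 𝒰 c := by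
  induction a using Quotient.inductionOn with
  | h L =>
    obtain ⟨𝒰, c, hc, e, he⟩ := L.exists_realizes
    exact ⟨𝒰, ⟨c, hc⟩, Realizes.toClass_eq (c := ⟨c, hc⟩) he⟩

theorem exists_lineClass_two (a b : Classes τ) :
    ∃ 𝒰 c c', a = lineClass 𝒰 c ∧ b = lineClass 𝒰 c' := by
  obtain ⟨𝒰, c, rfl⟩ := exists_lineClass a
  obtain ⟨𝒱, d, rfl⟩ := exists_lineClass b
  exact ⟨𝒰.prod 𝒱, (𝒰.prodFst 𝒱).pullCocycle _ c, (𝒰.prodSnd 𝒱).pullCocycle _ d,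
    (lineClass_pull _ c).symm, (lineClass_pull _ d).symm⟩

theorem exists_lineClass_three (a b d : Classes τ) :
    ∃ 𝒰 c c' c'', a = lineClass 𝒰 c ∧ b = lineClass 𝒰 c' ∧ d = lineClass 𝒰 c'' := by
  obtain ⟨𝒰, c, c', rfl, rfl⟩ := exists_lineClass_two a b
  obtain ⟨𝒱, c'', rfl⟩ := exists_lineClass d
  exact ⟨𝒰.prod 𝒱, (𝒰.prodFst 𝒱).pullCocycle _ c, (𝒰.prodFst 𝒱).pullCocycle _ c',
    (𝒰.prodSnd 𝒱).pullCocycle _ c'', (lineClass_pull _ c).symm, (lineClass_pull _ c').symm,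
    (lineClass_pull _ c'').symm⟩

/-- The product of isomorphism classes, given by the sum of cocycles. -/
def classMul (a b : Classes τ) : Classes τ :=
  lineClass _ ((exists_lineClass_two a b).choose_spec.choose +
    (exists_lineClass_two a b).choose_spec.choose_spec.choose)

theorem classMul_lineClass {𝒰 : C2Cover τ.toInvolution}
    (c c' : (𝒰.D2 (deligneComplex2 τ)).ker) :
    classMul (lineClass 𝒰 c) (lineClass 𝒰 c') = lineClass 𝒰 (c + c') :=
  have h := (exists_lineClass_two (lineClass 𝒰 c)
    (lineClass 𝒰 c')).choose_spec.choose_spec.choose_spec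
  lineClass_add_congr h.1.symm h.2.symm

/-- Any two or three classes come from cocycles on one cover, so the group axioms are inherited from
the additive groups of cocycles. -/
theorem exists_commGroup : ∃ _ : CommGroup (Classes τ), ∀ (𝒰 : C2Cover τ.toInvolution)
    (c c' : (𝒰.D2 (deligneComplex2 τ)).ker),
    lineClass 𝒰 (c + c') = lineClass 𝒰 c * lineClass 𝒰 c' := by
  let 𝒰₀ : C2Cover τ.toInvolution := C2Cover.double _ (fun _ => ⊤) fun _ => trivial
  have hinv : ∀ a : Classes τ, ∃ b, classMul b a = lineClass 𝒰₀ 0 := by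
    intro a
    obtain ⟨𝒰, c, rfl⟩ := exists_lineClass a
    exact ⟨lineClass 𝒰 (-c), by rw [classMul_lineClass, neg_add_cancel, lineClass_zero]⟩
  choose inv hinv using hinv
  let _ : Mul (Classes τ) := ⟨classMul⟩
  let _ : One (Classes τ) := ⟨lineClass 𝒰₀ 0⟩
  let _ : Inv (Classes τ) := ⟨inv⟩
  let G : Group (Classes τ) := Group.ofLeftAxioms (fun a b d => by
      obtain ⟨𝒰, c, c', c'', rfl, rfl, rfl⟩ := exists_lineClass_three a b d
      change classMul (classMul _ _) _ = classMul _ (classMul _ _)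
      simp only [classMul_lineClass, add_assoc])
    (fun a => by
      obtain ⟨𝒰, c, rfl⟩ := exists_lineClass a
      change classMul (lineClass 𝒰₀ 0) _ = _
      rw [lineClass_zero 𝒰₀ 𝒰, classMul_lineClass, zero_add])
    hinv
  refine ⟨{ G with mul_comm := fun a b => ?_ }, fun 𝒰 c c' => (classMul_lineClass c c').symm⟩
  obtain ⟨𝒰, c, c', rfl, rfl⟩ := exists_lineClass_two a b
  change classMul _ _ = classMul _ _
  rw [classMul_lineClass, classMul_lineClass, add_comm]

theorem nonempty_classes_addEquiv (G : CommGroup (Classes τ))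
    (hG : ∀ (𝒰 : C2Cover τ.toInvolution) (c c' : (𝒰.D2 (deligneComplex2 τ)).ker),
      lineClass 𝒰 (c + c') = lineClass 𝒰 c * lineClass 𝒰 c') :
    Nonempty (Additive (Classes τ) ≃+ DeligneH2 τ) := by
  have h0 : ∀ 𝒰 : C2Cover τ.toInvolution, lineClass 𝒰 0 = (1 : Classes τ) := fun 𝒰 => by
    have := hG 𝒰 0 0
    rwa [add_zero, left_eq_mul] at this
  refine exists_addEquiv_hypercohomology (K := deligneComplex2 τ)
    (fun 𝒰 => ⟨⟨fun c => Additive.ofMul (lineClass 𝒰 c), h0 𝒰⟩, hG 𝒰⟩)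
    (fun 𝒰 c b hb => (lineClass_eq_of_sub (c := 0) (b := b) (by
      rw [hb]; exact sub_zero _)).trans (h0 𝒰))
    (fun 𝒰 𝒱 ρ c => lineClass_pull ρ c) (fun 𝒰 c hc => ?_) (fun a => ?_)
  · have h1 : lineClass 𝒰 c = lineClass 𝒰 0 := Eq.trans hc (h0 𝒰).symm
    exact (hyperClass_eq_of_lineClass_eq h1).trans (map_zero _)
  · obtain ⟨𝒰, c, h⟩ := exists_lineClass a.toMul
    exact ⟨𝒰, c, h.symm⟩

theorem exists_tensor (L L' : RealLineBundleWithConnection τ) :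
    ∃ L'' : RealLineBundleWithConnection τ, Nonempty (L.TensorIso L' L'') := by
  obtain ⟨𝒰, c, c', h, h'⟩ := exists_lineClass_two L.toClass L'.toClass
  exact ⟨cocycleLine (c + c').1 (c + c').2, exists_tensorIso h h' rfl⟩

end RealLineBundleWithConnection

end RealDeligne

end

theorem mainTheorem3 {n : ℕ} {M : Type*} [TopologicalSpace M]
    [ChartedSpace (EuclideanSpace ℝ (Fin n)) M] [IsManifold (𝓡 n) ∞ M]
    [T2Space M] [ParacompactSpace M] (τ : RealDeligne.SmoothInvolution n M) :
    (∀ L L' : RealDeligne.RealLineBundleWithConnection τ,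
      ∃ L'' : RealDeligne.RealLineBundleWithConnection τ, Nonempty (L.TensorIso L' L'')) ∧
    ∃ _ : CommGroup (RealDeligne.RealLineBundleWithConnection.Classes τ),
      (∀ L L' L'' : RealDeligne.RealLineBundleWithConnection τ,
        Nonempty (L.TensorIso L' L'') → L.toClass * L'.toClass = L''.toClass) ∧
      Nonempty (Additive (RealDeligne.RealLineBundleWithConnection.Classes τ) ≃+
        RealDeligne.DeligneH2 τ) := by
  refine ⟨RealDeligne.RealLineBundleWithConnection.exists_tensor, ?_⟩
  obtain ⟨G, hG⟩ := RealDeligne.RealLineBundleWithConnection.exists_commGroup (τ := τ)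
  refine ⟨G, fun L L' L'' ⟨f⟩ => ?_,
    RealDeligne.RealLineBundleWithConnection.nonempty_classes_addEquiv G hG⟩
  -- Represent both factors on one cover; there the tensor product realizes the sum of the cocycles.
  obtain ⟨𝒰, c, c', h, h'⟩ :=
    RealDeligne.RealLineBundleWithConnection.exists_lineClass_two L.toClass L'.toClass
  rw [f.toClass_eq h h', h, h', hG]
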